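/- For $n\ge 2$, $k\ge 1$ and $\vec\alpha_i=(\alpha_{i1},\dots,\alpha_{i\,n-1})\in\mathbb R^{n-1}$ ($1\le i\le k$), let $nHT_{\vec\alpha_1,\dots,\vec\alpha_k}$ be the $n$-linear operator given, for Schwartz functions $f,f_1,\dots,f_{n-1}$ on $\mathbb R$, by $$nHT_{\vec\alpha_1,\dots,\vec\alpha_k}(f,f_1,\dots,f_{n-1})(x)=\int_{\mathbb R^n}\prod_{i=1}^k\operatorname{sgn}(\xi+\alpha_{i1}\xi_1+\dots+\alpha_{i\,n-1}\xi_{n-1})\,\widehat f(\xi)\widehat{f_1}(\xi_1)\cdots\widehat{f_{n-1}}(\xi_{n-1})\,e^{2\pi i x(\xi+\xi_1+\dots+\xi_{n-1})}\,d\xi\,d\xi_1\cdots d\xi_{n-1},$$ where $\widehat f(\xi)=\int f(y)e^{-2\pi i y\xi}\,dy$. Say that an $n$-linear operator $T$ satisfies no $L^p$ estimate of Hölder type if, for all $1<p_1,\dots,p_n\le\infty$ and $0<p<\infty$ with $1/p_1+\dots+1/p_n=1/p$, there is no finite constant $C$ such that $\|T(g_1,\dots,g_n)\|_p\le C\|g_1\|_{p_1}\cdots\|g_n\|_{p_n}$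 for all Schwartz functions $g_1,\dots,g_n$. Say that a property holds for generic $(\vec\alpha_1,\dots,\vec\alpha_k)$ if it holds off the zero set of some nonzero real polynomial in the $k(n-1)$ entries $\alpha_{ij}$. For real $\#,\#_1,\dots,\#_{n-1}$ put $$\Phi(x,t_1,\dots,t_k)=\#\,(x+t_1+\dots+t_k)^k+\sum_{j=1}^{n-1}\#_j\,(x+\alpha_{1j}t_1+\dots+\alpha_{kj}t_k)^k .$$ For $N>1$ and $\epsilon>0$, an $(N,\epsilon)$-cutoff is a smooth function $\chi:\mathbb R\to[0,1]$ that equals $1$ on $[-N,N]$ and is supported in $[-N-\epsilon,N+\epsilon]$; given such a $\chi$, put $f(y)=\chi(y)e^{i\# y^k}$ and $f_j(y)=\chi(y)e^{i\#_j y^k}$. (1) Let $k\ge 2$, $N(k)=\frac{(2k)!}{(k!)^2}-1$ and $n\ge N(k)$. Then for generic $\vec\alpha_1,\dots,\vec\alpha_k\in\mathbb R^{n-1}$: (a) $nHT_{\vec\alpha_1,\dots,\vec\alpha_k}$ satisfies no $L^p$ estimate of Hölder type; (b) there are real numbers $\#,\#_1,\dots,\#_{n-1}$ for which all monomials of $\Phi$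 vanish except those in $x^k$ and $t_1\cdots t_k$, and the coefficient of $t_1\cdots t_k$ is $1$; (c) for any such numbers there are $c,\widetilde c>0$ and $N_0>1$, depending only on $n$, $k$, the $\vec\alpha_i$ and $\#,\#_1,\dots,\#_{n-1}$, such that for every real $N\ge N_0$, every $0<\epsilon\le 1/N^{k-1}$ and every $(N,\epsilon)$-cutoff, $$|nHT_{\vec\alpha_1,\dots,\vec\alpha_k}(f,f_1,\dots,f_{n-1})(x)|\ge c(\log N)^{k-1}\qquad\text{whenever } |x|\le\widetilde c N .$$ (2) Let $k=2$ and $n=4$. Then for generic $\vec\alpha_1,\vec\alpha_2\in\mathbb R^3$: (a) $4HT_{\vec\alpha_1,\vec\alpha_2}$ satisfies no $L^p$ estimate of Hölder type; (b) there are real numbers $\#,\#_1,\#_2,\#_3$ with $\Phi=Ax^2+a t_2^2+b\,t_1t_2$ for some real $A$, some $a>0$ and some $b\neq 0$; (c) for any such numbers there are $c,\widetilde c>0$ and $N_0>1$ such that for every real $N\ge N_0$ there are an $\epsilon\in(0,1/N]$ and an $(N,\epsilon)$-cutoff with $|4HT_{\vec\alpha_1,\vec\alpha_2}(f,f_1,f_2,f_3)(x)|\ge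 c\log N$ whenever $|x|\le\widetilde c N$. -/

import Mathlib

open MeasureTheory
open scoped FourierTransform SchwartzMap ENNReal NNReal ContDiff Nat

noncomputable section

/-- The product symbol `∏ᵢ sgn (ξ₀ + αᵢ₁ ξ₁ + ⋯ + αᵢₘ ξₘ)` on `ℝⁿ`, where `n = m + 1`.
The coordinate `ξ 0` is the frequency of the distinguished function `f`, and `ξ j.succ` is the
frequency of the `j`-th of the remaining `n - 1` functions. -/
def productSymbol {k m : ℕ} (α : Fin k → Fin m → ℝ) (ξ : Fin (m + 1) → ℝ) : ℝ :=
  ∏ i : Fin k, Real.sign (ξ 0 + ∑ j : Fin m, α i j * ξ j.succ)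

/-- The `n`-linear operator (`n = m + 1`) with the product symbol:
`∫_{ℝⁿ} symbol(ξ) f̂₀(ξ₀) ⋯ f̂ₘ(ξₘ) exp(2πi x (ξ₀ + ⋯ + ξₘ)) dξ`,
where `f̂(ξ) = ∫ f(y) exp(-2πi y ξ) dy`. The integral converges absolutely for Schwartz functions,
the only ones to which the operator is applied. -/
def nHT {k m : ℕ} (α : Fin k → Fin m → ℝ) (f : Fin (m + 1) → ℝ → ℂ) (x : ℝ) : ℂ :=
  ∫ ξ : Fin (m + 1) → ℝ,
    (productSymbol α ξ : ℂ) * (∏ j, 𝓕 (f j) (ξ j)) *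
      Complex.exp (2 * Real.pi * Complex.I * x * ((∑ j, ξ j : ℝ) : ℂ))

/-- The a priori estimate `‖T(f₁, …, fₙ)‖_q ≤ C ‖f₁‖_{p₁} ⋯ ‖fₙ‖_{pₙ}` for Schwartz functions,
with a finite constant `C`. -/
def SatisfiesEstimate {n : ℕ} (T : (Fin n → ℝ → ℂ) → ℝ → ℂ) (p : Fin n → ℝ≥0∞) (q : ℝ≥0∞) :
    Prop :=
  ∃ C : ℝ≥0, ∀ f : Fin n → 𝓢(ℝ, ℂ),
    eLpNorm (T fun j => ⇑(f j)) q volume ≤ C * ∏ j, eLpNorm (⇑(f j)) (p j) volume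

/-- `T` satisfies no `Lᵖ` estimate of Hölder type: for all `1 < p₁, …, pₙ ≤ ∞` and `0 < q < ∞`
with `1/p₁ + ⋯ + 1/pₙ = 1/q`, the estimate fails. (Here `∞⁻¹ = 0` in `ℝ≥0∞`.) -/
def SatisfiesNoHolderEstimate {n : ℕ} (T : (Fin n → ℝ → ℂ) → ℝ → ℂ) : Prop :=
  ∀ (p : Fin n → ℝ≥0∞) (q : ℝ≥0∞), (∀ j, 1 < p j) → 0 < q → q < ⊤ →
    ∑ j, (p j)⁻¹ = q⁻¹ → ¬ SatisfiesEstimate T p q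

/-- A property holds for generic `(α₁, …, αₖ) ∈ (ℝᵐ)ᵏ` if it holds off a proper algebraic subset,
that is, off the zero set of a polynomial that is not the zero polynomial. -/
def ForGeneric {k m : ℕ} (Q : (Fin k → Fin m → ℝ) → Prop) : Prop :=
  ∃ P : MvPolynomial (Fin k × Fin m) ℝ, P ≠ 0 ∧
    ∀ α : Fin k → Fin m → ℝ, MvPolynomial.eval (fun ij => α ij.1 ij.2) P ≠ 0 → Q α

/-- The polynomial `#₀ (x + t₁ + ⋯ + tₖ)ᵏ + ∑ⱼ #ⱼ (x + α₁ⱼ t₁ + ⋯ + αₖⱼ tₖ)ᵏ` in `x, t₁, …, tₖ`. -/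
def phasePolynomial {k m : ℕ} (α : Fin k → Fin m → ℝ) (θ : Fin (m + 1) → ℝ)
    (x : ℝ) (t : Fin k → ℝ) : ℝ :=
  θ 0 * (x + ∑ i, t i) ^ k + ∑ j : Fin m, θ j.succ * (x + ∑ i, α i j * t i) ^ k

/-- The phases kill all monomials except `xᵏ` and `t₁ ⋯ tₖ`, the latter having coefficient `1`. -/
def KillsAllButProduct {k m : ℕ} (α : Fin k → Fin m → ℝ) (θ : Fin (m + 1) → ℝ) : Prop :=
  ∃ A : ℝ, ∀ (x : ℝ) (t : Fin k → ℝ), phasePolynomial α θ x t = A * x ^ k + ∏ i, t i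

/-- For `k = 2`: the phases kill the monomials `x t₁`, `x t₂`, `t₁²`, while `t₂²` has a positive
and `t₁ t₂` a nonzero coefficient. -/
def KillsMixedAndOneSquare {m : ℕ} (α : Fin 2 → Fin m → ℝ) (θ : Fin (m + 1) → ℝ) : Prop :=
  ∃ A a b : ℝ, 0 < a ∧ b ≠ 0 ∧ ∀ (x : ℝ) (t : Fin 2 → ℝ),
    phasePolynomial α θ x t = A * x ^ 2 + a * t 1 ^ 2 + b * (t 0 * t 1)

/-- `χ` is a smooth cutoff with values in `[0, 1]`, equal to `1` on `[-N, N]` and supported in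
`[-N - ε, N + ε]`. -/
structure IsSmoothCutoff (N ε : ℝ) (χ : ℝ → ℝ) : Prop where
  contDiff : ContDiff ℝ ∞ χ
  nonneg : ∀ y, 0 ≤ χ y
  le_one : ∀ y, χ y ≤ 1
  eq_one : ∀ y ∈ Set.Icc (-N) N, χ y = 1
  tsupport_subset : tsupport χ ⊆ Set.Icc (-N - ε) (N + ε)

/-- The tuple of functions `y ↦ χ(y) exp(i #ⱼ yᵏ)`. -/
def chirp (k : ℕ) {n : ℕ} (θ : Fin n → ℝ) (χ : ℝ → ℝ) : Fin n → ℝ → ℂ :=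
  fun j y => (χ y : ℂ) * Complex.exp (Complex.I * ((θ j * y ^ k : ℝ) : ℂ))

/-- `N(k) = (2k)! / (k!)² - 1`; the division is exact, and the quotient is at least `1`. -/
def thresholdN (k : ℕ) : ℕ := (2 * k)! / (k !) ^ 2 - 1

end

/-!
The proof passes from the symbol to a singular kernel and computes with it exactly.

Since `sgn η` is a multiple of the limit of `∫_{|t| ≤ ρ} sin (2π η t) / t dt`, the operator is, up to
the factor `(4 i S)ᵏ` with `S > 0`, the limit over growing cubes of the integrals of
`∏ᵢ tᵢ⁻¹ · ∏ⱼ fⱼ(x + ∑ᵢ aᵢⱼ tᵢ)`, summed over the reflections `tᵢ ↦ ± tᵢ`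
(`tendsto_integral_oddKernel`). Here column `0` of the coefficient matrix `a` is `(1, …, 1)` and the
other columns are given by the `α`. For chirps the product of the `fⱼ` is
`exp (i Φ(x, t))` times the amplitude, the product of the cutoffs, so that a lower bound for the
imaginary part, after a rotation, bounds the operator from below (`le_norm_nHT_chirp`). A reflection
of `t` may be moved to the signs of the matrix `a`, under which all hypotheses are invariant.

*The product phase.* If `Φ = A xᵏ + t₁ ⋯ tₖ`, the rotation by `exp (-i A xᵏ)` leaves, for each
reflection, the integral of `sinc (t₁ ⋯ tₖ)` against the amplitude. On a line in the direction of `t₁`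
the amplitude is the indicator function of an interval up to an error of order `ε`
(`abs_integral_mul_amplitude_sub_le`). With `u = t₂ ⋯ tₖ`, the integral over such a line is at least
a multiple of `1 / u` when the other coordinates lie in `[1, rN]`, and integrating this gives
`(log N)^(k-1)`. Where the other coordinates are at most `rN` in absolute value the interval contains
the origin and `Si` is positive, so that nothing is lost; if one of them is comparable to `N`, the
bound `O(1 / |u|)` loses one logarithm; coordinates below `N^(1-k)` are negligible
(`le_sliceIntegral`, `exists_log_pow_le_integral`).

*The phase with a square.* If `Φ = A x² + p t₂² + β t₁ t₂`, the addition theorem for the sine splits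
the imaginary part into `cos (p t₂²) |β| sinc (β t₁ t₂)`, the same for all reflections, whose integral
is `4 S log N + O(1)` (`le_integral_square`), and `sin (p t₂²) cos (β t₁ t₂) / (t₁ t₂)` with a sign
alternating with the reflection. The latter contributes `O(1)`
(`abs_integral_oscillatingPart_le`): the alternating sum of the amplitudes vanishes on a small cube;
for small `t₂` the integral in `t₁` oscillates; for large `t₂` the difference of the amplitudes
compensates the singularity in `t₁`, for cutoffs with Lipschitz constant `O(1 / ε)`.

*Generic phases.* The conditions on the phases are a linear system, whose columns are vectors of
monomials at the columns of `a`. The vectors of distinct monomials at all points span, and the vector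
at `(1, …, 1)` is nonzero and extends to a basis of such vectors; hence the determinant is a nonzero
polynomial in the `α` (`exists_polynomial_det_monomialMatrix`).

*Failure of the estimates.* The chirps are bounded by `1` and live on an interval of length `O(N)`,
and the operator exceeds a power of `log N` on an interval of length comparable to `N`. In a Hölder
type estimate the powers of `N` on the two sides cancel, and letting `N` tend to infinity contradicts
it (`satisfiesNoHolderEstimate_of_log`).
-/

/-! ### The sine integral and oscillatory integrals on an interval -/

/-- The sine integral `Si z = ∫₀ᶻ sin t / t dt`. -/
noncomputable def sineIntegral (z : ℝ) : ℝ := ∫ t in (0 : ℝ)..z, Real.sinc t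

lemma hasDerivAt_sineIntegral (z : ℝ) : HasDerivAt sineIntegral (Real.sinc z) z :=
  intervalIntegral.integral_hasDerivAt_right (Real.continuous_sinc.intervalIntegrable _ _)
    Real.continuous_sinc.stronglyMeasurable.stronglyMeasurableAtFilter
    Real.continuous_sinc.continuousAt

lemma continuous_sineIntegral : Continuous sineIntegral :=
  continuous_iff_continuousAt.2 fun z => (hasDerivAt_sineIntegral z).continuousAt

@[simp] lemma sineIntegral_zero : sineIntegral 0 = 0 := by simp [sineIntegral]

lemma sineIntegral_neg (z : ℝ) : sineIntegral (-z) = -sineIntegral z := by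
  have h := intervalIntegral.integral_comp_neg (a := 0) (b := z) Real.sinc
  simp only [Real.sinc_neg, neg_zero] at h
  rw [sineIntegral, sineIntegral, h, intervalIntegral.integral_symm]

/-- A second mean value estimate: the integral of a derivative `g'` of a bounded function against
a nonnegative decreasing weight `h` is controlled by the initial value of the weight. -/
lemma abs_integral_mul_deriv_le {p q M : ℝ} (hpq : p ≤ q) {g g' h h' : ℝ → ℝ}
    (hg : ∀ t ∈ Set.Icc p q, HasDerivAt g (g' t) t) (hh : ∀ t ∈ Set.Icc p q, HasDerivAt h (h' t) t)
    (hg' : ContinuousOn g' (Set.Icc p q)) (hh' : ContinuousOn h' (Set.Icc p q))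
    (hM : ∀ t ∈ Set.Icc p q, |g t| ≤ M) (hq : 0 ≤ h q) (hneg : ∀ t ∈ Set.Icc p q, h' t ≤ 0) :
    |∫ t in p..q, h t * g' t| ≤ 2 * M * h p := by
  have hu : Set.uIcc p q = Set.Icc p q := Set.uIcc_of_le hpq
  have ig : IntervalIntegrable g' volume p q := (hu ▸ hg').intervalIntegrable
  have ih : IntervalIntegrable h' volume p q := (hu ▸ hh').intervalIntegrable
  rw [intervalIntegral.integral_mul_deriv_eq_deriv_mul (u := h) (v := g) (u' := h') (v' := g')
    (fun t ht => hh t (hu ▸ ht)) (fun t ht => hg t (hu ▸ ht)) ih ig]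
  have hint : ∫ t in p..q, h' t = h q - h p :=
    intervalIntegral.integral_eq_sub_of_hasDerivAt (fun t ht => hh t (hu ▸ ht)) ih
  have h1 : |∫ t in p..q, h' t * g t| ≤ M * (h p - h q) := by
    have : ‖∫ t in p..q, h' t * g t‖ ≤ ∫ t in p..q, (-M) * h' t := by
      apply intervalIntegral.norm_integral_le_of_norm_le hpq
      · refine Filter.Eventually.of_forall fun t ht => ?_
        have ht' : t ∈ Set.Icc p q := ⟨ht.1.le, ht.2⟩
        rw [Real.norm_eq_abs, abs_mul, abs_of_nonpos (hneg t ht')]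
        nlinarith [hM t ht', hneg t ht', abs_nonneg (g t)]
      · exact ih.const_mul _
    rw [intervalIntegral.integral_const_mul, hint] at this
    calc _ ≤ _ := this
      _ = _ := by ring
  have hp' : p ∈ Set.Icc p q := ⟨le_rfl, hpq⟩
  have hq' : q ∈ Set.Icc p q := ⟨hpq, le_rfl⟩
  have hle : h q ≤ h p := by
    have : ∫ t in p..q, h' t ≤ ∫ t in p..q, (0 : ℝ) :=
      intervalIntegral.integral_mono_on hpq ih (by simp) hneg
    rw [hint] at this
    simp at this
    linarith
  have a1 : |h q * g q| ≤ M * h q := by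
    rw [abs_mul, abs_of_nonneg hq, mul_comm]; exact mul_le_mul_of_nonneg_right (hM q hq') hq
  have a2 : |h p * g p| ≤ M * h p := by
    rw [abs_mul, abs_of_nonneg (hq.trans hle), mul_comm]
    exact mul_le_mul_of_nonneg_right (hM p hp') (hq.trans hle)
  rw [abs_le] at *
  constructor <;> linarith [a1.1, a1.2, a2.1, a2.2, h1.1, h1.2]

lemma sineIntegral_sub_eq (p q : ℝ) :
    sineIntegral q - sineIntegral p = ∫ t in p..q, Real.sinc t := by
  rw [sineIntegral, sineIntegral, intervalIntegral.integral_interval_sub_left] <;>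
  exact Real.continuous_sinc.intervalIntegrable _ _

lemma hasDerivAt_inv_of_pos {p q t : ℝ} (hp : 0 < p) (ht : t ∈ Set.Icc p q) :
    HasDerivAt (fun t : ℝ => t⁻¹) (-(t ^ 2)⁻¹) t :=
  hasDerivAt_inv (hp.trans_le ht.1).ne'

lemma continuousOn_neg_inv_sq {p q : ℝ} (hp : 0 < p) :
    ContinuousOn (fun t : ℝ => -(t ^ 2)⁻¹) (Set.Icc p q) := by
  refine (ContinuousOn.inv₀ (by fun_prop) fun t ht => ?_).neg
  have := hp.trans_le ht.1
  positivity

lemma abs_sineIntegral_sub_le {p q : ℝ} (hp : 0 < p) (hpq : p ≤ q) :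
    |sineIntegral q - sineIntegral p| ≤ 2 / p := by
  have h := abs_integral_mul_deriv_le (M := 1) hpq (g := fun t => -Real.cos t) (g' := Real.sin)
    (h := fun t => t⁻¹) (h' := fun t => -(t ^ 2)⁻¹)
    (fun t _ => by simpa using (Real.hasDerivAt_cos t).fun_neg)
    (fun t ht => hasDerivAt_inv_of_pos hp ht)
    Real.continuous_sin.continuousOn (continuousOn_neg_inv_sq hp)
    (fun t _ => by simpa using Real.abs_cos_le_one t) (by have := hp.trans_le hpq; positivity)
    (fun t _ => by simp; positivity)
  rw [sineIntegral_sub_eq]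
  have e : ∫ t in p..q, Real.sinc t = ∫ t in p..q, t⁻¹ * Real.sin t := by
    apply intervalIntegral.integral_congr
    intro t ht
    rw [Set.uIcc_of_le hpq] at ht
    simp only
    rw [Real.sinc_of_ne_zero (hp.trans_le ht.1).ne', div_eq_inv_mul]
  rw [e]
  simpa [div_eq_mul_inv] using h

lemma abs_sineIntegral_le_abs (z : ℝ) : |sineIntegral z| ≤ |z| := by
  have h := intervalIntegral.norm_integral_le_of_norm_le_const (a := 0) (b := z) (C := 1)
    (f := Real.sinc) (fun t _ => by simpa using Real.abs_sinc_le_one t)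
  simpa [sineIntegral] using h

lemma abs_sineIntegral_le (z : ℝ) : |sineIntegral z| ≤ 3 := by
  have key : ∀ z : ℝ, 0 ≤ z → |sineIntegral z| ≤ 3 := by
    intro z hz
    rcases le_total z 1 with h | h
    · have := abs_sineIntegral_le_abs z
      rw [abs_of_nonneg hz] at this
      linarith
    · have h1 := abs_sineIntegral_sub_le one_pos h
      have h2 := abs_sineIntegral_le_abs 1
      have h3 := abs_add_le (sineIntegral z - sineIntegral 1) (sineIntegral 1)
      rw [sub_add_cancel] at h3
      norm_num at h1 h2
      linarith
  rcases le_total 0 z with h | h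
  · exact key z h
  · have := key (-z) (by linarith)
    rwa [sineIntegral_neg, abs_neg] at this

/-- The difference `Si z - (1 - cos z) / z` has derivative `(1 - cos z) / z²`, which is the
reason why `Si` is positive on the positive half-line. -/
lemma monotoneOn_sineIntegral_sub :
    MonotoneOn (fun z => sineIntegral z - (1 - Real.cos z) / z) (Set.Ici 0) := by
  apply monotoneOn_of_deriv_nonneg (convex_Ici 0)
  · intro z hz
    rcases eq_or_lt_of_le (Set.mem_Ici.1 hz) with h0 | h0
    · subst h0
      have : ContinuousAt (fun z : ℝ => sineIntegral z - (1 - Real.cos z) / z) 0 := by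
        apply continuous_sineIntegral.continuousAt.sub
        rw [ContinuousAt]
        simp only [div_zero]
        apply squeeze_zero_norm (a := fun t : ℝ => |t|)
        · intro t
          rcases eq_or_ne t 0 with rfl | ht
          · simp
          · rw [Real.norm_eq_abs, abs_div, div_le_iff₀ (abs_pos.2 ht), abs_mul_abs_self,
              abs_of_nonneg (by linarith [Real.cos_le_one t])]
            nlinarith [Real.one_sub_sq_div_two_le_cos (x := t)]
        · have := (continuous_abs (G := ℝ)).tendsto 0
          simpa using this
      exact this.continuousWithinAt
    · refine ContinuousAt.continuousWithinAt ?_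
      exact continuous_sineIntegral.continuousAt.sub
        (ContinuousAt.div (by fun_prop) continuousAt_id h0.ne')
  · intro z hz
    simp only [interior_Ici, Set.mem_Ioi] at hz
    refine DifferentiableAt.differentiableWithinAt ?_
    exact (hasDerivAt_sineIntegral z).differentiableAt.sub
      (DifferentiableAt.div (by fun_prop) differentiableAt_id hz.ne')
  · intro z hz
    simp only [interior_Ici, Set.mem_Ioi] at hz
    have h := (hasDerivAt_sineIntegral z).sub
      (((Real.hasDerivAt_cos z).const_sub 1).div (hasDerivAt_id z) hz.ne')
    have e := h.deriv
    have e' : deriv (fun z => sineIntegral z - (1 - Real.cos z) / z) z = (1 - Real.cos z) / z ^ 2 := by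
      refine Eq.trans e ?_
      rw [Real.sinc_of_ne_zero hz.ne']
      simp only [id]
      field_simp
      ring
    rw [e']
    have := Real.cos_le_one z
    exact div_nonneg (by linarith) (by positivity)

lemma sineIntegral_nonneg {z : ℝ} (hz : 0 ≤ z) : 0 ≤ sineIntegral z := by
  have h := monotoneOn_sineIntegral_sub (Set.mem_Ici.2 le_rfl) (Set.mem_Ici.2 hz) hz
  simp only [sineIntegral_zero, div_zero, sub_zero] at h
  have : 0 ≤ (1 - Real.cos z) / z := div_nonneg (by linarith [Real.cos_le_one z]) hz
  linarith

lemma one_quarter_le_sineIntegral {z : ℝ} (hz : 1 ≤ z) : 1 / 4 ≤ sineIntegral z := by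
  have h := monotoneOn_sineIntegral_sub (Set.mem_Ici.2 zero_le_one)
    (Set.mem_Ici.2 (zero_le_one.trans hz)) hz
  simp only [div_one] at h
  have h0 : 0 ≤ (1 - Real.cos z) / z :=
    div_nonneg (by linarith [Real.cos_le_one z]) (by linarith)
  -- By monotonicity it suffices to bound `Si 1` and `cos 1` from below.
  have h1 : 3 / 4 ≤ sineIntegral 1 := by
    have hle : ∫ t in (0 : ℝ)..1, (1 - t ^ 2 / 4 : ℝ) ≤ ∫ t in (0 : ℝ)..1, Real.sinc t := by
      apply intervalIntegral.integral_mono_on zero_le_one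
        (Continuous.intervalIntegrable (by fun_prop) _ _)
        (Real.continuous_sinc.intervalIntegrable _ _)
      intro t ht
      rcases eq_or_lt_of_le ht.1 with h0 | h0
      · simp [← h0]
      · rw [Real.sinc_of_ne_zero h0.ne', le_div_iff₀ h0]
        have := Real.sin_gt_sub_cube h0
        have h1 := pow_le_pow_left₀ h0.le ht.2 2
        nlinarith
    have e : ∫ t in (0 : ℝ)..1, (1 - t ^ 2 / 4 : ℝ) = 11 / 12 := by
      rw [intervalIntegral.integral_sub (by simp) (Continuous.intervalIntegrable (by fun_prop) _ _)]
      simp only [div_eq_mul_inv, intervalIntegral.integral_mul_const, integral_pow]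
      norm_num
    rw [e] at hle
    rw [sineIntegral]
    linarith
  have h2 := Real.one_sub_sq_div_two_le_cos (x := 1)
  norm_num at h2
  linarith

lemma exists_tendsto_sineIntegral :
    ∃ S : ℝ, 0 < S ∧ Filter.Tendsto sineIntegral Filter.atTop (nhds S) := by
  have hc : CauchySeq sineIntegral := by
    rw [Metric.cauchySeq_iff']
    intro ε hε
    refine ⟨3 / ε, fun n hn => ?_⟩
    rw [Real.dist_eq]
    have h3 : 0 < 3 / ε := by positivity
    refine (abs_sineIntegral_sub_le h3 hn).trans_lt ?_
    rw [div_div_eq_mul_div]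
    linarith
  obtain ⟨S, hS⟩ := cauchySeq_tendsto_of_complete hc
  refine ⟨S, ?_, hS⟩
  have : 1 / 4 ≤ S := ge_of_tendsto hS
    (Filter.eventually_atTop.2 ⟨1, fun z hz => one_quarter_le_sineIntegral hz⟩)
  linarith

/-- The limit of the sine integral at infinity; only its positivity is used. -/
noncomputable def sineLimit : ℝ := exists_tendsto_sineIntegral.choose

lemma sineLimit_pos : 0 < sineLimit := exists_tendsto_sineIntegral.choose_spec.1

lemma tendsto_sineIntegral : Filter.Tendsto sineIntegral Filter.atTop (nhds sineLimit) :=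
  exists_tendsto_sineIntegral.choose_spec.2

lemma abs_sineLimit_sub_le {p : ℝ} (hp : 0 < p) : |sineLimit - sineIntegral p| ≤ 2 / p :=
  le_of_tendsto ((tendsto_sineIntegral.sub_const _).abs)
    (Filter.eventually_atTop.2 ⟨p, fun _ hq => abs_sineIntegral_sub_le hp hq⟩)

/-- The rescaled sine integrals converge to a multiple of the sign function. -/
lemma tendsto_sineIntegral_mul (η : ℝ) :
    Filter.Tendsto (fun ρ : ℝ => sineIntegral (ρ * η)) Filter.atTop
      (nhds (sineLimit * Real.sign η)) := by
  rcases lt_trichotomy η 0 with h | h | h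
  · rw [Real.sign_of_neg h]
    have : (fun ρ : ℝ => sineIntegral (ρ * η)) = fun ρ => -sineIntegral (ρ * (-η)) := by
      funext ρ; rw [mul_neg, sineIntegral_neg, neg_neg]
    rw [this, mul_neg_one]
    exact (tendsto_sineIntegral.comp
      (Filter.tendsto_id.atTop_mul_const (by linarith : 0 < -η))).neg
  · subst h; simp
  · rw [Real.sign_of_pos h, mul_one]
    exact tendsto_sineIntegral.comp (Filter.tendsto_id.atTop_mul_const h)

lemma mul_integral_sinc_mul (u p q : ℝ) :
    u * ∫ t in p..q, Real.sinc (u * t) = sineIntegral (u * q) - sineIntegral (u * p) := by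
  rw [intervalIntegral.mul_integral_comp_mul_left, sineIntegral_sub_eq]

lemma abs_integral_cos_mul_div_le {p q c : ℝ} (hp : 0 < p) (hpq : p ≤ q) (hc : c ≠ 0) :
    |∫ t in p..q, Real.cos (c * t) / t| ≤ 2 / (|c| * p) := by
  have h := abs_integral_mul_deriv_le (M := 1 / |c|) hpq (g := fun t => Real.sin (c * t) / c)
    (g' := fun t => Real.cos (c * t)) (h := fun t => t⁻¹) (h' := fun t => -(t ^ 2)⁻¹)
    (fun t _ => by
      have := ((Real.hasDerivAt_sin (c * t)).comp t ((hasDerivAt_id t).const_mul c)).div_const c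
      simpa [hc] using this)
    (fun t ht => hasDerivAt_inv_of_pos hp ht)
    (by fun_prop) (continuousOn_neg_inv_sq hp)
    (fun t _ => by
      rw [abs_div]
      gcongr
      exact Real.abs_sin_le_one _) (by have := hp.trans_le hpq; positivity)
    (fun t _ => by simp; positivity)
  simp only [div_eq_inv_mul] at h ⊢
  refine h.trans (le_of_eq ?_)
  rw [mul_inv]
  ring

lemma abs_integral_cos_sq_div_le {p q a : ℝ} (hp : 0 < p) (hpq : p ≤ q) (ha : 0 < a) :
    |∫ t in p..q, Real.cos (a * t ^ 2) / t| ≤ 1 / (a * p ^ 2) := by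
  have h := abs_integral_mul_deriv_le (M := 1) hpq (g := fun t => Real.sin (a * t ^ 2))
    (g' := fun t => Real.cos (a * t ^ 2) * (2 * a * t)) (h := fun t => (2 * a)⁻¹ * (t ^ 2)⁻¹)
    (h' := fun t => (2 * a)⁻¹ * (-(2 * t) / (t ^ 2) ^ 2))
    (fun t _ => by
      have := (Real.hasDerivAt_sin (a * t ^ 2)).comp t ((hasDerivAt_pow 2 t).const_mul a)
      have e : Real.cos (a * t ^ 2) * (2 * a * t)
          = Real.cos (a * t ^ 2) * (a * ((2 : ℕ) * t ^ (2 - 1))) := by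
        push_cast; ring
      rw [e]
      exact this)
    (fun t ht => by
      have h0 := hp.trans_le ht.1
      have := ((hasDerivAt_pow 2 t).inv (by positivity)).const_mul (2 * a)⁻¹
      simpa using this)
    (by fun_prop)
    (by
      refine continuousOn_const.mul (ContinuousOn.div (by fun_prop) (by fun_prop) fun t ht => ?_)
      have := hp.trans_le ht.1
      positivity)
    (fun t _ => Real.abs_sin_le_one _) (by positivity)
    (fun t ht => by
      have := hp.trans_le ht.1
      have h2 : -(2 * t) / (t ^ 2) ^ 2 ≤ 0 := div_nonpos_of_nonpos_of_nonneg (by linarith)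
        (by positivity)
      exact mul_nonpos_of_nonneg_of_nonpos (by positivity) h2)
  have e : ∫ t in p..q, Real.cos (a * t ^ 2) / t
      = ∫ t in p..q, (2 * a)⁻¹ * (t ^ 2)⁻¹ * (Real.cos (a * t ^ 2) * (2 * a * t)) := by
    apply intervalIntegral.integral_congr
    intro t ht
    rw [Set.uIcc_of_le hpq] at ht
    have := hp.trans_le ht.1
    field_simp
  rw [e]
  refine h.trans (le_of_eq ?_)
  field_simp

/-- On `[δ, 1]` the cosine is close to `1` and contributes `log (1 / δ)`; on `[1, q]` the
oscillation keeps the integral bounded uniformly in `q`. -/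
lemma le_integral_cos_sq_div {δ q a : ℝ} (hδ : 0 < δ) (hδ1 : δ ≤ 1) (hq : 1 ≤ q) (ha : 0 < a) :
    -Real.log δ - (a ^ 2 + 1 / a) ≤ ∫ t in δ..q, Real.cos (a * t ^ 2) / t := by
  have hii : ∀ p r : ℝ, 0 < p → p ≤ r →
      IntervalIntegrable (fun t => Real.cos (a * t ^ 2) / t) volume p r := by
    intro p r hp hr
    apply ContinuousOn.intervalIntegrable
    rw [Set.uIcc_of_le hr]
    exact ContinuousOn.div (by fun_prop) continuousOn_id fun t ht => (hp.trans_le ht.1).ne'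
  rw [← intervalIntegral.integral_add_adjacent_intervals (hii δ 1 hδ hδ1) (hii 1 q one_pos hq)]
  have h1 := abs_le.1 (abs_integral_cos_sq_div_le one_pos hq ha)
  have h2 : ∫ t in δ..1, (1 / t - a ^ 2 : ℝ) ≤ ∫ t in δ..1, Real.cos (a * t ^ 2) / t := by
    apply intervalIntegral.integral_mono_on hδ1 _ (hii δ 1 hδ hδ1)
    · intro t ht
      have h0 := hδ.trans_le ht.1
      have := Real.one_sub_sq_div_two_le_cos (x := a * t ^ 2)
      rw [le_div_iff₀ h0, sub_mul, one_div_mul_cancel h0.ne']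
      have h4 : t ^ 4 ≤ t := by
        calc t ^ 4 ≤ t ^ 1 := pow_le_pow_of_le_one h0.le ht.2 (by norm_num)
          _ = t := pow_one t
      nlinarith [mul_le_mul_of_nonneg_left h4 (sq_nonneg a), mul_nonneg (sq_nonneg a) h0.le]
    · apply ContinuousOn.intervalIntegrable
      rw [Set.uIcc_of_le hδ1]
      exact (ContinuousOn.div (by fun_prop) continuousOn_id
        fun t ht => (hδ.trans_le ht.1).ne').sub continuousOn_const
  have e : ∫ t in δ..1, (1 / t - a ^ 2 : ℝ) = -Real.log δ - a ^ 2 * (1 - δ) := by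
    rw [intervalIntegral.integral_sub, integral_one_div_of_pos hδ one_pos]
    · simp [mul_comm]
    · apply ContinuousOn.intervalIntegrable
      rw [Set.uIcc_of_le hδ1]
      exact ContinuousOn.div (by fun_prop) continuousOn_id fun t ht => (hδ.trans_le ht.1).ne'
    · simp
  rw [e] at h2
  have : a ^ 2 * (1 - δ) ≤ a ^ 2 := by nlinarith [sq_nonneg a]
  have h3 := h1.1
  simp only [one_pow, mul_one] at h3
  linarith

/-! ### The kernel representation -/

/-- The coefficients of the linear forms: the form attached to the distinguished function `f 0` is
the sum of the coordinates, and the form attached to `f j.succ` has the coefficients `α i j`. -/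
def coeffMatrix {k m : ℕ} (α : Fin k → Fin m → ℝ) (i : Fin k) : Fin (m + 1) → ℝ :=
  Fin.cons 1 (α i)

lemma productSymbol_eq {k m : ℕ} (α : Fin k → Fin m → ℝ) (ξ : Fin (m + 1) → ℝ) :
    productSymbol α ξ = ∏ i, Real.sign (∑ j, coeffMatrix α i j * ξ j) := by
  simp [productSymbol, coeffMatrix, Fin.sum_univ_succ]

/-- The sign `±1` encoded by a Boolean. -/
def boolSign (b : Bool) : ℝ := if b then 1 else -1

lemma abs_boolSign (b : Bool) : |boolSign b| = 1 := by
  cases b <;> simp [boolSign]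

/-- Multiplication of the rows of a coefficient matrix by signs, that is, the effect on the linear
forms of a reflection of the coordinates. -/
def signFlip {k n : ℕ} (s : Fin k → Bool) (a : Fin k → Fin n → ℝ) (i : Fin k) (j : Fin n) : ℝ :=
  boolSign (s i) * a i j

/-- The values `x + ∑ᵢ aᵢⱼ tᵢ` at which the functions are evaluated. -/
def affineForm {k n : ℕ} (a : Fin k → Fin n → ℝ) (x : ℝ) (t : Fin k → ℝ) (j : Fin n) : ℝ :=
  x + ∑ i, a i j * t i

/-- The singular integrand `∏ᵢ tᵢ⁻¹ · ∏ⱼ fⱼ(x + ∑ᵢ aᵢⱼ tᵢ)` summed over all reflections of the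
coordinates. Its integrals over symmetric cubes are absolutely convergent and stand for `2ᵏ` times
the principal values. -/
noncomputable def oddKernel {k n : ℕ} (a : Fin k → Fin n → ℝ) (f : Fin n → ℝ → ℂ) (x : ℝ)
    (t : Fin k → ℝ) : ℂ :=
  (∏ i, (t i : ℂ))⁻¹ *
    ∑ s : Fin k → Bool, (∏ i, (boolSign (s i) : ℂ)) * ∏ j, f j (affineForm (signFlip s a) x t j)

/-- The cube `[-ρ, ρ]ᵏ`. -/
def cube (k : ℕ) (ρ : ℝ) : Set (Fin k → ℝ) := Set.univ.pi fun _ => Set.Icc (-ρ) ρ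

lemma volume_restrict_cube (k : ℕ) (ρ : ℝ) :
    (volume : Measure (Fin k → ℝ)).restrict (cube k ρ) =
      Measure.pi fun _ : Fin k => (volume : Measure ℝ).restrict (Set.Icc (-ρ) ρ) := by
  rw [cube, volume_pi, Measure.restrict_pi_pi]

lemma integral_sinc_symmetric {ρ : ℝ} (hρ : 0 ≤ ρ) (η : ℝ) :
    ∫ t in Set.Icc (-ρ) ρ, η * Real.sinc (η * t) = 2 * sineIntegral (ρ * η) := by
  rw [integral_Icc_eq_integral_Ioc, ← intervalIntegral.integral_of_le (by linarith),
    intervalIntegral.integral_const_mul, mul_integral_sinc_mul, mul_neg, sineIntegral_neg,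
    mul_comm η ρ]
  ring

lemma mul_sinc_mul_eq (η : ℝ) {t : ℝ} (ht : t ≠ 0) :
    ((η * Real.sinc (η * t) : ℝ) : ℂ) = (t : ℂ)⁻¹ * ((2 * Complex.I)⁻¹ *
      ∑ b : Bool, (boolSign b : ℂ) * Complex.exp (Complex.I * ((η * (boolSign b * t) : ℝ) : ℂ))) := by
  have h1 : η * Real.sinc (η * t) = t⁻¹ * Real.sin (η * t) := by
    rcases eq_or_ne η 0 with rfl | hη
    · simp
    · rw [Real.sinc_of_ne_zero (mul_ne_zero hη ht)]
      field_simp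
  rw [h1, Complex.ofReal_mul, Complex.ofReal_inv, Complex.ofReal_sin, Complex.sin]
  congr 1
  simp only [Fintype.sum_bool, boolSign]
  push_cast
  have hI : (2 * Complex.I)⁻¹ = -Complex.I / 2 := by
    rw [mul_inv, Complex.inv_I]; ring
  rw [hI]
  ring_nf

lemma integral_fourier_mul_exp (f : 𝓢(ℝ, ℂ)) (y : ℝ) :
    ∫ ξ : ℝ, 𝓕 (f : ℝ → ℂ) ξ * Complex.exp (Complex.I * ((2 * Real.pi * ξ * y : ℝ) : ℂ)) = f y := by
  have h := f.continuous.fourierInv_fourier_eq f.integrable (𝓕 f).integrable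
  have h2 := congrFun h y
  rw [Real.fourierInv_eq'] at h2
  rw [← h2]
  congr 1
  funext ξ
  rw [smul_eq_mul, mul_comm]
  congr 2
  simp
  ring

lemma abs_linear_form_le {n : ℕ} (a ξ : Fin n → ℝ) :
    |∑ j, a j * ξ j| ≤ (∑ j, |a j|) * ∏ j, (1 + |ξ j|) := by
  rw [Finset.sum_mul]
  refine (Finset.abs_sum_le_sum_abs _ _).trans (Finset.sum_le_sum fun j _ => ?_)
  rw [abs_mul]
  gcongr
  have h1 : 1 + |ξ j| ≤ ∏ j, (1 + |ξ j|) :=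
    le_of_eq_of_le (Finset.prod_singleton (fun j => (1 + |ξ j|)) j).symm
      (Finset.prod_le_prod_of_subset_of_one_le (Finset.subset_univ _)
        (fun i _ => by positivity) (fun i _ _ => by simp))
  linarith

lemma integrable_one_add_abs_pow_mul (g : 𝓢(ℝ, ℂ)) (k : ℕ) :
    Integrable fun ξ : ℝ => (1 + |ξ|) ^ k * ‖g ξ‖ := by
  have h : Integrable fun ξ : ℝ => ∑ i ∈ Finset.range (k + 1), (k.choose i : ℝ) * (‖ξ‖ ^ i * ‖g ξ‖) :=
    integrable_finsetSum _ fun i _ => (g.integrable_pow_mul volume i).const_mul _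
  refine h.congr (Filter.Eventually.of_forall fun ξ => ?_)
  simp only
  rw [add_comm 1 |ξ|, add_pow, Finset.sum_mul]
  refine Finset.sum_congr rfl fun i _ => ?_
  simp
  ring

section Representation

variable {k n : ℕ} (a : Fin k → Fin n → ℝ) (f : Fin n → 𝓢(ℝ, ℂ)) (x : ℝ)

/-- The frequency-side integrand without the symbol. -/
noncomputable def waveProduct (ξ : Fin n → ℝ) : ℂ :=
  (∏ j, 𝓕 (f j : ℝ → ℂ) (ξ j)) * Complex.exp (2 * Real.pi * Complex.I * x * ((∑ j, ξ j : ℝ) : ℂ))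

lemma continuous_waveProduct : Continuous (waveProduct f x) := by
  have : ∀ j, Continuous (𝓕 (f j : ℝ → ℂ)) := fun j => (𝓕 (f j)).continuous
  unfold waveProduct
  fun_prop

lemma norm_waveProduct (ξ : Fin n → ℝ) :
    ‖waveProduct f x ξ‖ = ∏ j, ‖𝓕 (f j : ℝ → ℂ) (ξ j)‖ := by
  rw [waveProduct, norm_mul, norm_prod]
  have : (2 * Real.pi * Complex.I * x * ((∑ j, ξ j : ℝ) : ℂ)) =
    ((2 * Real.pi * x * ∑ j, ξ j : ℝ) : ℂ) * Complex.I := by push_cast; ring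
  rw [this, Complex.norm_exp_ofReal_mul_I, mul_one]

lemma integrable_waveProduct : Integrable (waveProduct f x) := by
  have h : Integrable fun ξ : Fin n → ℝ => ∏ j, ‖(𝓕 (f j)) (ξ j)‖ := by
    rw [volume_pi]
    exact Integrable.fintype_prod (f := fun j ξ => ‖(𝓕 (f j)) ξ‖)
      fun j => ((𝓕 (f j)).integrable (μ := volume)).norm
  refine h.mono' (continuous_waveProduct f x).aestronglyMeasurable
    (Filter.Eventually.of_forall fun ξ => ?_)
  rw [norm_waveProduct]
  rfl

lemma integrable_prod_form_mul_waveProduct :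
    Integrable fun ξ : Fin n → ℝ =>
      (∏ i, |2 * Real.pi * ∑ j, a i j * ξ j|) * ‖waveProduct f x ξ‖ := by
  have h : Integrable fun ξ : Fin n → ℝ =>
      (∏ i, (2 * Real.pi * ∑ j, |a i j|)) * ∏ j, ((1 + |ξ j|) ^ k * ‖(𝓕 (f j)) (ξ j)‖) := by
    refine Integrable.const_mul ?_ _
    rw [volume_pi]
    exact Integrable.fintype_prod (f := fun j ξ => (1 + |ξ|) ^ k * ‖(𝓕 (f j)) ξ‖)
      fun j => integrable_one_add_abs_pow_mul (𝓕 (f j)) k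
  refine h.mono' ?_ (Filter.Eventually.of_forall fun ξ => ?_)
  · have := continuous_waveProduct f x
    exact Continuous.aestronglyMeasurable (by fun_prop)
  · rw [Real.norm_of_nonneg (by positivity), norm_waveProduct,
      Finset.prod_mul_distrib (f := fun j => (1 + |ξ j|) ^ k), ← mul_assoc]
    refine mul_le_mul_of_nonneg_right ?_ (by positivity)
    rw [Finset.prod_pow]
    calc ∏ i, |2 * Real.pi * ∑ j, a i j * ξ j|
        ≤ ∏ i : Fin k, ((2 * Real.pi * ∑ j, |a i j|) * ∏ j, (1 + |ξ j|)) := by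
          refine Finset.prod_le_prod (fun _ _ => abs_nonneg _) fun i _ => ?_
          rw [abs_mul, abs_of_pos (by positivity : 0 < 2 * Real.pi),
            mul_assoc (2 * Real.pi)]
          exact mul_le_mul_of_nonneg_left (abs_linear_form_le _ _) (by positivity)
      _ = _ := by
          rw [Finset.prod_mul_distrib, Finset.prod_const, Finset.card_univ, Fintype.card_fin]

/-- The integrand on the product of the cube and the frequency space. With `ηᵢ = ∑ⱼ aᵢⱼ ξⱼ`, the
kernel factor `sin (2π ηᵢ tᵢ) / tᵢ` is written through `sinc`, which makes it continuous. -/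
noncomputable def truncatedIntegrand (t : Fin k → ℝ) (ξ : Fin n → ℝ) : ℂ :=
  (∏ i, ((2 * Real.pi * (∑ j, a i j * ξ j) *
    Real.sinc (2 * Real.pi * (∑ j, a i j * ξ j) * t i) : ℝ) : ℂ)) * waveProduct f x ξ

lemma integrable_truncatedIntegrand (ρ : ℝ) :
    Integrable (Function.uncurry (truncatedIntegrand a f x))
      (((volume : Measure (Fin k → ℝ)).restrict (cube k ρ)).prod volume) := by
  have hfin : IsFiniteMeasure ((volume : Measure (Fin k → ℝ)).restrict (cube k ρ)) := by
    rw [volume_restrict_cube]; infer_instance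
  refine ((integrable_prod_form_mul_waveProduct a f x).comp_snd
    ((volume : Measure (Fin k → ℝ)).restrict (cube k ρ))).mono' ?_
    (Filter.Eventually.of_forall fun p => ?_)
  · have h1 := continuous_waveProduct f x
    have h2 := Real.continuous_sinc
    refine Continuous.aestronglyMeasurable ?_
    unfold Function.uncurry truncatedIntegrand
    fun_prop
  · simp only [Function.uncurry, truncatedIntegrand]
    rw [norm_mul, norm_prod]
    refine mul_le_mul_of_nonneg_right (Finset.prod_le_prod (fun _ _ => norm_nonneg _)
      fun i _ => ?_) (norm_nonneg _)
    rw [Complex.norm_real, Real.norm_eq_abs, abs_mul]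
    exact mul_le_of_le_one_right (abs_nonneg _) (Real.abs_sinc_le_one _)

/-- Fourier inversion in each frequency variable. -/
lemma integral_waveProduct_mul_exp (t : Fin k → ℝ) :
    ∫ ξ : Fin n → ℝ, (∏ i, Complex.exp (Complex.I *
      ((2 * Real.pi * (∑ j, a i j * ξ j) * t i : ℝ) : ℂ))) * waveProduct f x ξ
      = ∏ j, f j (affineForm a x t j) := by
  have e : ∀ ξ : Fin n → ℝ, (∏ i, Complex.exp (Complex.I *
      ((2 * Real.pi * (∑ j, a i j * ξ j) * t i : ℝ) : ℂ))) * waveProduct f x ξ =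
      ∏ j, (𝓕 (f j : ℝ → ℂ) (ξ j) *
        Complex.exp (Complex.I * ((2 * Real.pi * ξ j * affineForm a x t j : ℝ) : ℂ))) := by
    intro ξ
    rw [waveProduct, Finset.prod_mul_distrib, mul_left_comm, ← Complex.exp_sum, ← Complex.exp_sum,
      ← Complex.exp_add, ← Finset.mul_sum, ← Finset.mul_sum]
    congr 2
    have h : ∑ i, 2 * Real.pi * (∑ j, a i j * ξ j) * t i + 2 * Real.pi * x * ∑ j, ξ j =
        ∑ j, 2 * Real.pi * ξ j * affineForm a x t j := by
      simp only [affineForm, mul_add, Finset.sum_add_distrib, Finset.mul_sum, Finset.sum_mul]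
      rw [Finset.sum_comm, add_comm]
      congr 1
      · exact Finset.sum_congr rfl fun _ _ => by ring
      · exact Finset.sum_congr rfl fun _ _ => Finset.sum_congr rfl fun _ _ => by ring
    rw [← Complex.ofReal_sum, ← Complex.ofReal_sum, ← h]
    push_cast
    ring
  simp_rw [e]
  rw [integral_fintype_prod_volume_eq_prod (fun j ξ => 𝓕 (f j : ℝ → ℂ) ξ *
        Complex.exp (Complex.I * ((2 * Real.pi * ξ * affineForm a x t j : ℝ) : ℂ)))]
  exact Finset.prod_congr rfl fun j _ => integral_fourier_mul_exp (f j) _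

/-- Writing each sine as a difference of exponentials produces the sum over the reflections. -/
lemma integral_truncatedIntegrand {t : Fin k → ℝ} (ht : ∀ i, t i ≠ 0) :
    ∫ ξ, truncatedIntegrand a f x t ξ =
      ((2 * Complex.I) ^ k)⁻¹ * oddKernel a (fun j => f j) x t := by
  have e : ∀ ξ, truncatedIntegrand a f x t ξ = ((2 * Complex.I) ^ k)⁻¹ * ((∏ i, (t i : ℂ))⁻¹ *
      ∑ s : Fin k → Bool, (∏ i, (boolSign (s i) : ℂ)) * ((∏ i, Complex.exp (Complex.I *
      ((2 * Real.pi * (∑ j, signFlip s a i j * ξ j) * t i : ℝ) : ℂ))) * waveProduct f x ξ)) := by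
    intro ξ
    rw [truncatedIntegrand]
    simp_rw [fun i => mul_sinc_mul_eq (2 * Real.pi * ∑ j, a i j * ξ j) (ht i)]
    rw [Finset.prod_mul_distrib, Finset.prod_mul_distrib, Finset.prod_univ_sum,
      Fintype.piFinset_univ, Finset.prod_const, Finset.card_univ, Fintype.card_fin,
      Finset.prod_inv_distrib, inv_pow]
    simp_rw [Finset.prod_mul_distrib]
    rw [mul_assoc, mul_assoc, Finset.sum_mul, mul_left_comm]
    refine congrArg _ (congrArg _ (Finset.sum_congr rfl fun s _ => ?_))
    rw [mul_assoc]
    congr 2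
    refine Finset.prod_congr rfl fun i _ => ?_
    have hflip : ∑ j, signFlip s a i j * ξ j = boolSign (s i) * ∑ j, a i j * ξ j := by
      rw [Finset.mul_sum]
      exact Finset.sum_congr rfl fun j _ => by rw [signFlip, mul_assoc]
    rw [hflip]
    congr 3
    ring
  simp_rw [e]
  rw [integral_const_mul, integral_const_mul, integral_finsetSum]
  · simp_rw [integral_const_mul, integral_waveProduct_mul_exp]
    rfl
  · intro s _
    refine Integrable.const_mul ?_ _
    refine (integrable_waveProduct f x).norm.mono' ?_ (Filter.Eventually.of_forall fun ξ => ?_)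
    · have := continuous_waveProduct f x
      exact Continuous.aestronglyMeasurable (by fun_prop)
    · rw [norm_mul, norm_prod, Finset.prod_eq_one, one_mul]
      intro i _
      rw [mul_comm Complex.I, Complex.norm_exp_ofReal_mul_I]

lemma ae_cube_ne_zero (ρ : ℝ) :
    ∀ᵐ t ∂(volume : Measure (Fin k → ℝ)).restrict (cube k ρ), ∀ i, t i ≠ 0 := by
  refine ae_restrict_of_ae (ae_all_iff.2 fun i => ?_)
  rw [volume_pi]
  exact Measure.ae_eval_ne _ i 0

lemma integrableOn_oddKernel (ρ : ℝ) :
    IntegrableOn (oddKernel a (fun j => f j) x) (cube k ρ) := by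
  have h := ((integrable_truncatedIntegrand a f x ρ).integral_prod_left).const_mul
    ((2 * Complex.I) ^ k)
  refine h.congr ?_
  filter_upwards [ae_cube_ne_zero ρ] with t ht
  have : ∫ ξ, Function.uncurry (truncatedIntegrand a f x) (t, ξ) = _ :=
    integral_truncatedIntegrand a f x ht
  rw [this, mul_inv_cancel_left₀]
  simp

/-- By Fubini's theorem, truncating the kernel to a cube amounts to replacing each sign function in
the symbol by a rescaled sine integral. -/
lemma integral_oddKernel {ρ : ℝ} (hρ : 0 ≤ ρ) :
    ∫ t in cube k ρ, oddKernel a (fun j => f j) x t = (2 * Complex.I) ^ k *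
      ∫ ξ, ((∏ i, 2 * sineIntegral (ρ * (2 * Real.pi * ∑ j, a i j * ξ j)) : ℝ) : ℂ) *
        waveProduct f x ξ := by
  have h1 : ∫ t in cube k ρ, oddKernel a (fun j => f j) x t =
      ∫ t in cube k ρ, (2 * Complex.I) ^ k * ∫ ξ, truncatedIntegrand a f x t ξ := by
    refine integral_congr_ae ?_
    filter_upwards [ae_cube_ne_zero ρ] with t ht
    rw [integral_truncatedIntegrand a f x ht, mul_inv_cancel_left₀]
    simp
  rw [h1, integral_const_mul, integral_integral_swap (integrable_truncatedIntegrand a f x ρ)]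
  congr 2
  funext ξ
  simp only [truncatedIntegrand]
  rw [integral_mul_const]
  congr 1
  simp_rw [← Complex.ofReal_prod]
  rw [integral_complex_ofReal, volume_restrict_cube,
    integral_fintype_prod_eq_prod (fun i t => 2 * Real.pi * (∑ j, a i j * ξ j) *
      Real.sinc (2 * Real.pi * (∑ j, a i j * ξ j) * t))]
  simp_rw [integral_sinc_symmetric hρ]

end Representation

/-- The operator is a multiple of the limit of the integrals of the antisymmetrized singular kernel
over growing cubes. -/
lemma tendsto_integral_oddKernel {k m : ℕ} (α : Fin k → Fin m → ℝ) (f : Fin (m + 1) → 𝓢(ℝ, ℂ))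
    (x : ℝ) :
    Filter.Tendsto (fun ρ : ℝ => ∫ t in cube k ρ, oddKernel (coeffMatrix α) (fun j => f j) x t)
      Filter.atTop (nhds ((4 * sineLimit * Complex.I) ^ k * nHT α (fun j => f j) x)) := by
  set a := coeffMatrix α
  have hlim : Filter.Tendsto (fun ρ : ℝ => ∫ ξ, ((∏ i, 2 * sineIntegral
      (ρ * (2 * Real.pi * ∑ j, a i j * ξ j)) : ℝ) : ℂ) * waveProduct f x ξ)
      Filter.atTop (nhds (∫ ξ, ((∏ i, 2 * (sineLimit *
        Real.sign (2 * Real.pi * ∑ j, a i j * ξ j)) : ℝ) : ℂ) * waveProduct f x ξ)) := by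
    -- The sine integral is bounded by `3`, which gives the dominating function.
    refine tendsto_integral_filter_of_dominated_convergence
      (fun ξ => 6 ^ k * ‖waveProduct f x ξ‖) ?_ ?_ ?_ ?_
    · refine Filter.Eventually.of_forall fun ρ => ?_
      have h1 := continuous_waveProduct f x
      have h2 := continuous_sineIntegral
      exact Continuous.aestronglyMeasurable (by fun_prop)
    · refine Filter.Eventually.of_forall fun ρ => Filter.Eventually.of_forall fun ξ => ?_
      rw [norm_mul]
      refine mul_le_mul_of_nonneg_right ?_ (norm_nonneg _)
      rw [Complex.norm_real, Real.norm_eq_abs, Finset.abs_prod]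
      calc ∏ i, |2 * sineIntegral (ρ * (2 * Real.pi * ∑ j, a i j * ξ j))|
          ≤ ∏ _i : Fin k, (6 : ℝ) := by
            refine Finset.prod_le_prod (fun _ _ => abs_nonneg _) fun i _ => ?_
            rw [abs_mul, abs_two]
            linarith [abs_sineIntegral_le (ρ * (2 * Real.pi * ∑ j, a i j * ξ j))]
        _ = 6 ^ k := by simp
    · exact (integrable_waveProduct f x).norm.const_mul _
    · refine Filter.Eventually.of_forall fun ξ => ?_
      refine Filter.Tendsto.mul_const _ ?_
      refine (Complex.continuous_ofReal.tendsto _).comp ?_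
      exact tendsto_finsetProd _ fun i _ => (tendsto_sineIntegral_mul _).const_mul 2
  have hval : (4 * sineLimit * Complex.I) ^ k * nHT α (fun j => f j) x =
      (2 * Complex.I) ^ k * ∫ ξ, ((∏ i, 2 * (sineLimit *
        Real.sign (2 * Real.pi * ∑ j, a i j * ξ j)) : ℝ) : ℂ) * waveProduct f x ξ := by
    have e : ∀ ξ, ((∏ i, 2 * (sineLimit * Real.sign (2 * Real.pi * ∑ j, a i j * ξ j)) : ℝ) : ℂ)
        * waveProduct f x ξ = (2 * sineLimit : ℂ) ^ k * ((productSymbol α ξ : ℂ) *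
        (∏ j, 𝓕 (f j : ℝ → ℂ) (ξ j)) *
        Complex.exp (2 * Real.pi * Complex.I * x * ((∑ j, ξ j : ℝ) : ℂ))) := by
      intro ξ
      have hs : ∀ y : ℝ, Real.sign (2 * Real.pi * y) = Real.sign y := by
        intro y
        have hp : 0 < 2 * Real.pi := by positivity
        rcases lt_trichotomy y 0 with h | h | h
        · rw [Real.sign_of_neg h, Real.sign_of_neg (mul_neg_of_pos_of_neg hp h)]
        · simp [h]
        · rw [Real.sign_of_pos h, Real.sign_of_pos (mul_pos hp h)]
      simp_rw [hs, ← mul_assoc]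
      rw [Finset.prod_mul_distrib, ← productSymbol_eq, Finset.prod_const, Finset.card_univ,
        Fintype.card_fin, waveProduct]
      push_cast
      ring
    simp_rw [e]
    rw [integral_const_mul, nHT, ← mul_assoc, ← mul_pow]
    congr 2
    ring
  rw [hval]
  refine (hlim.const_mul _).congr' ?_
  filter_upwards [Filter.eventually_ge_atTop 0] with ρ hρ
  exact (integral_oddKernel a f x hρ).symm

/-! ### The amplitude and its one-dimensional slices -/

/-- The product of the cutoffs along the affine forms. For chirps, the integrand of the singular
integral is this amplitude times a unimodular function of the phase polynomial. -/
noncomputable def amplitude {k n : ℕ} (a : Fin k → Fin n → ℝ) (χ : ℝ → ℝ) (x : ℝ)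
    (t : Fin k → ℝ) : ℝ :=
  ∏ j, χ (affineForm a x t j)

/-- The forms `x + ∑ᵢ aᵢⱼ tᵢ` are at most `N` on the cube of side `rN` and control the coordinates:
where they are all at most `2N`, the point lies in the cube of side `RN`. -/
structure FormBounds {k n : ℕ} (a : Fin k → Fin n → ℝ) (r R : ℝ) : Prop where
  r_pos : 0 < r
  r_le_one : r ≤ 1
  one_le_R : 1 ≤ R
  inside : ∀ {N x : ℝ} {t : Fin k → ℝ}, |x| ≤ r * N → (∀ i, |t i| ≤ r * N) →
    ∀ j, |affineForm a x t j| ≤ N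
  outside : ∀ {N x : ℝ} {t : Fin k → ℝ}, |x| ≤ N → (∀ j, |affineForm a x t j| ≤ 2 * N) →
    ∀ i, |t i| ≤ R * N

lemma affineForm_signFlip {k n : ℕ} (s : Fin k → Bool) (a : Fin k → Fin n → ℝ) (x : ℝ)
    (t : Fin k → ℝ) (j : Fin n) :
    affineForm (signFlip s a) x t j = affineForm a x (fun i => boolSign (s i) * t i) j := by
  simp only [affineForm, signFlip]
  congr 1
  exact Finset.sum_congr rfl fun i _ => by ring

lemma FormBounds.signFlip {k n : ℕ} {a : Fin k → Fin n → ℝ} {r R : ℝ} (h : FormBounds a r R)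
    (s : Fin k → Bool) : FormBounds (signFlip s a) r R where
  r_pos := h.r_pos
  r_le_one := h.r_le_one
  one_le_R := h.one_le_R
  inside hx ht j := by
    rw [affineForm_signFlip]
    exact h.inside hx (fun i => by rw [abs_mul, abs_boolSign, one_mul]; exact ht i) j
  outside hx ht i := by
    have := h.outside hx (fun j => by rw [← affineForm_signFlip]; exact ht j) i
    rwa [abs_mul, abs_boolSign, one_mul] at this

/-- If the linear parts of the forms have no common kernel, then the bounds hold for some
constants. -/
lemma exists_formBounds {k n : ℕ} (a : Fin k → Fin n → ℝ)
    (ha : ∀ t : Fin k → ℝ, (∀ j, ∑ i, a i j * t i = 0) → t = 0) :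
    ∃ r R : ℝ, FormBounds a r R := by
  let Λ : (Fin k → ℝ) →ₗ[ℝ] (Fin n → ℝ) := Matrix.mulVecLin (Matrix.of fun j i => a i j)
  have hΛ : ∀ t j, Λ t j = ∑ i, a i j * t i := fun t j => rfl
  have hker : LinearMap.ker Λ = ⊥ := by
    rw [LinearMap.ker_eq_bot']
    intro t ht
    exact ha t fun j => by rw [← hΛ, ht]; rfl
  -- The linear part is injective, hence bounded from below, which gives `R`; a crude upper bound
  -- for the coefficients gives `r`.
  obtain ⟨D, hD, hanti⟩ := Λ.exists_antilipschitzWith hker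
  set B : ℝ := ∑ j, ∑ i, |a i j| with hB
  have hB0 : 0 ≤ B := by positivity
  refine ⟨1 / (1 + B), 3 * D + 1, ⟨by positivity, ?_, ?_, ?_, ?_⟩⟩
  · rw [div_le_one (by positivity)]; linarith
  · have : (0 : ℝ) ≤ D := D.coe_nonneg
    linarith
  · intro N x t hx ht j
    have hrN : 0 ≤ 1 / (1 + B) * N := (abs_nonneg x).trans hx
    have h1 : |∑ i, a i j * t i| ≤ B * (1 / (1 + B) * N) := by
      calc |∑ i, a i j * t i| ≤ ∑ i, |a i j * t i| := Finset.abs_sum_le_sum_abs _ _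
        _ ≤ ∑ i, |a i j| * (1 / (1 + B) * N) := by
            refine Finset.sum_le_sum fun i _ => ?_
            rw [abs_mul]
            exact mul_le_mul_of_nonneg_left (ht i) (abs_nonneg _)
        _ = (∑ i, |a i j|) * (1 / (1 + B) * N) := by rw [Finset.sum_mul]
        _ ≤ _ := by
            refine mul_le_mul_of_nonneg_right ?_ hrN
            exact Finset.single_le_sum (f := fun j => ∑ i, |a i j|) (fun j _ => by positivity)
              (Finset.mem_univ j)
    calc |affineForm a x t j| ≤ |x| + |∑ i, a i j * t i| := abs_add_le _ _
      _ ≤ 1 / (1 + B) * N + B * (1 / (1 + B) * N) := add_le_add hx h1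
      _ = N := by field_simp
  · intro N x t hx ht i
    have hN : 0 ≤ N := (abs_nonneg x).trans hx
    have h1 : ‖Λ t‖ ≤ 3 * N := by
      rw [pi_norm_le_iff_of_nonneg (by positivity)]
      intro j
      rw [hΛ, Real.norm_eq_abs]
      have e : ∑ i, a i j * t i = affineForm a x t j - x := by simp [affineForm]
      rw [e]
      refine (abs_sub _ _).trans ?_
      linarith [ht j]
    have h2 := hanti.le_mul_dist t 0
    rw [dist_zero_right, map_zero, dist_zero_right] at h2
    calc |t i| ≤ ‖t‖ := norm_le_pi_norm t i
      _ ≤ D * ‖Λ t‖ := h2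
      _ ≤ D * (3 * N) := by gcongr
      _ ≤ (3 * D + 1) * N := by nlinarith

section Amplitude

variable {k n : ℕ} {a : Fin k → Fin n → ℝ} {r R N ε x : ℝ} {χ : ℝ → ℝ}

lemma IsSmoothCutoff.eq_zero (h : IsSmoothCutoff N ε χ) {y : ℝ} (hy : N + ε < |y|) : χ y = 0 := by
  by_contra hne
  have := h.tsupport_subset (subset_tsupport χ hne)
  rw [Set.mem_Icc] at this
  have : |y| ≤ N + ε := abs_le.2 ⟨by linarith, this.2⟩
  linarith

lemma IsSmoothCutoff.eq_one' (h : IsSmoothCutoff N ε χ) {y : ℝ} (hy : |y| ≤ N) : χ y = 1 :=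
  h.eq_one y (abs_le.1 hy)

lemma amplitude_nonneg (h : IsSmoothCutoff N ε χ) (t : Fin k → ℝ) : 0 ≤ amplitude a χ x t :=
  Finset.prod_nonneg fun _ _ => h.nonneg _

lemma amplitude_le_one (h : IsSmoothCutoff N ε χ) (t : Fin k → ℝ) : amplitude a χ x t ≤ 1 :=
  Finset.prod_le_one (fun _ _ => h.nonneg _) fun _ _ => h.le_one _

lemma abs_amplitude_le_one (h : IsSmoothCutoff N ε χ) (t : Fin k → ℝ) : |amplitude a χ x t| ≤ 1 := by
  rw [abs_of_nonneg (amplitude_nonneg h t)]; exact amplitude_le_one h t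

lemma amplitude_eq_one (h : IsSmoothCutoff N ε χ) {t : Fin k → ℝ}
    (ht : ∀ j, |affineForm a x t j| ≤ N) : amplitude a χ x t = 1 :=
  Finset.prod_eq_one fun j _ => h.eq_one' (ht j)

lemma amplitude_eq_zero (h : IsSmoothCutoff N ε χ) {t : Fin k → ℝ} {j : Fin n}
    (ht : N + ε < |affineForm a x t j|) : amplitude a χ x t = 0 :=
  Finset.prod_eq_zero (Finset.mem_univ j) (h.eq_zero ht)

lemma continuous_amplitude (h : IsSmoothCutoff N ε χ) : Continuous (amplitude a χ x) := by
  have := h.contDiff.continuous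
  unfold amplitude affineForm
  fun_prop

lemma amplitude_eq_zero_of_lt (hF : FormBounds a r R) (h : IsSmoothCutoff N ε χ) (hε : ε ≤ N)
    (hx : |x| ≤ N) {t : Fin k → ℝ} {i : Fin k} (ht : R * N < |t i|) : amplitude a χ x t = 0 := by
  by_contra hne
  have : ∀ j, |affineForm a x t j| ≤ 2 * N := by
    intro j
    by_contra hj
    exact hne (amplitude_eq_zero h (j := j) (by linarith))
  have := hF.outside hx this i
  linarith

lemma isCompact_cube (k : ℕ) (ρ : ℝ) : IsCompact (cube k ρ) :=
  isCompact_univ_pi fun _ => isCompact_Icc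

lemma mem_cube {ρ : ℝ} {t : Fin k → ℝ} : t ∈ cube k ρ ↔ ∀ i, |t i| ≤ ρ := by
  simp [cube, abs_le, Pi.le_def, forall_and]

lemma amplitude_eq_zero_of_notMem (hF : FormBounds a r R) (h : IsSmoothCutoff N ε χ) (hε : ε ≤ N)
    (hx : |x| ≤ N) {t : Fin k → ℝ} (ht : t ∉ cube k (R * N)) : amplitude a χ x t = 0 := by
  rw [mem_cube] at ht
  push Not at ht
  obtain ⟨i, hi⟩ := ht
  exact amplitude_eq_zero_of_lt hF h hε hx hi

lemma integrable_of_cube {f : (Fin k → ℝ) → ℝ} {ρ M : ℝ} (hf : AEStronglyMeasurable f volume)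
    (hM : ∀ t, |f t| ≤ M) (h0 : ∀ t, t ∉ cube k ρ → f t = 0) : Integrable f := by
  have h : IntegrableOn f (cube k ρ) :=
    Measure.integrableOn_of_bounded (M := M) (isCompact_cube k ρ).measure_lt_top.ne
      hf (Filter.Eventually.of_forall hM)
  rw [← integrableOn_univ]
  exact h.of_forall_sdiff_eq_zero MeasurableSet.univ fun t ht => h0 t ht.2

lemma integrable_mul_amplitude (hF : FormBounds a r R) (h : IsSmoothCutoff N ε χ) (hε : ε ≤ N)
    (hx : |x| ≤ N) {w : (Fin k → ℝ) → ℝ} (hw : Measurable w) {M : ℝ} (hM : ∀ t, |w t| ≤ M) :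
    Integrable fun t => w t * amplitude a χ x t := by
  refine integrable_of_cube (ρ := R * N) (M := M)
    (hw.mul (continuous_amplitude h).measurable).aestronglyMeasurable (fun t => ?_) fun t ht => ?_
  · rw [abs_mul]
    exact (mul_le_of_le_one_right (abs_nonneg _) (abs_amplitude_le_one h t)).trans (hM t)
  · rw [amplitude_eq_zero_of_notMem hF h hε hx ht, mul_zero]

end Amplitude

section Slice

variable {d n : ℕ} {a : Fin (d + 1) → Fin n → ℝ} {r R N ε x : ℝ} {χ : ℝ → ℝ}

lemma integral_fin_cons {f : (Fin (d + 1) → ℝ) → ℝ} (hf : Integrable f) :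
    ∫ t, f t = ∫ t' : Fin d → ℝ, ∫ τ : ℝ, f (Fin.cons τ t') ∧
    Integrable fun t' : Fin d → ℝ => ∫ τ : ℝ, f (Fin.cons τ t') := by
  have e := (volume_preserving_piFinSuccAbove (fun _ : Fin (d + 1) => ℝ) 0).symm
  have hi : Integrable (fun p : ℝ × (Fin d → ℝ) => f (Fin.cons p.1 p.2)) (volume.prod volume) := by
    have := (e.integrable_comp_emb (MeasurableEquiv.measurableEmbedding _) (g := f)).2 hf
    refine this.congr (Filter.Eventually.of_forall fun p => ?_)
    simp [MeasurableEquiv.piFinSuccAbove_symm_apply, Fin.insertNthEquiv]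
  refine ⟨?_, hi.integral_prod_right⟩
  rw [← e.integral_comp']
  have := integral_prod_symm _ hi
  rw [← this]
  refine integral_congr_ae (Filter.Eventually.of_forall fun p => ?_)
  simp [MeasurableEquiv.piFinSuccAbove_symm_apply, Fin.insertNthEquiv]

lemma affineForm_cons (τ : ℝ) (t' : Fin d → ℝ) (j : Fin n) :
    affineForm a x (Fin.cons τ t') j = affineForm (fun i => a i.succ) x t' j + a 0 j * τ := by
  simp [affineForm, Fin.sum_univ_succ]
  ring

/-- The slice in the first coordinate of the polytope where all forms are at most `N`. -/
def slice (a : Fin (d + 1) → Fin n → ℝ) (N x : ℝ) (t' : Fin d → ℝ) : Set ℝ :=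
  {τ | ∀ j, |affineForm a x (Fin.cons τ t') j| ≤ N}

lemma isClosed_slice (t' : Fin d → ℝ) : IsClosed (slice a N x t') := by
  simp only [slice, affineForm_cons, Set.ofPred_forall]
  exact isClosed_iInter fun j => isClosed_le (by fun_prop) continuous_const

lemma ordConnected_slice (t' : Fin d → ℝ) : (slice a N x t').OrdConnected := by
  refine ⟨fun τ₁ h₁ τ₂ h₂ τ hτ j => ?_⟩
  have h1 := abs_le.1 (h₁ j)
  have h2 := abs_le.1 (h₂ j)
  rw [affineForm_cons] at h1 h2 ⊢
  rw [abs_le]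
  rcases le_total 0 (a 0 j) with h | h
  · have := mul_le_mul_of_nonneg_left hτ.1 h
    have := mul_le_mul_of_nonneg_left hτ.2 h
    constructor <;> linarith
  · have := mul_le_mul_of_nonpos_left hτ.1 h
    have := mul_le_mul_of_nonpos_left hτ.2 h
    constructor <;> linarith

lemma slice_subset (hF : FormBounds a r R) (hN : 0 ≤ N) (hx : |x| ≤ N) (t' : Fin d → ℝ) :
    slice a N x t' ⊆ Set.Icc (-(R * N)) (R * N) := by
  intro τ hτ
  have := hF.outside (t := Fin.cons τ t') hx (fun j => (hτ j).trans (by linarith)) 0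
  rw [Fin.cons_zero] at this
  exact abs_le.1 this

lemma slice_eq (hF : FormBounds a r R) (hN : 0 ≤ N) (hx : |x| ≤ N) (t' : Fin d → ℝ) :
    slice a N x t' = ∅ ∨ ∃ p q, p ≤ q ∧ slice a N x t' = Set.Icc p q := by
  rcases Set.eq_empty_or_nonempty (slice a N x t') with h | h
  · exact Or.inl h
  · right
    have hc : IsCompact (slice a N x t') :=
      isCompact_Icc.of_isClosed_subset (isClosed_slice t') (slice_subset hF hN hx t')
    have ho := ordConnected_slice (a := a) (N := N) (x := x) t'
    refine ⟨sInf (slice a N x t'), sSup (slice a N x t'), csInf_le_csSup h hc.bddBelow hc.bddAbove,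
      Set.Subset.antisymm (subset_Icc_csInf_csSup hc.bddBelow hc.bddAbove) ?_⟩
    exact ho.out (hc.sInf_mem h) (hc.sSup_mem h)

/-- When the other coordinates are small, the slice is an interval containing `[-rN, rN]`. -/
lemma slice_eq_of_inside (hF : FormBounds a r R) (hN : 0 ≤ N) (hx : |x| ≤ r * N)
    {t' : Fin d → ℝ} (ht : ∀ i, |t' i| ≤ r * N) :
    ∃ p q, p ≤ -(r * N) ∧ r * N ≤ q ∧ slice a N x t' = Set.Icc p q := by
  have hrN : 0 ≤ r * N := mul_nonneg hF.r_pos.le hN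
  have hmem : ∀ τ, |τ| ≤ r * N → τ ∈ slice a N x t' := fun τ hτ =>
    hF.inside hx fun i => by
      refine Fin.cases ?_ (fun i => ?_) i
      · simpa using hτ
      · simpa using ht i
  have hx' : |x| ≤ N := hx.trans (mul_le_of_le_one_left hN hF.r_le_one)
  rcases slice_eq hF hN hx' t' with h | ⟨p, q, hpq, h⟩
  · have := hmem 0 (by simpa using hrN)
    rw [h] at this
    exact this.elim
  · have h1 := hmem (-(r * N)) (by rw [abs_neg, abs_of_nonneg hrN])
    have h2 := hmem (r * N) (by rw [abs_of_nonneg hrN])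
    rw [h] at h1 h2
    exact ⟨p, q, h1.1, h2.2, h⟩

lemma abs_setIntegral_slice_le (hF : FormBounds a r R) (hN : 0 ≤ N) (hx : |x| ≤ N)
    (t' : Fin d → ℝ) {w : ℝ → ℝ} {C : ℝ} (hC0 : 0 ≤ C)
    (hC : ∀ p q, p ≤ q → |∫ τ in p..q, w τ| ≤ C) : |∫ τ in slice a N x t', w τ| ≤ C := by
  rcases slice_eq hF hN hx t' with h | ⟨p, q, hpq, h⟩
  · simpa [h] using hC0
  · rw [h, integral_Icc_eq_integral_Ioc, ← intervalIntegral.integral_of_le hpq]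
    exact hC p q hpq

/-- The transition region of a cutoff. -/
def transitionSet (N ε : ℝ) : Set ℝ := Set.Icc (-(N + ε)) (-N) ∪ Set.Icc N (N + ε)

lemma measurableSet_transitionSet : MeasurableSet (transitionSet N ε) :=
  measurableSet_Icc.union measurableSet_Icc

lemma mem_transitionSet {z : ℝ} (h1 : N ≤ |z|) (h2 : |z| ≤ N + ε) : z ∈ transitionSet N ε := by
  rcases le_total 0 z with h | h
  · rw [abs_of_nonneg h] at h1 h2
    exact Or.inr ⟨h1, h2⟩
  · rw [abs_of_nonpos h] at h1 h2
    exact Or.inl ⟨by linarith, by linarith⟩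

lemma volume_transitionSet_lt_top : volume (transitionSet N ε) < ⊤ :=
  (isCompact_Icc.union isCompact_Icc).measure_lt_top

lemma integrable_indicator_transitionSet :
    Integrable (Set.indicator (transitionSet N ε) fun _ => (1 : ℝ)) :=
  (integrable_indicator_iff measurableSet_transitionSet).2
    (integrableOn_const volume_transitionSet_lt_top.ne)

lemma integral_indicator_transitionSet_le (hε : 0 ≤ ε) :
    ∫ z, Set.indicator (transitionSet N ε) (fun _ => (1 : ℝ)) z ≤ 2 * ε := by
  rw [integral_indicator measurableSet_transitionSet, setIntegral_const, smul_eq_mul, mul_one]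
  refine (measureReal_union_le _ _).trans ?_
  rw [Real.volume_real_Icc_of_le (by linarith), Real.volume_real_Icc_of_le (by linarith)]
  linarith

lemma integrable_indicator_comp {c : ℝ} (hc : c ≠ 0) (y : ℝ) :
    Integrable fun τ => Set.indicator (transitionSet N ε) (fun _ => (1 : ℝ)) (y + c * τ) :=
  ((integrable_indicator_transitionSet (N := N) (ε := ε)).comp_add_left y).comp_mul_left' hc

lemma integral_indicator_comp_le (hε : 0 ≤ ε) (c : ℝ) (y : ℝ) :
    ∫ τ, Set.indicator (transitionSet N ε) (fun _ => (1 : ℝ)) (y + c * τ) ≤ 2 / |c| * ε := by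
  rw [Measure.integral_comp_mul_left
    (fun z => Set.indicator (transitionSet N ε) (fun _ => (1 : ℝ)) (y + z)) c,
    integral_add_left_eq_self (fun z => Set.indicator (transitionSet N ε) (fun _ => (1 : ℝ)) z) y,
    smul_eq_mul, abs_inv]
  calc |c|⁻¹ * _ ≤ |c|⁻¹ * (2 * ε) :=
        mul_le_mul_of_nonneg_left (integral_indicator_transitionSet_le hε) (by positivity)
    _ = _ := by ring

/-- The total measure of the transition regions on a line in the first coordinate direction is at
most this constant times `ε`. -/
noncomputable def slopeConst (a : Fin (d + 1) → Fin n → ℝ) : ℝ := ∑ j, 2 / |a 0 j|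

lemma slopeConst_nonneg : 0 ≤ slopeConst a := Finset.sum_nonneg fun _ _ => by positivity

lemma slopeConst_signFlip (s : Fin (d + 1) → Bool) : slopeConst (signFlip s a) = slopeConst a := by
  simp [slopeConst, signFlip, abs_mul, abs_boolSign]

/-- On each line the amplitude may be replaced by the indicator function of an interval, up to an
error proportional to the width of the transition region of the cutoff. -/
lemma abs_integral_mul_amplitude_sub_le (hF : FormBounds a r R) (h : IsSmoothCutoff N ε χ)
    (ha : ∀ j, a 0 j ≠ 0) (hε0 : 0 ≤ ε) (hN : 0 ≤ N) (hx : |x| ≤ N)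
    (t' : Fin d → ℝ) {w : ℝ → ℝ} (hw : Measurable w) {M : ℝ} (hM : ∀ τ, |w τ| ≤ M) :
    |(∫ τ, w τ * amplitude a χ x (Fin.cons τ t')) - ∫ τ in slice a N x t', w τ|
      ≤ M * slopeConst a * ε := by
  have hM0 : 0 ≤ M := (abs_nonneg _).trans (hM 0)
  set y : Fin n → ℝ := affineForm (fun i => a i.succ) x t'
  have hms : MeasurableSet (slice a N x t') := (isClosed_slice t').measurableSet
  have hbd : Integrable fun τ => M * ∑ j, Set.indicator (transitionSet N ε) (fun _ => (1 : ℝ))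
      (y j + a 0 j * τ) :=
    (integrable_finsetSum _ fun j _ => integrable_indicator_comp (ha j) _).const_mul _
  have hpt : ∀ τ, ‖w τ * amplitude a χ x (Fin.cons τ t') - Set.indicator (slice a N x t') w τ‖ ≤
      M * ∑ j, Set.indicator (transitionSet N ε) (fun _ => (1 : ℝ)) (y j + a 0 j * τ) := by
    intro τ
    have hnn : ∀ j, 0 ≤ Set.indicator (transitionSet N ε) (fun _ => (1 : ℝ)) (y j + a 0 j * τ) :=
      fun j => Set.indicator_nonneg (fun _ _ => zero_le_one) _
    rw [Real.norm_eq_abs]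
    by_cases hτ : τ ∈ slice a N x t'
    · rw [Set.indicator_of_mem hτ, amplitude_eq_one h hτ, mul_one, sub_self, abs_zero]
      exact mul_nonneg hM0 (Finset.sum_nonneg fun j _ => hnn j)
    · rw [Set.indicator_of_notMem hτ, sub_zero]
      by_cases hz : amplitude a χ x (Fin.cons τ t') = 0
      · rw [hz, mul_zero, abs_zero]
        exact mul_nonneg hM0 (Finset.sum_nonneg fun j _ => hnn j)
      · -- Off the slice the amplitude is nonzero only if some form lies in the transition region.
        simp only [slice, Set.mem_ofPred_eq, not_forall, not_le] at hτ
        obtain ⟨j, hj⟩ := hτ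
        have hj2 : |affineForm a x (Fin.cons τ t') j| ≤ N + ε := by
          by_contra hlt
          exact hz (amplitude_eq_zero h (not_le.1 hlt))
        have hmem := mem_transitionSet hj.le hj2
        rw [affineForm_cons] at hmem
        rw [abs_mul]
        refine mul_le_mul (hM τ) ?_ (abs_nonneg _) hM0
        refine (abs_amplitude_le_one h _).trans ?_
        have h1 : Set.indicator (transitionSet N ε) (fun _ => (1 : ℝ)) (y j + a 0 j * τ) = 1 :=
          Set.indicator_of_mem hmem _
        refine h1.symm.le.trans ?_
        exact Finset.single_le_sum (f := fun j => Set.indicator (transitionSet N ε)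
          (fun _ => (1 : ℝ)) (y j + a 0 j * τ)) (fun j _ => hnn j) (Finset.mem_univ j)
  have hwI : Integrable (Set.indicator (slice a N x t') w) := by
    rw [integrable_indicator_iff hms]
    exact Measure.integrableOn_of_bounded (M := M)
      ((measure_mono (slice_subset hF hN hx t')).trans_lt isCompact_Icc.measure_lt_top).ne
      hw.aestronglyMeasurable (Filter.Eventually.of_forall hM)
  have hcont : Continuous fun τ : ℝ => amplitude a χ x (Fin.cons τ t' : Fin (d + 1) → ℝ) :=
    (continuous_amplitude h).comp (by fun_prop)
  have hdiff : Integrable fun τ =>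
      w τ * amplitude a χ x (Fin.cons τ t') - Set.indicator (slice a N x t') w τ :=
    hbd.mono' ((hw.mul hcont.measurable).sub (hw.indicator hms)).aestronglyMeasurable
      (Filter.Eventually.of_forall hpt)
  have hsum : Integrable fun τ => w τ * amplitude a χ x (Fin.cons τ t') := by
    refine (hdiff.add hwI).congr (Filter.Eventually.of_forall fun τ => ?_)
    simp
  rw [← integral_indicator hms, ← integral_sub hsum hwI]
  refine (norm_integral_le_of_norm_le hbd (Filter.Eventually.of_forall hpt)).trans ?_
  rw [integral_const_mul, integral_finsetSum _ fun j _ => integrable_indicator_comp (ha j) _,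
    mul_assoc, slopeConst, Finset.sum_mul]
  exact mul_le_mul_of_nonneg_left
    (Finset.sum_le_sum fun j _ => integral_indicator_comp_le hε0 _ _) hM0

end Slice

/-! ### The lower bound for the product phase -/

/-- The function `1 / |t|` on the annulus `p ≤ |t| ≤ q`. -/
noncomputable def invAbsOn (p q t : ℝ) : ℝ := Set.indicator (Set.Icc p q) (fun s => s⁻¹) |t|

/-- The indicator function of `[-ρ, ρ]`. -/
noncomputable def boxFun (ρ t : ℝ) : ℝ := Set.indicator (Set.Icc (-ρ) ρ) (fun _ => 1) t

/-- The function `1 / t` on `[1, q]`. -/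
noncomputable def invOn (q t : ℝ) : ℝ := Set.indicator (Set.Icc 1 q) (fun s => s⁻¹) t

lemma integrable_of_Icc {f : ℝ → ℝ} {ρ M : ℝ} (hf : Measurable f)
    (hM : ∀ t, |f t| ≤ M) (h0 : ∀ t, ρ < |t| → f t = 0) : Integrable f := by
  have h : IntegrableOn f (Set.Icc (-ρ) ρ) :=
    Measure.integrableOn_of_bounded (M := M) isCompact_Icc.measure_lt_top.ne
      hf.aestronglyMeasurable (Filter.Eventually.of_forall hM)
  rw [← integrableOn_univ]
  refine h.of_forall_sdiff_eq_zero MeasurableSet.univ fun t ht => h0 t ?_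
  by_contra hlt
  exact ht.2 (abs_le.1 (not_lt.1 hlt))

lemma invAbsOn_nonneg {p : ℝ} (hp : 0 < p) (q t : ℝ) : 0 ≤ invAbsOn p q t :=
  Set.indicator_nonneg (fun _ hs => inv_nonneg.2 (hp.le.trans hs.1)) _

lemma boxFun_nonneg (ρ t : ℝ) : 0 ≤ boxFun ρ t := Set.indicator_nonneg (fun _ _ => zero_le_one) _

lemma invAbsOn_of_mem {p q t : ℝ} (h1 : p ≤ |t|) (h2 : |t| ≤ q) : invAbsOn p q t = |t|⁻¹ :=
  Set.indicator_of_mem (show |t| ∈ Set.Icc p q from ⟨h1, h2⟩) _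

lemma boxFun_of_le {ρ t : ℝ} (h : |t| ≤ ρ) : boxFun ρ t = 1 :=
  Set.indicator_of_mem (show t ∈ Set.Icc (-ρ) ρ from abs_le.1 h) _

lemma invOn_of_mem {q t : ℝ} (h1 : 1 ≤ t) (h2 : t ≤ q) : invOn q t = t⁻¹ :=
  Set.indicator_of_mem (show t ∈ Set.Icc 1 q from ⟨h1, h2⟩) _

lemma invOn_eq_zero {q t : ℝ} (h : ¬ (1 ≤ t ∧ t ≤ q)) : invOn q t = 0 :=
  Set.indicator_of_notMem (show t ∉ Set.Icc 1 q from h) _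

lemma measurable_invAbsOn (p q : ℝ) : Measurable (invAbsOn p q) :=
  (measurable_inv.indicator measurableSet_Icc).comp continuous_abs.measurable

lemma integrable_invAbsOn {p : ℝ} (hp : 0 < p) (q : ℝ) : Integrable (invAbsOn p q) := by
  refine integrable_of_Icc (ρ := q) (M := p⁻¹) (measurable_invAbsOn p q) (fun t => ?_)
    fun t ht => Set.indicator_of_notMem (fun h => absurd h.2 (not_le.2 ht)) _
  rw [abs_of_nonneg (invAbsOn_nonneg hp q t)]
  by_cases h : |t| ∈ Set.Icc p q
  · rw [invAbsOn_of_mem h.1 h.2]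
    exact inv_anti₀ hp h.1
  · rw [invAbsOn, Set.indicator_of_notMem h]
    positivity

lemma integral_invAbsOn {p q : ℝ} (hp : 0 < p) (hpq : p ≤ q) :
    ∫ t, invAbsOn p q t = 2 * Real.log (q / p) := by
  simp only [invAbsOn]
  rw [integral_comp_abs (f := Set.indicator (Set.Icc p q) fun s => s⁻¹),
    setIntegral_indicator measurableSet_Icc, Set.inter_eq_self_of_subset_right,
    integral_Icc_eq_integral_Ioc, ← intervalIntegral.integral_of_le hpq,
    integral_inv_of_pos hp (hp.trans_le hpq)]
  exact fun t ht => hp.trans_le ht.1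

lemma integrable_boxFun (ρ : ℝ) : Integrable (boxFun ρ) :=
  (integrable_indicator_iff measurableSet_Icc).2
    (integrableOn_const isCompact_Icc.measure_lt_top.ne)

lemma integral_boxFun {ρ : ℝ} (hρ : 0 ≤ ρ) : ∫ t, boxFun ρ t = 2 * ρ := by
  simp only [boxFun]
  rw [integral_indicator measurableSet_Icc, setIntegral_const, Real.volume_real_Icc_of_le
    (by linarith), smul_eq_mul]
  ring

lemma integrable_invOn (q : ℝ) : Integrable (invOn q) := by
  refine (integrable_indicator_iff measurableSet_Icc).2 (ContinuousOn.integrableOn_Icc ?_)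
  exact continuousOn_inv₀.mono fun t ht => (zero_lt_one.trans_le ht.1).ne'

lemma integral_invOn {q : ℝ} (hq : 1 ≤ q) : ∫ t, invOn q t = Real.log q := by
  simp only [invOn]
  rw [integral_indicator measurableSet_Icc, integral_Icc_eq_integral_Ioc,
    ← intervalIntegral.integral_of_le hq, integral_inv_of_pos one_pos (one_pos.trans_le hq), div_one]

lemma integral_sinc_eq (u p q : ℝ) :
    |u| * ∫ τ in p..q, Real.sinc (u * τ) = sineIntegral (|u| * q) + sineIntegral (|u| * (-p)) := by
  have h : ∀ τ, Real.sinc (u * τ) = Real.sinc (|u| * τ) := by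
    intro τ
    rcases abs_choice u with h | h
    · rw [h]
    · rw [h, neg_mul, Real.sinc_neg]
  simp_rw [h]
  rw [mul_integral_sinc_mul, mul_neg, sineIntegral_neg]
  ring

lemma abs_integral_sinc_le {u : ℝ} (hu : u ≠ 0) (p q : ℝ) :
    |∫ τ in p..q, Real.sinc (u * τ)| ≤ 6 / |u| := by
  have hu' := abs_pos.2 hu
  rw [le_div_iff₀' hu']
  calc |u| * |∫ τ in p..q, Real.sinc (u * τ)| =
        |(|u| * ∫ τ in p..q, Real.sinc (u * τ))| := by
        rw [abs_mul, abs_abs]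
    _ ≤ |sineIntegral (|u| * q)| + |sineIntegral (|u| * (-p))| := by
        rw [integral_sinc_eq]; exact abs_add_le _ _
    _ ≤ 6 := by linarith [abs_sineIntegral_le (|u| * q), abs_sineIntegral_le (|u| * (-p))]

lemma integral_sinc_nonneg (u : ℝ) {p q : ℝ} (hp : p ≤ 0) (hq : 0 ≤ q) :
    0 ≤ ∫ τ in p..q, Real.sinc (u * τ) := by
  rcases eq_or_ne u 0 with rfl | hu
  · simp; linarith
  · have hu' := abs_pos.2 hu
    refine nonneg_of_mul_nonneg_right (b := ∫ τ in p..q, Real.sinc (u * τ)) ?_ hu'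
    rw [integral_sinc_eq]
    exact add_nonneg (sineIntegral_nonneg (by positivity))
      (sineIntegral_nonneg (mul_nonneg hu'.le (by linarith)))

lemma le_integral_sinc {u p q : ℝ} (hu : 1 ≤ u) (hp : p ≤ -1) (hq : 1 ≤ q) :
    1 / 2 * u⁻¹ ≤ ∫ τ in p..q, Real.sinc (u * τ) := by
  have hu0 : 0 < u := by linarith
  have h := integral_sinc_eq u p q
  rw [abs_of_pos hu0] at h
  have h1 := one_quarter_le_sineIntegral (z := u * q) (by nlinarith)
  have h2 := one_quarter_le_sineIntegral (z := u * (-p)) (by nlinarith)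
  rw [← div_eq_mul_inv, div_le_iff₀' hu0, h]
  linarith

section ProductPhase

variable {d n : ℕ} {a : Fin (d + 1) → Fin n → ℝ} {r R N ε x : ℝ} {χ : ℝ → ℝ}

/-- The integral of `sinc (u τ)` against the amplitude along a line in the first coordinate
direction. For the product phase `u` is the product of the remaining coordinates. -/
noncomputable def sliceIntegral (a : Fin (d + 1) → Fin n → ℝ) (χ : ℝ → ℝ) (x u : ℝ)
    (t' : Fin d → ℝ) : ℝ :=
  ∫ τ, Real.sinc (u * τ) * amplitude a χ x (Fin.cons τ t')

lemma sliceIntegral_eq_zero (hF : FormBounds a r R) (h : IsSmoothCutoff N ε χ) (hε : ε ≤ N)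
    (hx : |x| ≤ N) {t' : Fin d → ℝ} (ht : ¬ ∀ i, |t' i| ≤ R * N) (u : ℝ) :
    sliceIntegral a χ x u t' = 0 := by
  push Not at ht
  obtain ⟨i, hi⟩ := ht
  rw [sliceIntegral]
  refine integral_eq_zero_of_ae (Filter.Eventually.of_forall fun τ => ?_)
  simp only
  rw [amplitude_eq_zero_of_lt hF h hε hx (i := i.succ) (by simpa using hi), mul_zero]
  rfl

lemma abs_sliceIntegral_le (hF : FormBounds a r R) (h : IsSmoothCutoff N ε χ) (hε : ε ≤ N)
    (hN : 0 ≤ N) (hx : |x| ≤ N) (u : ℝ) (t' : Fin d → ℝ) :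
    |sliceIntegral a χ x u t'| ≤ 2 * (R * N) := by
  have hRN : 0 ≤ R * N := mul_nonneg (zero_le_one.trans hF.one_le_R) hN
  rw [sliceIntegral, ← integral_boxFun hRN, ← Real.norm_eq_abs]
  refine norm_integral_le_of_norm_le (integrable_boxFun _) (Filter.Eventually.of_forall fun τ => ?_)
  rw [Real.norm_eq_abs]
  by_cases hτ : |τ| ≤ R * N
  · rw [boxFun_of_le hτ, abs_mul]
    exact mul_le_one₀ (Real.abs_sinc_le_one _) (abs_nonneg _) (abs_amplitude_le_one h _)
  · rw [amplitude_eq_zero_of_lt hF h hε hx (i := 0) (by simpa using hτ), mul_zero, abs_zero]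
    exact boxFun_nonneg _ _

lemma abs_sliceIntegral_sub_le (hF : FormBounds a r R) (h : IsSmoothCutoff N ε χ)
    (ha : ∀ j, a 0 j ≠ 0) (hε0 : 0 ≤ ε) (hN : 0 ≤ N) (hx : |x| ≤ N) (u : ℝ) (t' : Fin d → ℝ) :
    |sliceIntegral a χ x u t' - ∫ τ in slice a N x t', Real.sinc (u * τ)| ≤ slopeConst a * ε := by
  have := abs_integral_mul_amplitude_sub_le hF h ha hε0 hN hx t'
    (w := fun τ => Real.sinc (u * τ)) (M := 1)
    (Real.continuous_sinc.comp (continuous_const_mul u)).measurable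
    (fun τ => Real.abs_sinc_le_one _)
  rwa [one_mul] at this

lemma abs_sliceIntegral_le_div (hF : FormBounds a r R) (h : IsSmoothCutoff N ε χ)
    (ha : ∀ j, a 0 j ≠ 0) (hε0 : 0 ≤ ε) (hN : 0 ≤ N) (hx : |x| ≤ N) {u : ℝ} (hu : u ≠ 0)
    (t' : Fin d → ℝ) : |sliceIntegral a χ x u t'| ≤ 6 / |u| + slopeConst a * ε := by
  have h1 := abs_sliceIntegral_sub_le hF h ha hε0 hN hx u t'
  have h2 := abs_setIntegral_slice_le hF hN hx t' (w := fun τ => Real.sinc (u * τ))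
    (by positivity) fun p q _ => abs_integral_sinc_le hu p q
  have h3 := abs_add_le (sliceIntegral a χ x u t' - ∫ τ in slice a N x t', Real.sinc (u * τ))
    (∫ τ in slice a N x t', Real.sinc (u * τ))
  rw [sub_add_cancel] at h3
  linarith

/-- When the other coordinates are small, the slice is an interval around the origin, over which the
integral of `sinc` is nonnegative, and of size at least `1 / u` if the interval is long. -/
lemma le_sliceIntegral_of_inside (hF : FormBounds a r R) (h : IsSmoothCutoff N ε χ)
    (ha : ∀ j, a 0 j ≠ 0) (hε0 : 0 ≤ ε) (hN : 0 ≤ N) (hx : |x| ≤ r * N) (u : ℝ)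
    {t' : Fin d → ℝ} (ht : ∀ i, |t' i| ≤ r * N) :
    -(slopeConst a * ε) ≤ sliceIntegral a χ x u t' ∧
    (1 ≤ u → 1 ≤ r * N → 1 / 2 * u⁻¹ - slopeConst a * ε ≤ sliceIntegral a χ x u t') := by
  have hx' : |x| ≤ N := hx.trans (mul_le_of_le_one_left hN hF.r_le_one)
  have h1 := (abs_le.1 (abs_sliceIntegral_sub_le hF h ha hε0 hN hx' u t')).1
  have hrN : 0 ≤ r * N := mul_nonneg hF.r_pos.le hN
  obtain ⟨p, q, hp, hq, hs⟩ := slice_eq_of_inside hF hN hx ht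
  rw [hs, integral_Icc_eq_integral_Ioc, ← intervalIntegral.integral_of_le (by linarith)] at h1
  constructor
  · have := integral_sinc_nonneg u (p := p) (q := q) (by linarith) (by linarith)
    linarith
  · intro hu hrN1
    have := le_integral_sinc hu (p := p) (q := q) (by linarith) (by linarith)
    linarith

/-- The pointwise lower bound for the slice integral. The main term lives where all coordinates lie
in `[1, rN]`; of the error terms, the one in the second line deals with points having a tiny
coordinate and the last one with points having a coordinate of size comparable to `N`. -/
lemma le_sliceIntegral (hF : FormBounds a r R) (h : IsSmoothCutoff N ε χ)
    (ha : ∀ j, a 0 j ≠ 0) (hε0 : 0 ≤ ε) (hε : ε ≤ N) (hN : 0 ≤ N) (hrN : 1 ≤ r * N)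
    (hx : |x| ≤ r * N) {δ : ℝ} (hδ : 0 < δ) (t' : Fin d → ℝ) :
    1 / 2 * ∏ l, invOn (r * N) (t' l) - slopeConst a * ε * ∏ l, boxFun (R * N) (t' l)
      - 2 * (R * N) * ∑ l, ∏ i, (if i = l then boxFun δ else boxFun (R * N)) (t' i)
      - 6 * ∑ l, ∏ i, (if i = l then invAbsOn (r * N) (R * N) else invAbsOn δ (R * N)) (t' i)
      ≤ sliceIntegral a χ x (∏ i, t' i) t' := by
  have hx' : |x| ≤ N := hx.trans (mul_le_of_le_one_left hN hF.r_le_one)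
  have hRN : 0 ≤ R * N := mul_nonneg (zero_le_one.trans hF.one_le_R) hN
  have hrR : r * N ≤ R * N := mul_le_mul_of_nonneg_right (hF.r_le_one.trans hF.one_le_R) hN
  have hκ : 0 ≤ slopeConst a * ε := mul_nonneg slopeConst_nonneg hε0
  have hA : ∀ l i, 0 ≤ (if i = l then boxFun δ else boxFun (R * N)) (t' i) := by
    intro l i; split_ifs <;> exact boxFun_nonneg _ _
  have hB : ∀ l i,
      0 ≤ (if i = l then invAbsOn (r * N) (R * N) else invAbsOn δ (R * N)) (t' i) := by
    intro l i; split_ifs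
    · exact invAbsOn_nonneg (by linarith) _ _
    · exact invAbsOn_nonneg hδ _ _
  have hAs := fun l => Finset.prod_nonneg (s := Finset.univ) fun i _ => hA l i
  have hBs := fun l => Finset.prod_nonneg (s := Finset.univ) fun i _ => hB l i
  have hA0 : 0 ≤ 2 * (R * N) * ∑ l, ∏ i, (if i = l then boxFun δ else boxFun (R * N)) (t' i) :=
    mul_nonneg (by linarith) (Finset.sum_nonneg fun l _ => hAs l)
  have hB0 : 0 ≤ 6 * ∑ l, ∏ i,
      (if i = l then invAbsOn (r * N) (R * N) else invAbsOn δ (R * N)) (t' i) :=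
    mul_nonneg (by norm_num) (Finset.sum_nonneg fun l _ => hBs l)
  have hbox0 : 0 ≤ slopeConst a * ε * ∏ l, boxFun (R * N) (t' l) :=
    mul_nonneg hκ (Finset.prod_nonneg fun _ _ => boxFun_nonneg _ _)
  have hinv0 : ¬ (∀ l, 1 ≤ t' l ∧ t' l ≤ r * N) → ∏ l, invOn (r * N) (t' l) = 0 := by
    intro hne
    push Not at hne
    obtain ⟨l, hl⟩ := hne
    exact Finset.prod_eq_zero (Finset.mem_univ l)
      (invOn_eq_zero fun hh => absurd (hl hh.1) (not_lt.2 hh.2))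
  -- Outside the large cube everything vanishes.
  by_cases hQ : ∀ i, |t' i| ≤ R * N
  swap
  · rw [sliceIntegral_eq_zero hF h hε hx' hQ, hinv0]
    · linarith
    · intro hall
      exact hQ fun i => by
        rw [abs_of_nonneg (by linarith [(hall i).1])]
        exact (hall i).2.trans hrR
  have hbox : ∏ l, boxFun (R * N) (t' l) = 1 := Finset.prod_eq_one fun l _ => boxFun_of_le (hQ l)
  rw [hbox, mul_one] at *
  by_cases hin : ∀ i, |t' i| ≤ r * N
  · obtain ⟨h1, h2⟩ := le_sliceIntegral_of_inside hF h ha hε0 hN hx (∏ i, t' i) hin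
    by_cases hall : ∀ l, 1 ≤ t' l ∧ t' l ≤ r * N
    · have hu : 1 ≤ ∏ i, t' i := Finset.one_le_prod fun i _ => (hall i).1
      have h3 := h2 hu hrN
      have e : ∏ l, invOn (r * N) (t' l) = (∏ i, t' i)⁻¹ := by
        rw [← Finset.prod_inv_distrib]
        exact Finset.prod_congr rfl fun l _ => invOn_of_mem (hall l).1 (hall l).2
      rw [e]
      linarith
    · rw [hinv0 hall]
      linarith
  · rw [hinv0 fun hall => hin fun i => by
      rw [abs_of_nonneg (by linarith [(hall i).1])]
      exact (hall i).2]
    push Not at hin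
    obtain ⟨m, hm⟩ := hin
    by_cases hδl : ∃ l, |t' l| ≤ δ
    · -- A coordinate is tiny: the trivial bound by the length of the slice suffices.
      obtain ⟨l, hl⟩ := hδl
      have h1 := (abs_le.1 (abs_sliceIntegral_le hF h hε hN hx' (∏ i, t' i) t')).1
      have h2 : (1 : ℝ) ≤ ∑ l, ∏ i, (if i = l then boxFun δ else boxFun (R * N)) (t' i) := by
        have e : ∏ i, (if i = l then boxFun δ else boxFun (R * N)) (t' i) = 1 := by
          refine Finset.prod_eq_one fun i _ => ?_
          split_ifs with hil
          · rw [hil]; exact boxFun_of_le hl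
          · exact boxFun_of_le (hQ i)
        rw [← e]
        exact Finset.single_le_sum (f := fun l => ∏ i,
          (if i = l then boxFun δ else boxFun (R * N)) (t' i)) (fun l _ => hAs l)
          (Finset.mem_univ l)
      nlinarith
    · -- No coordinate is tiny and one is large: the bound `6 / |u|` for the sine integral is used.
      push Not at hδl
      have hu : ∏ i, t' i ≠ 0 :=
        Finset.prod_ne_zero_iff.2 fun i _ => abs_pos.1 (hδ.trans (hδl i))
      have h1 := (abs_le.1 (abs_sliceIntegral_le_div hF h ha hε0 hN hx' hu t')).1
      have h2 : |∏ i, t' i|⁻¹ ≤ ∑ l, ∏ i,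
          (if i = l then invAbsOn (r * N) (R * N) else invAbsOn δ (R * N)) (t' i) := by
        have e : ∏ i, (if i = m then invAbsOn (r * N) (R * N) else invAbsOn δ (R * N)) (t' i)
            = |∏ i, t' i|⁻¹ := by
          rw [Finset.abs_prod, ← Finset.prod_inv_distrib]
          refine Finset.prod_congr rfl fun i _ => ?_
          split_ifs with hil
          · rw [hil]; exact invAbsOn_of_mem hm.le (hQ m)
          · exact invAbsOn_of_mem (hδl i).le (hQ i)
        rw [← e]
        exact Finset.single_le_sum (f := fun l => ∏ i,
          (if i = l then invAbsOn (r * N) (R * N) else invAbsOn δ (R * N)) (t' i))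
          (fun l _ => hBs l) (Finset.mem_univ m)
      rw [div_eq_mul_inv] at h1
      linarith

lemma integrable_prod_ite {A B : ℝ → ℝ} (hA : Integrable A) (hB : Integrable B) (l : Fin d) :
    Integrable fun t : Fin d → ℝ => ∏ i, (if i = l then A else B) (t i) := by
  rw [volume_pi]
  refine Integrable.fintype_prod (f := fun i => if i = l then A else B) fun i => ?_
  split_ifs
  · exact hA
  · exact hB

lemma integral_prod_ite (A B : ℝ → ℝ) (l : Fin d) :
    ∫ t : Fin d → ℝ, ∏ i, (if i = l then A else B) (t i) =
      (∫ s, A s) * (∫ s, B s) ^ (d - 1) := by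
  rw [integral_fintype_prod_volume_eq_prod (fun i => if i = l then A else B),
    ← Finset.mul_prod_erase _ _ (Finset.mem_univ l), if_pos rfl]
  congr 1
  rw [Finset.prod_congr rfl (g := fun _ => ∫ s, B s)
    fun i hi => by rw [if_neg (Finset.ne_of_mem_erase hi)]]
  simp [Finset.card_erase_of_mem]

lemma integrable_prod_const {A : ℝ → ℝ} (hA : Integrable A) :
    Integrable fun t : Fin d → ℝ => ∏ i, A (t i) := by
  rw [volume_pi]
  exact Integrable.fintype_prod (f := fun _ => A) fun _ => hA

lemma integral_prod_const (A : ℝ → ℝ) :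
    ∫ t : Fin d → ℝ, ∏ i, A (t i) = (∫ s, A s) ^ d := by
  rw [integral_fintype_prod_volume_eq_pow, Fintype.card_fin]

lemma le_integral_sinc_mul_amplitude (hF : FormBounds a r R) (h : IsSmoothCutoff N ε χ)
    (ha : ∀ j, a 0 j ≠ 0) (hε0 : 0 ≤ ε) (hε : ε ≤ N) (hN : 0 ≤ N) (hrN : 1 ≤ r * N)
    (hx : |x| ≤ r * N) {δ : ℝ} (hδ : 0 < δ) (hδN : δ ≤ R * N) :
    1 / 2 * Real.log (r * N) ^ d - slopeConst a * ε * (2 * (R * N)) ^ d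
      - 2 * (R * N) * (d * (2 * δ * (2 * (R * N)) ^ (d - 1)))
      - 6 * (d * (2 * Real.log (R * N / (r * N)) * (2 * Real.log (R * N / δ)) ^ (d - 1)))
      ≤ ∫ t, Real.sinc (∏ i, t i) * amplitude a χ x t := by
  have hx' : |x| ≤ N := hx.trans (mul_le_of_le_one_left hN hF.r_le_one)
  have hRN : 0 ≤ R * N := mul_nonneg (zero_le_one.trans hF.one_le_R) hN
  have hrR : r * N ≤ R * N := mul_le_mul_of_nonneg_right (hF.r_le_one.trans hF.one_le_R) hN
  have hrN0 : 0 < r * N := by linarith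
  have hI := integrable_mul_amplitude hF h hε hx' (w := fun t => Real.sinc (∏ i, t i)) (M := 1)
    (Continuous.measurable (by have := Real.continuous_sinc; fun_prop))
    (fun t => Real.abs_sinc_le_one _)
  obtain ⟨h1, h2⟩ := integral_fin_cons hI
  have e : ∀ t' : Fin d → ℝ, ∫ τ : ℝ, Real.sinc (∏ i, (Fin.cons τ t' : Fin (d + 1) → ℝ) i) *
      amplitude a χ x (Fin.cons τ t') = sliceIntegral a χ x (∏ i, t' i) t' := by
    intro t'
    rw [sliceIntegral]
    congr 1
    funext τ
    rw [Fin.prod_univ_succ]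
    simp only [Fin.cons_zero, Fin.cons_succ]
    rw [mul_comm τ]
  simp_rw [e] at h1 h2
  rw [h1]
  have i1 : Integrable fun t' : Fin d → ℝ => 1 / 2 * ∏ l, invOn (r * N) (t' l) :=
    (integrable_prod_const (integrable_invOn _)).const_mul _
  have i2 : Integrable fun t' : Fin d → ℝ => slopeConst a * ε * ∏ l, boxFun (R * N) (t' l) :=
    (integrable_prod_const (integrable_boxFun _)).const_mul _
  have i3 : Integrable fun t' : Fin d → ℝ => 2 * (R * N) *
      ∑ l, ∏ i, (if i = l then boxFun δ else boxFun (R * N)) (t' i) :=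
    (integrable_finsetSum _ fun l _ =>
      integrable_prod_ite (integrable_boxFun _) (integrable_boxFun _) l).const_mul _
  have i4 : Integrable fun t' : Fin d → ℝ => 6 * ∑ l, ∏ i,
      (if i = l then invAbsOn (r * N) (R * N) else invAbsOn δ (R * N)) (t' i) :=
    (integrable_finsetSum _ fun l _ => integrable_prod_ite
      (integrable_invAbsOn hrN0 _) (integrable_invAbsOn hδ _) l).const_mul _
  have i12 : Integrable fun t' : Fin d → ℝ => 1 / 2 * ∏ l, invOn (r * N) (t' l) -
      slopeConst a * ε * ∏ l, boxFun (R * N) (t' l) := i1.sub i2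
  have i123 : Integrable fun t' : Fin d → ℝ => 1 / 2 * ∏ l, invOn (r * N) (t' l) -
      slopeConst a * ε * ∏ l, boxFun (R * N) (t' l) - 2 * (R * N) *
      ∑ l, ∏ i, (if i = l then boxFun δ else boxFun (R * N)) (t' i) := i12.sub i3
  refine le_trans (le_of_eq ?_) (integral_mono (i123.sub i4) h2
    fun t' => le_sliceIntegral hF h ha hε0 hε hN hrN hx hδ t')
  simp only [Pi.sub_apply]
  rw [integral_sub i123 i4, integral_sub i12 i3, integral_sub i1 i2, integral_const_mul,
    integral_const_mul, integral_const_mul,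
    integral_const_mul, integral_finsetSum _ fun l _ =>
      integrable_prod_ite (integrable_boxFun _) (integrable_boxFun _) l,
    integral_finsetSum _ fun l _ => integrable_prod_ite
      (integrable_invAbsOn hrN0 _) (integrable_invAbsOn hδ _) l]
  simp_rw [integral_prod_ite, integral_prod_const]
  rw [integral_invOn hrN, integral_boxFun hRN, integral_boxFun hδ.le, integral_invAbsOn hrN0 hrR,
    integral_invAbsOn hδ hδN]
  simp

/-- For the product phase in `d + 1` variables the absolutely convergent part of the singular
integral is at least of size `(log N) ^ d`, with constants depending on the coefficients only
through quantities that are invariant under changes of signs. -/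
theorem exists_log_pow_le_integral (hd : 0 < d) (r R κ : ℝ) :
    ∃ c N₀ : ℝ, 0 < c ∧ 1 < N₀ ∧ ∀ a : Fin (d + 1) → Fin n → ℝ, FormBounds a r R →
      slopeConst a = κ → (∀ j, a 0 j ≠ 0) → ∀ N : ℝ, N₀ ≤ N → ∀ ε : ℝ, 0 < ε → ε ≤ 1 / N ^ d →
        ∀ χ : ℝ → ℝ, IsSmoothCutoff N ε χ → ∀ x : ℝ, |x| ≤ r * N →
          c * Real.log N ^ d ≤ ∫ t, Real.sinc (∏ i, t i) * amplitude a χ x t := by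
  -- The error terms are those of `le_integral_sinc_mul_amplitude` with `δ = N ^ (-d)`: the first two
  -- are bounded, while the third is of order `L ^ (d - 1)`, where `L = log N`.
  set C₁ : ℝ := |κ * (2 * R) ^ d| with hC₁
  set C₂ : ℝ := |2 * d * (2 * R) ^ d| with hC₂
  set C₃ : ℝ := |12 * d * Real.log (R / r) * (2 * (d + 2)) ^ (d - 1)| with hC₃
  set C : ℝ := C₁ + C₂ + C₃ with hC
  have hC0 : 0 ≤ C := by positivity
  -- For `L ≥ M` the errors take up at most half of the main term.
  set M : ℝ := 1 + |Real.log R| + 2 * |Real.log r| + 4 * 2 ^ d * C with hM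
  refine ⟨1 / (4 * 2 ^ d), Real.exp M, by positivity, Real.one_lt_exp_iff.2 (by positivity), ?_⟩
  intro a hF hκ ha N hN ε hε0 hεN χ h x hx
  have hN0 : 0 < N := (Real.exp_pos M).trans_le hN
  set L := Real.log N with hL
  have hML : M ≤ L := (Real.le_log_iff_exp_le hN0).2 hN
  have hpow : 0 ≤ 4 * 2 ^ d * C := by positivity
  have hL1 : 1 ≤ L := by linarith [abs_nonneg (Real.log R), abs_nonneg (Real.log r)]
  have hLR : Real.log R ≤ L := by
    linarith [le_abs_self (Real.log R), abs_nonneg (Real.log r), abs_nonneg (Real.log R)]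
  have hLr : L / 2 ≤ L + Real.log r := by
    linarith [neg_abs_le (Real.log r), abs_nonneg (Real.log R)]
  have hLC : 4 * 2 ^ d * C ≤ L := by
    linarith [abs_nonneg (Real.log R), abs_nonneg (Real.log r)]
  have hr := hF.r_pos
  have hR : 0 < R := zero_lt_one.trans_le hF.one_le_R
  have hN1 : 1 ≤ N := by
    rw [← Real.log_nonneg_iff hN0]; linarith
  have hNd : 1 ≤ N ^ d := one_le_pow₀ hN1
  have hNd0 : 0 < N ^ d := by positivity
  have hlogr : Real.log (r * N) = L + Real.log r := by
    rw [Real.log_mul hr.ne' hN0.ne', add_comm]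
  have hrN : 1 ≤ r * N := by
    rw [← Real.log_nonneg_iff (by positivity), hlogr]; linarith
  have hε1 : ε ≤ N := by
    refine (hεN.trans ?_).trans hN1
    rw [div_le_one hNd0]
    exact hNd
  have hδN : (N ^ d)⁻¹ ≤ R * N := by
    refine (inv_le_one_of_one_le₀ hNd).trans ?_
    nlinarith [hF.one_le_R]
  refine le_trans ?_ (le_integral_sinc_mul_amplitude hF h ha hε0.le hε1 hN0.le hrN hx
    (inv_pos.2 hNd0) hδN)
  have e1 : slopeConst a * ε * (2 * (R * N)) ^ d ≤ C₁ := by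
    refine le_trans ?_ (le_abs_self _)
    rw [hκ, ← mul_assoc 2 R N, mul_pow (2 * R) N]
    have h1 : ε * N ^ d ≤ 1 := by rwa [le_div_iff₀ hNd0] at hεN
    have h2 : 0 ≤ κ := hκ ▸ slopeConst_nonneg
    calc κ * ε * ((2 * R) ^ d * N ^ d) = κ * (2 * R) ^ d * (ε * N ^ d) := by ring
      _ ≤ κ * (2 * R) ^ d * 1 := by gcongr
      _ = _ := mul_one _
  have e2 : 2 * (R * N) * (d * (2 * (N ^ d)⁻¹ * (2 * (R * N)) ^ (d - 1))) ≤ C₂ := by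
    refine le_trans (le_of_eq ?_) (le_abs_self _)
    have : (2 * (R * N)) ^ d = 2 * (R * N) * (2 * (R * N)) ^ (d - 1) :=
      (mul_pow_sub_one hd.ne' _).symm
    calc 2 * (R * N) * (d * (2 * (N ^ d)⁻¹ * (2 * (R * N)) ^ (d - 1)))
        = 2 * d * (N ^ d)⁻¹ * (2 * (R * N) * (2 * (R * N)) ^ (d - 1)) := by ring
      _ = 2 * d * (2 * R) ^ d := by
          rw [← this, ← mul_assoc 2 R N, mul_pow (2 * R) N]
          field_simp
  have e3 : 6 * (d * (2 * Real.log (R * N / (r * N)) *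
      (2 * Real.log (R * N / (N ^ d)⁻¹)) ^ (d - 1))) ≤ C₃ * L ^ (d - 1) := by
    rw [mul_div_mul_right _ _ hN0.ne', div_inv_eq_mul,
      Real.log_mul (by positivity) hNd0.ne', Real.log_mul hR.ne' hN0.ne', Real.log_pow]
    have h1 : 0 ≤ Real.log R := Real.log_nonneg hF.one_le_R
    have h2 : 0 ≤ Real.log (R / r) :=
      Real.log_nonneg (by rw [one_le_div hr]; exact hF.r_le_one.trans hF.one_le_R)
    calc 6 * (d * (2 * Real.log (R / r) * (2 * (Real.log R + Real.log N + d * Real.log N)) ^ (d - 1)))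
        ≤ 6 * (d * (2 * Real.log (R / r) * (2 * (d + 2) * L) ^ (d - 1))) := by
          have : 2 * (Real.log R + Real.log N + d * Real.log N) ≤ 2 * (d + 2) * L := by
            rw [← hL]; nlinarith
          have h3 : 0 ≤ 2 * (Real.log R + Real.log N + d * Real.log N) := by
            rw [← hL]; positivity
          gcongr
      _ = 12 * d * Real.log (R / r) * (2 * (d + 2)) ^ (d - 1) * L ^ (d - 1) := by
          rw [mul_pow (2 * ((d : ℝ) + 2)) L]; ring
      _ ≤ C₃ * L ^ (d - 1) := mul_le_mul_of_nonneg_right (le_abs_self _) (by positivity)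
  have hLd : 1 ≤ L ^ (d - 1) := one_le_pow₀ hL1
  have e4 : C₁ + C₂ + C₃ * L ^ (d - 1) ≤ C * L ^ (d - 1) := by
    rw [hC]
    nlinarith [abs_nonneg (κ * (2 * R) ^ d), abs_nonneg (2 * d * (2 * R) ^ d)]
  have e5 : C * L ^ (d - 1) ≤ 1 / (4 * 2 ^ d) * L ^ d := by
    rw [← mul_pow_sub_one hd.ne' L, ← mul_assoc]
    refine mul_le_mul_of_nonneg_right ?_ (by positivity)
    rw [one_div_mul_eq_div, le_div_iff₀ (by positivity)]
    linarith
  have e6 : 2 * (1 / (4 * 2 ^ d) * L ^ d) ≤ 1 / 2 * Real.log (r * N) ^ d := by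
    calc 2 * (1 / (4 * 2 ^ d) * L ^ d) = 1 / 2 * (L / 2) ^ d := by
          rw [div_pow]; field_simp; norm_num
      _ ≤ _ := by
          rw [hlogr]
          gcongr
  linarith

end ProductPhase

/-! ### Chirps -/

lemma IsSmoothCutoff.hasCompactSupport {N ε : ℝ} {χ : ℝ → ℝ} (h : IsSmoothCutoff N ε χ) :
    HasCompactSupport χ :=
  isCompact_Icc.of_isClosed_subset (isClosed_tsupport χ) h.tsupport_subset

lemma exists_schwartz_eq_chirp {n : ℕ} {N ε : ℝ} {χ : ℝ → ℝ} (h : IsSmoothCutoff N ε χ) (k : ℕ)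
    (θ : Fin n → ℝ) : ∃ F : Fin n → 𝓢(ℝ, ℂ), (fun j => ⇑(F j)) = chirp k θ χ := by
  have h1 : ∀ j, HasCompactSupport (chirp k θ χ j) := fun j =>
    (h.hasCompactSupport.comp_left (g := ((↑) : ℝ → ℂ)) Complex.ofReal_zero).mul_right
  have h2 : ∀ j, ContDiff ℝ ∞ (chirp k θ χ j) := fun j => by
    refine ContDiff.mul (Complex.ofRealCLM.contDiff.comp h.contDiff) ?_
    refine ContDiff.cexp (contDiff_const.mul (Complex.ofRealCLM.contDiff.comp ?_))
    exact contDiff_const.mul (contDiff_id.pow k)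
  exact ⟨fun j => (h1 j).toSchwartzMap (h2 j), rfl⟩

lemma phasePolynomial_eq {k m : ℕ} (α : Fin k → Fin m → ℝ) (θ : Fin (m + 1) → ℝ) (x : ℝ)
    (t : Fin k → ℝ) :
    phasePolynomial α θ x t = ∑ j, θ j * affineForm (coeffMatrix α) x t j ^ k := by
  simp [phasePolynomial, Fin.sum_univ_succ, affineForm, coeffMatrix]

lemma prod_chirp_eq {k m : ℕ} (α : Fin k → Fin m → ℝ) (θ : Fin (m + 1) → ℝ) (χ : ℝ → ℝ) (x : ℝ)
    (s : Fin k → Bool) (t : Fin k → ℝ) :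
    ∏ j, chirp k θ χ j (affineForm (signFlip s (coeffMatrix α)) x t j) =
      (amplitude (signFlip s (coeffMatrix α)) χ x t : ℂ) * Complex.exp
        (Complex.I * (phasePolynomial α θ x (fun i => boolSign (s i) * t i) : ℝ)) := by
  simp only [chirp, amplitude]
  rw [Finset.prod_mul_distrib, ← Complex.exp_sum, ← Finset.mul_sum, ← Complex.ofReal_sum,
    Complex.ofReal_prod, phasePolynomial_eq]
  simp_rw [affineForm_signFlip]

/-- A lower bound for the imaginary part of a rotated truncated integral passes to the operator. -/
lemma le_norm_nHT_chirp {k m : ℕ} (α : Fin k → Fin m → ℝ) (θ : Fin (m + 1) → ℝ) {N ε : ℝ}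
    {χ : ℝ → ℝ} (h : IsSmoothCutoff N ε χ) (x : ℝ) {z : ℂ} (hz : ‖z‖ = 1) {B : ℝ}
    (hB : ∀ᶠ ρ in Filter.atTop, B ≤
      ∫ t in cube k ρ, (z * oddKernel (coeffMatrix α) (chirp k θ χ) x t).im) :
    B ≤ (4 * sineLimit) ^ k * ‖nHT α (chirp k θ χ) x‖ := by
  obtain ⟨F, hF⟩ := exists_schwartz_eq_chirp h k θ
  rw [← hF] at hB ⊢
  have hlim := (tendsto_integral_oddKernel α F x).norm
  have hS := sineLimit_pos
  rw [norm_mul, norm_pow, norm_mul, norm_mul, Complex.norm_I, mul_one, Complex.norm_real,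
    Real.norm_of_nonneg hS.le, Complex.norm_ofNat] at hlim
  refine ge_of_tendsto hlim ?_
  filter_upwards [hB] with ρ hρ
  have hint := (integrableOn_oddKernel (coeffMatrix α) F x ρ).const_mul z
  have e : ∫ t in cube k ρ, (z * oddKernel (coeffMatrix α) (fun j => ⇑(F j)) x t).im =
      (z * ∫ t in cube k ρ, oddKernel (coeffMatrix α) (fun j => ⇑(F j)) x t).im := by
    rw [← integral_const_mul]
    exact integral_im hint
  rw [e] at hρ
  refine hρ.trans ((le_abs_self _).trans ((Complex.abs_im_le_norm _).trans ?_))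
  rw [norm_mul, hz, one_mul]

lemma setIntegral_cube_mul_amplitude {k n : ℕ} {a : Fin k → Fin n → ℝ} {r R N ε x : ℝ} {χ : ℝ → ℝ}
    (hF : FormBounds a r R) (h : IsSmoothCutoff N ε χ) (hε : ε ≤ N) (hx : |x| ≤ N)
    (w : (Fin k → ℝ) → ℝ) {ρ : ℝ} (hρ : R * N ≤ ρ) :
    ∫ t in cube k ρ, w t * amplitude a χ x t = ∫ t, w t * amplitude a χ x t := by
  refine setIntegral_eq_integral_of_forall_compl_eq_zero fun t ht => ?_
  rw [amplitude_eq_zero_of_notMem hF h hε hx, mul_zero]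
  intro hmem
  exact ht (mem_cube.2 fun i => (mem_cube.1 hmem i).trans hρ)

lemma KillsAllButProduct.eq_zero {k m : ℕ} {α : Fin k → Fin m → ℝ} {θ : Fin (m + 1) → ℝ}
    (h : KillsAllButProduct α θ) (v : Fin k → ℝ)
    (hv : ∀ j, ∑ i, coeffMatrix α i j * v i = 0) : v = 0 := by
  obtain ⟨A, hA⟩ := h
  by_contra hne
  obtain ⟨l, hl⟩ := Function.ne_iff.1 hne
  -- The phase is invariant under translation by `v`, while the product is not: it vanishes at a
  -- point with `l`-th coordinate `0` and can be made equal to `v l` at its translate.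
  set t : Fin k → ℝ := fun i => if i = l then 0 else 1 - v i with ht
  have h1 := hA 0 t
  have h2 := hA 0 (t + v)
  have e : phasePolynomial α θ 0 (t + v) = phasePolynomial α θ 0 t := by
    rw [phasePolynomial_eq, phasePolynomial_eq]
    refine Finset.sum_congr rfl fun j _ => ?_
    congr 2
    simp only [affineForm, Pi.add_apply, mul_add, Finset.sum_add_distrib, hv j, add_zero]
  have e1 : ∏ i, t i = 0 := Finset.prod_eq_zero (Finset.mem_univ l) (by simp [ht])
  have e2 : ∏ i, (t + v) i = v l := by
    rw [Finset.prod_eq_single l]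
    · simp [ht]
    · intro i _ hi; simp [ht, hi]
    · simp
  rw [e, h1, e1, e2] at h2
  exact hl (by simpa using (add_left_cancel h2).symm)

lemma coeffMatrix_ne_zero {k m : ℕ} {α : Fin k → Fin m → ℝ} {i : Fin k} (h : ∀ j, α i j ≠ 0)
    (j : Fin (m + 1)) : coeffMatrix α i j ≠ 0 := by
  refine Fin.cases ?_ (fun j => ?_) j
  · simp [coeffMatrix]
  · simpa [coeffMatrix] using h j

/-- A reflection changes the product phase by its sign, which the oddness of the sine compensates:
after a rotation removing `A xᵏ`, all reflections contribute to the imaginary part with the same,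
absolutely convergent, kernel `sinc (∏ tᵢ)`. -/
lemma im_oddKernel_chirp_of_product {k m : ℕ} {α : Fin k → Fin m → ℝ} {θ : Fin (m + 1) → ℝ}
    {A : ℝ} (hA : ∀ x t, phasePolynomial α θ x t = A * x ^ k + ∏ i, t i) (χ : ℝ → ℝ)
    (x : ℝ) {t : Fin k → ℝ} (ht : ∀ i, t i ≠ 0) :
    (Complex.exp (((-(A * x ^ k) : ℝ) : ℂ) * Complex.I) *
      oddKernel (coeffMatrix α) (chirp k θ χ) x t).im =
      ∑ s : Fin k → Bool, Real.sinc (∏ i, t i) * amplitude (signFlip s (coeffMatrix α)) χ x t := by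
  have hT : ∏ i, t i ≠ 0 := Finset.prod_ne_zero_iff.2 fun i _ => ht i
  simp only [oddKernel]
  rw [mul_left_comm, Finset.mul_sum, Finset.mul_sum, Complex.im_sum]
  refine Finset.sum_congr rfl fun s _ => ?_
  rw [prod_chirp_eq, hA, Finset.prod_mul_distrib]
  set σ : ℝ := ∏ i, boolSign (s i) with hσ
  have hσ1 : σ = 1 ∨ σ = -1 := by
    have : |σ| = 1 := by rw [hσ, Finset.abs_prod]; simp [abs_boolSign]
    exact eq_or_eq_neg_of_abs_eq this
  set T := ∏ i, t i with hTdef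
  set G := amplitude (signFlip s (coeffMatrix α)) χ x t
  have e : (∏ i, (t i : ℂ))⁻¹ * (Complex.exp (((-(A * x ^ k) : ℝ) : ℂ) * Complex.I) *
      ((∏ i, (boolSign (s i) : ℂ)) * ((G : ℂ) *
        Complex.exp (Complex.I * ((A * x ^ k + σ * T : ℝ) : ℂ))))) =
      ((T⁻¹ * σ * G : ℝ) : ℂ) * Complex.exp (((σ * T : ℝ) : ℂ) * Complex.I) := by
    have e1 : Complex.exp (((σ * T : ℝ) : ℂ) * Complex.I) =
        Complex.exp (((-(A * x ^ k) : ℝ) : ℂ) * Complex.I) *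
        Complex.exp (Complex.I * ((A * x ^ k + σ * T : ℝ) : ℂ)) := by
      rw [← Complex.exp_add]
      congr 1
      push_cast
      ring
    rw [e1, hσ, hTdef]
    push_cast
    ring
  rw [e, Complex.im_ofReal_mul, Complex.exp_ofReal_mul_I_im, Real.sinc_of_ne_zero hT]
  rcases hσ1 with h | h <;> rw [h] <;> simp <;> field_simp

/-- The lower bound for chirps whose phases kill all monomials but `xᵏ` and `t₁ ⋯ tₖ`. -/
theorem exists_log_pow_le_norm_nHT {d m : ℕ} (hd : 0 < d) {α : Fin (d + 1) → Fin m → ℝ}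
    (hα : ∀ j, α 0 j ≠ 0) {θ : Fin (m + 1) → ℝ} (hθ : KillsAllButProduct α θ) :
    ∃ c c' N₀ : ℝ, 0 < c ∧ 0 < c' ∧ 1 < N₀ ∧
      ∀ N : ℝ, N₀ ≤ N → ∀ ε : ℝ, 0 < ε → ε ≤ 1 / N ^ d →
        ∀ χ : ℝ → ℝ, IsSmoothCutoff N ε χ → ∀ x : ℝ, |x| ≤ c' * N →
          c * Real.log N ^ d ≤ ‖nHT α (chirp (d + 1) θ χ) x‖ := by
  obtain ⟨r, R, hF⟩ := exists_formBounds _ hθ.eq_zero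
  obtain ⟨A, hA⟩ := hθ
  obtain ⟨c, N₀, hc, hN₀, H⟩ :=
    exists_log_pow_le_integral (n := m + 1) hd r R (slopeConst (coeffMatrix α))
  have hS := sineLimit_pos
  refine ⟨c / (4 * sineLimit) ^ (d + 1), r, N₀, by positivity, hF.r_pos, hN₀, ?_⟩
  intro N hN ε hε hεN χ h x hx
  have hN1 : 1 < N := hN₀.trans_le hN
  have hL : 0 ≤ Real.log N := Real.log_nonneg hN1.le
  have hε1 : ε ≤ N := by
    refine (hεN.trans ?_).trans hN1.le
    rw [div_le_one (by positivity)]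
    exact one_le_pow₀ hN1.le
  have hx' : |x| ≤ N := hx.trans (mul_le_of_le_one_left (by linarith) hF.r_le_one)
  rw [div_mul_eq_mul_div, div_le_iff₀' (by positivity)]
  refine le_norm_nHT_chirp α θ h x (z := Complex.exp (((-(A * x ^ (d + 1)) : ℝ) : ℂ) * Complex.I))
    (Complex.norm_exp_ofReal_mul_I _) ?_
  filter_upwards [Filter.eventually_ge_atTop (R * N)] with ρ hρ
  have e : ∫ t in cube (d + 1) ρ, (Complex.exp (((-(A * x ^ (d + 1)) : ℝ) : ℂ) * Complex.I) *
      oddKernel (coeffMatrix α) (chirp (d + 1) θ χ) x t).im = ∫ t in cube (d + 1) ρ,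
      ∑ s : Fin (d + 1) → Bool,
        Real.sinc (∏ i, t i) * amplitude (signFlip s (coeffMatrix α)) χ x t := by
    refine integral_congr_ae ?_
    filter_upwards [ae_cube_ne_zero ρ] with t ht
    exact im_oddKernel_chirp_of_product hA χ x ht
  rw [e, integral_finsetSum]
  · simp_rw [fun s => setIntegral_cube_mul_amplitude (hF.signFlip s) h hε1 hx'
      (fun t => Real.sinc (∏ i, t i)) hρ]
    have hs : ∀ s : Fin (d + 1) → Bool, c * Real.log N ^ d ≤
        ∫ t, Real.sinc (∏ i, t i) * amplitude (signFlip s (coeffMatrix α)) χ x t := fun s =>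
      H _ (hF.signFlip s) (slopeConst_signFlip s) (fun j => mul_ne_zero
        (abs_pos.1 (by rw [abs_boolSign]; exact one_pos)) (coeffMatrix_ne_zero hα j))
        N hN ε hε hεN χ h x hx
    -- All reflections contribute nonnegatively, so that a single one suffices.
    have h0 : 0 ≤ c * Real.log N ^ d := by positivity
    calc c * Real.log N ^ d ≤ _ := hs fun _ => true
      _ ≤ _ := Finset.single_le_sum (f := fun s =>
        ∫ t, Real.sinc (∏ i, t i) * amplitude (signFlip s (coeffMatrix α)) χ x t)
        (fun s _ => h0.trans (hs s)) (Finset.mem_univ fun _ => true)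
  · intro s _
    exact (integrable_mul_amplitude (hF.signFlip s) h hε1 hx' (w := fun t => Real.sinc (∏ i, t i))
      (M := 1) (Continuous.measurable (by have := Real.continuous_sinc; fun_prop))
      (fun t => Real.abs_sinc_le_one _)).integrableOn

/-! ### Cutoffs with controlled Lipschitz constants -/

lemma exists_lipschitz_smoothTransition :
    ∃ L : ℝ, 0 ≤ L ∧ ∀ y z : ℝ, |Real.smoothTransition y - Real.smoothTransition z| ≤ L * |y - z| := by
  have hd : ContDiff ℝ 1 Real.smoothTransition := Real.smoothTransition.contDiff (n := 1)
  obtain ⟨L, hL⟩ := (isCompact_Icc (a := (0 : ℝ)) (b := 1)).exists_bound_of_continuousOn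
    (hd.continuous_deriv le_rfl).continuousOn
  have hL0 : 0 ≤ L := (norm_nonneg _).trans (hL 0 ⟨le_rfl, zero_le_one⟩)
  refine ⟨L, hL0, fun y z => ?_⟩
  rw [← Real.smoothTransition.projIcc (x := y), ← Real.smoothTransition.projIcc (x := z)]
  have h1 := (convex_Icc (0 : ℝ) 1).norm_image_sub_le_of_norm_deriv_le
    (fun t _ => hd.differentiable one_ne_zero t) hL
    (Set.projIcc (0 : ℝ) 1 zero_le_one z).2 (Set.projIcc (0 : ℝ) 1 zero_le_one y).2
  exact h1.trans (mul_le_mul_of_nonneg_left (Set.abs_projIcc_sub_projIcc _) hL0)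

/-- Cutoffs exist with a Lipschitz constant inversely proportional to the width of the transition
region. -/
lemma exists_isSmoothCutoff :
    ∃ L : ℝ, 0 ≤ L ∧ ∀ N ε : ℝ, 0 < N → 0 < ε → ∃ χ : ℝ → ℝ, IsSmoothCutoff N ε χ ∧
      ∀ y z, |χ y - χ z| ≤ L / ε * |y - z| := by
  obtain ⟨L, hL0, hL⟩ := exists_lipschitz_smoothTransition
  refine ⟨2 * L, by positivity, fun N ε hN hε => ?_⟩
  let S := Real.smoothTransition
  have hS1 := Real.smoothTransition.le_one
  have hS0 := Real.smoothTransition.nonneg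
  refine ⟨fun y => S (1 + (N - y) / ε) * S (1 + (N + y) / ε),
    ⟨?_, fun y => mul_nonneg (hS0 _) (hS0 _), fun y => mul_le_one₀ (hS1 _) (hS0 _) (hS1 _),
      fun y hy => ?_, ?_⟩, fun y z => ?_⟩
  · have hS : ContDiff ℝ ∞ S := Real.smoothTransition.contDiff
    exact (hS.comp (by fun_prop)).mul (hS.comp (by fun_prop))
  · have h1 : 0 ≤ (N - y) / ε := div_nonneg (by linarith [hy.2]) hε.le
    have h2 : 0 ≤ (N + y) / ε := div_nonneg (by linarith [hy.1]) hε.le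
    simp only [S]
    rw [Real.smoothTransition.one_of_one_le (by linarith),
      Real.smoothTransition.one_of_one_le (by linarith), one_mul]
  · refine closure_minimal (fun y hy => ?_) isClosed_Icc
    rw [Function.mem_support] at hy
    by_contra hmem
    apply hy
    rw [Set.mem_Icc, not_and_or, not_le, not_le] at hmem
    rcases hmem with h | h
    · have : S (1 + (N + y) / ε) = 0 := by
        refine Real.smoothTransition.zero_of_nonpos ?_
        have : (N + y) / ε ≤ -1 := by rw [div_le_iff₀ hε]; linarith
        linarith
      rw [this, mul_zero]
    · have : S (1 + (N - y) / ε) = 0 := by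
        refine Real.smoothTransition.zero_of_nonpos ?_
        have : (N - y) / ε ≤ -1 := by rw [div_le_iff₀ hε]; linarith
        linarith
      rw [this, zero_mul]
  · have h1 : |S (1 + (N - y) / ε) - S (1 + (N - z) / ε)| ≤ L / ε * |y - z| := by
      refine (hL _ _).trans (le_of_eq ?_)
      rw [show 1 + (N - y) / ε - (1 + (N - z) / ε) = -((y - z) / ε) by ring, abs_neg, abs_div,
        abs_of_pos hε]
      ring
    have h2 : |S (1 + (N + y) / ε) - S (1 + (N + z) / ε)| ≤ L / ε * |y - z| := by
      refine (hL _ _).trans (le_of_eq ?_)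
      rw [show 1 + (N + y) / ε - (1 + (N + z) / ε) = (y - z) / ε by ring, abs_div,
        abs_of_pos hε]
      ring
    have e : S (1 + (N - y) / ε) * S (1 + (N + y) / ε) - S (1 + (N - z) / ε) * S (1 + (N + z) / ε)
        = (S (1 + (N - y) / ε) - S (1 + (N - z) / ε)) * S (1 + (N + y) / ε) +
          S (1 + (N - z) / ε) * (S (1 + (N + y) / ε) - S (1 + (N + z) / ε)) := by ring
    simp only
    rw [e]
    refine (abs_add_le _ _).trans ?_
    rw [abs_mul, abs_mul, abs_of_nonneg (hS0 _), abs_of_nonneg (hS0 _)]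
    have h3 := mul_le_of_le_one_right (abs_nonneg (S (1 + (N - y) / ε) - S (1 + (N - z) / ε)))
      (hS1 (1 + (N + y) / ε))
    have h4 := mul_le_of_le_one_left (abs_nonneg (S (1 + (N + y) / ε) - S (1 + (N + z) / ε)))
      (hS1 (1 + (N - z) / ε))
    calc _ ≤ L / ε * |y - z| + L / ε * |y - z| := add_le_add (h3.trans h1) (h4.trans h2)
      _ = 2 * L / ε * |y - z| := by ring

section Difference

variable {N ε L : ℝ} {χ : ℝ → ℝ}

/-- The symmetric difference of a cutoff with step `η` is of order `|η|` in `L¹`, uniformly in the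
width of the transition region, as for a function of bounded variation. -/
lemma integral_abs_cutoff_sub_le (h : IsSmoothCutoff N ε χ) (hε : 0 < ε) (hL0 : 0 ≤ L)
    (hL : ∀ y z, |χ y - χ z| ≤ L / ε * |y - z|) (η : ℝ) :
    (Integrable fun y => |χ (y + η) - χ (y - η)|) ∧
    ∫ y, |χ (y + η) - χ (y - η)| ≤ (4 + 8 * L) * |η| := by
  -- The difference lives within `|η| + ε` of the points `±N` and is at most `min 1 (2 L |η| / ε)`.
  set δ := |η| + ε with hδ
  have hδ0 : 0 ≤ δ := by positivity
  set μ := min 1 (L / ε * |2 * η|) with hμ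
  have hμ0 : 0 ≤ μ := le_min zero_le_one (by positivity)
  have hpt : ∀ y, ‖|χ (y + η) - χ (y - η)|‖ ≤
      μ * Set.indicator (transitionSet (N - δ) (2 * δ)) (fun _ => (1 : ℝ)) y := by
    intro y
    rw [Real.norm_eq_abs, abs_abs]
    have a1 := abs_sub_abs_le_abs_sub y (-η)
    have a2 := abs_sub_abs_le_abs_sub y η
    have a3 := abs_add_le y η
    have a4 := abs_sub y η
    rw [abs_neg, sub_neg_eq_add] at a1
    by_cases hy : y ∈ transitionSet (N - δ) (2 * δ)
    · rw [Set.indicator_of_mem hy, mul_one]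
      refine le_min ?_ ?_
      · rw [abs_le]
        constructor <;> linarith [h.nonneg (y + η), h.nonneg (y - η), h.le_one (y + η),
          h.le_one (y - η)]
      · refine (hL _ _).trans (le_of_eq ?_)
        congr 2
        ring
    · rw [Set.indicator_of_notMem hy, mul_zero]
      by_cases hlt : |y| < N - δ
      · rw [h.eq_one' (by linarith), h.eq_one' (by linarith), sub_self, abs_zero]
      · have : N + δ < |y| := by
          by_contra hle
          exact hy (mem_transitionSet (not_lt.1 hlt) (by linarith))
        rw [h.eq_zero (by linarith), h.eq_zero (by linarith), sub_self, abs_zero]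
  have hbd : Integrable fun y =>
      μ * Set.indicator (transitionSet (N - δ) (2 * δ)) (fun _ => (1 : ℝ)) y :=
    integrable_indicator_transitionSet.const_mul _
  have hc := h.contDiff.continuous
  refine ⟨hbd.mono' (Continuous.aestronglyMeasurable (by fun_prop))
    (Filter.Eventually.of_forall hpt), ?_⟩
  refine (le_abs_self _).trans ((norm_integral_le_of_norm_le hbd
    (Filter.Eventually.of_forall hpt)).trans ?_)
  rw [integral_const_mul]
  have h1 := integral_indicator_transitionSet_le (N := N - δ) (ε := 2 * δ) (by linarith)
  have h2 : μ ≤ 1 := min_le_left _ _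
  have h3 : μ ≤ L / ε * |2 * η| := min_le_right _ _
  have h4 : μ * ε ≤ 2 * L * |η| := by
    calc μ * ε ≤ L / ε * |2 * η| * ε := mul_le_mul_of_nonneg_right h3 hε.le
      _ = 2 * L * |η| := by rw [abs_mul, abs_two]; field_simp
  calc _ ≤ μ * (2 * (2 * δ)) := mul_le_mul_of_nonneg_left h1 hμ0
    _ = 4 * (μ * |η|) + 4 * (μ * ε) := by rw [hδ]; ring
    _ ≤ 4 * (1 * |η|) + 4 * (2 * L * |η|) := by gcongr
    _ = _ := by ring

lemma integral_comp_affine (f : ℝ → ℝ) (x c : ℝ) :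
    ∫ s, f (x + c * s) = |c|⁻¹ * ∫ y, f y := by
  rw [Measure.integral_comp_mul_left (fun z => f (x + z)) c, integral_add_left_eq_self f x,
    smul_eq_mul, abs_inv]

end Difference

lemma abs_prod_sub_prod_le {ι : Type*} (s : Finset ι) {f g : ι → ℝ} (hf0 : ∀ i, 0 ≤ f i)
    (hf1 : ∀ i, f i ≤ 1) (hg0 : ∀ i, 0 ≤ g i) (hg1 : ∀ i, g i ≤ 1) :
    |∏ i ∈ s, f i - ∏ i ∈ s, g i| ≤ ∑ i ∈ s, |f i - g i| := by
  classical
  induction s using Finset.induction_on with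
  | empty => simp
  | insert i s hi ih =>
    rw [Finset.prod_insert hi, Finset.prod_insert hi, Finset.sum_insert hi]
    have e : f i * ∏ j ∈ s, f j - g i * ∏ j ∈ s, g j =
        (f i - g i) * ∏ j ∈ s, f j + g i * (∏ j ∈ s, f j - ∏ j ∈ s, g j) := by ring
    rw [e]
    refine (abs_add_le _ _).trans (add_le_add ?_ ?_)
    · rw [abs_mul]
      refine mul_le_of_le_one_right (abs_nonneg _) ?_
      rw [abs_of_nonneg (Finset.prod_nonneg fun _ _ => hf0 _)]
      exact Finset.prod_le_one (fun _ _ => hf0 _) fun _ _ => hf1 _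
    · rw [abs_mul, abs_of_nonneg (hg0 i)]
      exact (mul_le_of_le_one_left (abs_nonneg _) (hg1 i)).trans ih

/-! ### The phase with one square: the main term -/

lemma integral_fin_two {f : (Fin 2 → ℝ) → ℝ} (hf : Integrable f) :
    (∫ t, f t = ∫ s, ∫ τ, f ![τ, s]) ∧ (Integrable fun s => ∫ τ, f ![τ, s]) ∧
    (∫ t, f t = ∫ τ, ∫ s, f ![τ, s]) ∧ (Integrable fun τ => ∫ s, f ![τ, s]) := by
  have e := (volume_preserving_finTwoArrow ℝ).symm
  have hi : Integrable (fun p : ℝ × ℝ => f ![p.1, p.2]) (volume.prod volume) :=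
    (e.integrable_comp_emb (MeasurableEquiv.measurableEmbedding _) (g := f)).2 hf
  have h0 : ∫ t, f t = ∫ p : ℝ × ℝ, f ![p.1, p.2] ∂(volume.prod volume) := by
    rw [← e.integral_comp']
    rfl
  refine ⟨?_, hi.integral_prod_right, ?_, hi.integral_prod_left⟩
  · rw [h0]; exact integral_prod_symm _ hi
  · rw [h0]; exact integral_prod _ hi

section SquarePhase

variable {n : ℕ} {a : Fin 2 → Fin n → ℝ} {r R N ε x p β : ℝ} {χ : ℝ → ℝ}

/-- The function `cos (p t²) / |t|` on the annulus `1 / N ≤ |t| ≤ q`. -/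
noncomputable def cosSqOn (p N q t : ℝ) : ℝ :=
  Set.indicator (Set.Icc (1 / N) q) (fun s => Real.cos (p * s ^ 2) / s) |t|

/-- The function `1 / t²` on the annulus `1 / N ≤ |t| ≤ q`. -/
noncomputable def invSqOn (N q t : ℝ) : ℝ :=
  Set.indicator (Set.Icc (1 / N) q) (fun s => (s ^ 2)⁻¹) |t|

lemma integrable_indicator_comp_abs {f : ℝ → ℝ} (hf : Measurable f) {l q M : ℝ} (hM0 : 0 ≤ M)
    (hM : ∀ s ∈ Set.Icc l q, |f s| ≤ M) :
    Integrable fun t => Set.indicator (Set.Icc l q) f |t| := by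
  refine integrable_of_Icc (ρ := q) (M := M)
    ((hf.indicator measurableSet_Icc).comp continuous_abs.measurable) (fun t => ?_)
    fun t ht => Set.indicator_of_notMem (fun h => absurd h.2 (not_le.2 ht)) _
  by_cases h : |t| ∈ Set.Icc l q
  · rw [Set.indicator_of_mem h]; exact hM _ h
  · rw [Set.indicator_of_notMem h, abs_zero]; exact hM0

lemma integral_indicator_comp_abs (f : ℝ → ℝ) {l q : ℝ} (hl : 0 < l) (hlq : l ≤ q) :
    ∫ t, Set.indicator (Set.Icc l q) f |t| = 2 * ∫ t in l..q, f t := by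
  rw [integral_comp_abs (f := Set.indicator (Set.Icc l q) f),
    setIntegral_indicator measurableSet_Icc, Set.inter_eq_self_of_subset_right,
    integral_Icc_eq_integral_Ioc, ← intervalIntegral.integral_of_le hlq]
  exact fun t ht => hl.trans_le ht.1

lemma integrable_cosSqOn (hN : 0 < N) (p q : ℝ) : Integrable (cosSqOn p N q) := by
  refine integrable_indicator_comp_abs (by fun_prop) hN.le fun s hs => ?_
  have hs0 : 0 < s := (by positivity : 0 < 1 / N).trans_le hs.1
  rw [abs_div, abs_of_pos hs0, div_le_iff₀ hs0]
  refine (Real.abs_cos_le_one _).trans ?_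
  have := hs.1
  rwa [div_le_iff₀' hN] at this

lemma integrable_invSqOn (hN : 0 < N) (q : ℝ) : Integrable (invSqOn N q) := by
  refine integrable_indicator_comp_abs (by fun_prop) (by positivity : 0 ≤ N ^ 2) fun s hs => ?_
  have hs0 : 0 < s := (by positivity : 0 < 1 / N).trans_le hs.1
  rw [abs_of_nonneg (by positivity)]
  have h1 : (N ^ 2)⁻¹ ≤ s ^ 2 := by
    rw [← inv_pow, ← one_div]
    exact pow_le_pow_left₀ (by positivity) hs.1 2
  rw [← inv_inv (N ^ 2)]
  exact inv_anti₀ (by positivity) h1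

lemma le_integral_cosSqOn (hN : 1 ≤ N) {q : ℝ} (hq : 1 ≤ q) (hp : 0 < p) :
    2 * (Real.log N - (p ^ 2 + 1 / p)) ≤ ∫ t, cosSqOn p N q t := by
  have h1 : 1 / N ≤ 1 := by rw [div_le_one (by linarith)]; exact hN
  have h := le_integral_cos_sq_div (by positivity : 0 < 1 / N) h1 hq hp
  simp only [cosSqOn]
  rw [integral_indicator_comp_abs _ (by positivity) (h1.trans hq)]
  rw [one_div N, Real.log_inv, neg_neg, ← one_div] at h
  linarith

lemma integral_invSqOn_le (hN : 1 ≤ N) {q : ℝ} (hq : 1 ≤ q) :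
    ∫ t, invSqOn N q t ≤ 2 * N := by
  have h1 : 1 / N ≤ 1 := by rw [div_le_one (by linarith)]; exact hN
  have hN0 : 0 < 1 / N := by positivity
  simp only [invSqOn]
  rw [integral_indicator_comp_abs _ hN0 (h1.trans hq)]
  have hu : Set.uIcc (1 / N) q = Set.Icc (1 / N) q := Set.uIcc_of_le (h1.trans hq)
  have e : ∫ t in (1 / N)..q, (t ^ 2)⁻¹ = -q⁻¹ - -(1 / N)⁻¹ := by
    refine intervalIntegral.integral_eq_sub_of_hasDerivAt (f := fun t => -t⁻¹) (fun t ht => ?_) ?_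
    · rw [hu] at ht
      have := (hasDerivAt_inv (hN0.trans_le ht.1).ne').fun_neg
      simpa using this
    · refine ContinuousOn.intervalIntegrable ?_
      rw [hu]
      refine ContinuousOn.inv₀ (by fun_prop) fun t ht => ?_
      have := hN0.trans_le ht.1
      positivity
  rw [e]
  have : 0 ≤ q⁻¹ := by positivity
  simp
  linarith

/-- The integral in the first coordinate. For `1 / N ≤ |s| ≤ rN` it is close to a complete sine
integral divided by `|s|`; elsewhere it is an error term. -/
lemma le_integrand_square (hF : FormBounds a r R) (h : IsSmoothCutoff N ε χ)
    (ha : ∀ j, a 0 j ≠ 0) (hε0 : 0 ≤ ε) (hε : ε ≤ N) (hN : 0 < N)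
    (hx : |x| ≤ r * N) (hβ : β ≠ 0) (s : ℝ) :
    2 * sineLimit * cosSqOn p N (r * N) s - 4 / (|β| * (r * N)) * invSqOn N (r * N) s
      - (6 / (r * N) + |β| * (slopeConst a * ε)) * boxFun (R * N) s
      - |β| * (2 * (R * N)) * boxFun (1 / N) s
      ≤ Real.cos (p * s ^ 2) * (|β| * sliceIntegral a χ x (β * s) ![s]) := by
  have hx' : |x| ≤ N := hx.trans (mul_le_of_le_one_left hN.le hF.r_le_one)
  have hRN : 0 ≤ R * N := mul_nonneg (zero_le_one.trans hF.one_le_R) hN.le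
  have hrN : 0 < r * N := mul_pos hF.r_pos hN
  have hrR : r * N ≤ R * N := mul_le_mul_of_nonneg_right (hF.r_le_one.trans hF.one_le_R) hN.le
  have hκ : 0 ≤ slopeConst a * ε := mul_nonneg slopeConst_nonneg hε0
  have hβ' := abs_pos.2 hβ
  have hcos := Real.abs_cos_le_one (p * s ^ 2)
  have b1 := boxFun_nonneg (R * N) s
  have b2 := boxFun_nonneg (1 / N) s
  have b3 : 0 ≤ invSqOn N (r * N) s := Set.indicator_nonneg (fun _ _ => by positivity) _
  have c1 : 0 ≤ (6 / (r * N) + |β| * (slopeConst a * ε)) * boxFun (R * N) s := by positivity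
  have c2 : 0 ≤ |β| * (2 * (R * N)) * boxFun (1 / N) s := by positivity
  have c3 : 0 ≤ 4 / (|β| * (r * N)) * invSqOn N (r * N) s := by positivity
  have hW : |Real.cos (p * s ^ 2) * (|β| * sliceIntegral a χ x (β * s) ![s])| ≤
      |β| * |sliceIntegral a χ x (β * s) ![s]| := by
    rw [abs_mul, abs_mul, abs_abs]
    exact mul_le_of_le_one_left (by positivity) hcos
  have hout : ¬ |s| ∈ Set.Icc (1 / N) (r * N) → cosSqOn p N (r * N) s = 0 := fun hs =>
    Set.indicator_of_notMem hs _
  by_cases hsR : |s| ≤ R * N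
  swap
  · rw [sliceIntegral_eq_zero hF h hε hx' (t' := ![s]) (by simpa using hsR),
      hout fun hs => hsR (hs.2.trans hrR)]
    simp only [mul_zero]
    linarith
  rw [boxFun_of_le hsR, mul_one] at *
  by_cases hann : |s| ∈ Set.Icc (1 / N) (r * N)
  · have hs0 : 0 < |s| := (by positivity : 0 < 1 / N).trans_le hann.1
    set u := β * s with hu
    have hu0 : 0 < |u| := by rw [hu, abs_mul]; positivity
    obtain ⟨P, Q, hP, hQ, hs⟩ := slice_eq_of_inside hF hN.le hx (t' := ![s]) (by simpa using hann.2)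
    have h1 := abs_sliceIntegral_sub_le hF h ha hε0 hN.le hx' u ![s]
    rw [hs, integral_Icc_eq_integral_Ioc, ← intervalIntegral.integral_of_le (by linarith)] at h1
    set I := ∫ τ in P..Q, Real.sinc (u * τ) with hI
    have h2 : |(|u| * I) - 2 * sineLimit| ≤ 4 / (|u| * (r * N)) := by
      have hb : ∀ z, r * N ≤ z → |sineLimit - sineIntegral (|u| * z)| ≤ 2 / (|u| * (r * N)) := by
        intro z hz
        have hz0 : 0 < z := hrN.trans_le hz
        refine (abs_sineLimit_sub_le (mul_pos hu0 hz0)).trans ?_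
        gcongr
      have b1 := abs_le.1 (hb Q hQ)
      have b2 := abs_le.1 (hb (-P) (by linarith))
      have e : 4 / (|u| * (r * N)) = 2 / (|u| * (r * N)) + 2 / (|u| * (r * N)) := by ring
      rw [hI, integral_sinc_eq, e, abs_le]
      constructor <;> linarith [b1.1, b1.2, b2.1, b2.2]
    have h3 : |(|β| * sliceIntegral a χ x u ![s]) - 2 * sineLimit / (|s|)| ≤
        4 / (|β| * (r * N)) * (s ^ 2)⁻¹ + |β| * (slopeConst a * ε) := by
      have e1 : |β| * sliceIntegral a χ x u ![s] - 2 * sineLimit / |s| =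
          (|u| * I - 2 * sineLimit) / |s| + |β| * (sliceIntegral a χ x u ![s] - I) := by
        rw [hu, abs_mul]; field_simp; ring
      have e2 : 4 / (|β| * (r * N)) * (s ^ 2)⁻¹ = 4 / (|u| * (r * N)) / |s| := by
        rw [hu, abs_mul, ← sq_abs s]; field_simp
      rw [e1, e2]
      refine (abs_add_le _ _).trans (add_le_add ?_ ?_)
      · rw [abs_div, abs_abs]; gcongr
      · rw [abs_mul, abs_abs]; gcongr
    have eC : cosSqOn p N (r * N) s = Real.cos (p * s ^ 2) / |s| := by
      rw [cosSqOn, Set.indicator_of_mem hann, sq_abs]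
    have eZ : invSqOn N (r * N) s = (s ^ 2)⁻¹ := by
      rw [invSqOn, Set.indicator_of_mem hann, sq_abs]
    have h4 : |Real.cos (p * s ^ 2) * (|β| * sliceIntegral a χ x u ![s] - 2 * sineLimit / (|s|))| ≤
        4 / (|β| * (r * N)) * (s ^ 2)⁻¹ + |β| * (slopeConst a * ε) := by
      rw [abs_mul]
      exact (mul_le_of_le_one_left (abs_nonneg _) hcos).trans h3
    have h5 := (abs_le.1 h4).1
    rw [mul_sub] at h5
    have h6 : 0 ≤ 6 / (r * N) := by positivity
    have e3 : Real.cos (p * s ^ 2) * (2 * sineLimit / |s|) =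
        2 * sineLimit * (Real.cos (p * s ^ 2) / |s|) := by ring
    rw [eC, eZ]
    linarith
  · rw [hout hann]
    rw [Set.mem_Icc, not_and_or, not_le, not_le] at hann
    rcases hann with hsN | hsN
    · rw [boxFun_of_le hsN.le, mul_one] at *
      have h1 := abs_sliceIntegral_le hF h hε hN.le hx' (β * s) ![s]
      have h2 := (abs_le.1 (hW.trans (mul_le_mul_of_nonneg_left h1 hβ'.le))).1
      linarith
    · have hs0 : s ≠ 0 := abs_pos.1 (hrN.trans hsN)
      have h1 := abs_sliceIntegral_le_div hF h ha hε0 hN.le hx' (mul_ne_zero hβ hs0) ![s]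
      have h2 := (abs_le.1 (hW.trans (mul_le_mul_of_nonneg_left h1 hβ'.le))).1
      have h3 : |β| * (6 / |β * s|) ≤ 6 / (r * N) := by
        rw [abs_mul]
        have : |β| * (6 / (|β| * |s|)) = 6 / |s| := by field_simp
        rw [this]
        gcongr
      rw [mul_add] at h2
      linarith

/-- The main term for the phase with one square: the logarithm comes from `1 / N ≤ |t 1| ≤ 1`,
where `cos (p * t 1 ^ 2)` is close to `1`. -/
lemma le_integral_square (hF : FormBounds a r R) (h : IsSmoothCutoff N ε χ)
    (ha : ∀ j, a 0 j ≠ 0) (hε0 : 0 ≤ ε) (hεN : ε ≤ 1 / N) (hN : 1 ≤ N) (hrN : 1 ≤ r * N)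
    (hx : |x| ≤ r * N) (hβ : β ≠ 0) (hp : 0 < p) :
    4 * sineLimit * Real.log N - (4 * sineLimit * (p ^ 2 + 1 / p) + 8 / (|β| * r) + 12 * R / r +
      2 * |β| * slopeConst a * R + 4 * |β| * R) ≤
      ∫ t : Fin 2 → ℝ, Real.cos (p * t 1 ^ 2) * (|β| * Real.sinc (β * (t 0 * t 1))) *
        amplitude a χ x t := by
  have hN0 : 0 < N := by linarith
  have hε : ε ≤ N := hεN.trans (((div_le_one hN0).2 hN).trans hN)
  have hx' : |x| ≤ N := hx.trans (mul_le_of_le_one_left hN0.le hF.r_le_one)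
  have hr := hF.r_pos
  have hR : 0 < R := zero_lt_one.trans_le hF.one_le_R
  have hβ' := abs_pos.2 hβ
  have hS := sineLimit_pos
  have hI := integrable_mul_amplitude hF h hε hx'
    (w := fun t => Real.cos (p * t 1 ^ 2) * (|β| * Real.sinc (β * (t 0 * t 1)))) (M := |β|)
    (Continuous.measurable (by have := Real.continuous_sinc; fun_prop))
    (fun t => by
      rw [abs_mul, abs_mul, abs_abs]
      calc _ ≤ 1 * (|β| * 1) := by
            gcongr
            · exact Real.abs_cos_le_one _
            · exact Real.abs_sinc_le_one _
        _ = |β| := by ring)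
  obtain ⟨h1, h2, -, -⟩ := integral_fin_two hI
  have e : ∀ s : ℝ, ∫ τ : ℝ, Real.cos (p * (![τ, s] : Fin 2 → ℝ) 1 ^ 2) *
      (|β| * Real.sinc (β * ((![τ, s] : Fin 2 → ℝ) 0 * (![τ, s] : Fin 2 → ℝ) 1))) *
      amplitude a χ x ![τ, s] =
      Real.cos (p * s ^ 2) * (|β| * sliceIntegral a χ x (β * s) ![s]) := by
    intro s
    rw [sliceIntegral, ← integral_const_mul, ← integral_const_mul]
    congr 1
    funext τ
    simp only [Matrix.cons_val_zero, Matrix.cons_val_one]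
    rw [show β * (τ * s) = β * s * τ by ring, mul_assoc, mul_assoc]
    rfl
  simp_rw [e] at h1 h2
  rw [h1]
  have i1 : Integrable fun s => 2 * sineLimit * cosSqOn p N (r * N) s :=
    (integrable_cosSqOn hN0 _ _).const_mul _
  have i2 : Integrable fun s => 4 / (|β| * (r * N)) * invSqOn N (r * N) s :=
    (integrable_invSqOn hN0 _).const_mul _
  have i3 : Integrable fun s =>
      (6 / (r * N) + |β| * (slopeConst a * ε)) * boxFun (R * N) s :=
    (integrable_boxFun _).const_mul _
  have i4 : Integrable fun s => |β| * (2 * (R * N)) * boxFun (1 / N) s :=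
    (integrable_boxFun _).const_mul _
  have i12 : Integrable fun s => 2 * sineLimit * cosSqOn p N (r * N) s -
      4 / (|β| * (r * N)) * invSqOn N (r * N) s := i1.sub i2
  have i123 : Integrable fun s => 2 * sineLimit * cosSqOn p N (r * N) s -
      4 / (|β| * (r * N)) * invSqOn N (r * N) s -
      (6 / (r * N) + |β| * (slopeConst a * ε)) * boxFun (R * N) s := i12.sub i3
  refine le_trans ?_ (integral_mono (i123.sub i4) h2
    fun s => le_integrand_square hF h ha hε0 hε hN0 hx hβ s)
  simp only [Pi.sub_apply]
  rw [integral_sub i123 i4, integral_sub i12 i3, integral_sub i1 i2, integral_const_mul,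
    integral_const_mul, integral_const_mul, integral_const_mul,
    integral_boxFun (by positivity), integral_boxFun (by positivity)]
  have b1 := mul_le_mul_of_nonneg_left (le_integral_cosSqOn hN hrN hp)
    (by positivity : 0 ≤ 2 * sineLimit)
  have b2 := mul_le_mul_of_nonneg_left (integral_invSqOn_le hN hrN)
    (by positivity : 0 ≤ 4 / (|β| * (r * N)))
  have e2 : 4 / (|β| * (r * N)) * (2 * N) = 8 / (|β| * r) := by field_simp; norm_num
  have e3 : (6 / (r * N) + |β| * (slopeConst a * ε)) * (2 * (R * N)) =
      12 * R / r + 2 * |β| * slopeConst a * R * (ε * N) := by field_simp; ring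
  have e4 : |β| * (2 * (R * N)) * (2 * (1 / N)) = 4 * |β| * R := by field_simp; ring
  have b3 : 2 * |β| * slopeConst a * R * (ε * N) ≤ 2 * |β| * slopeConst a * R := by
    refine mul_le_of_le_one_right ?_ (by rwa [le_div_iff₀ hN0] at hεN)
    have := slopeConst_nonneg (a := a)
    positivity
  rw [e2] at b2
  rw [e3, e4]
  linarith

end SquarePhase

/-! ### The phase with one square: the oscillatory error term -/

/-- The function `cos (c τ) / τ` on `|τ| > q`. -/
noncomputable def cosFar (q c τ : ℝ) : ℝ :=
  Set.indicator {τ : ℝ | q < |τ|} (fun τ => Real.cos (c * τ) / τ) τ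

/-- The function `sin (p s²) / s` on `|s| ≤ q`. -/
noncomputable def sinSqNear (q p s : ℝ) : ℝ :=
  Set.indicator {s : ℝ | |s| ≤ q} (fun s => Real.sin (p * s ^ 2) / s) s

lemma measurableSet_far (q : ℝ) : MeasurableSet {τ : ℝ | q < |τ|} :=
  measurableSet_lt measurable_const continuous_abs.measurable

lemma measurableSet_near (q : ℝ) : MeasurableSet {τ : ℝ | |τ| ≤ q} :=
  measurableSet_le continuous_abs.measurable measurable_const

lemma measurable_cosFar (q c : ℝ) : Measurable (cosFar q c) :=
  Measurable.indicator (by fun_prop) (measurableSet_far q)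

lemma abs_cosFar_le {q : ℝ} (hq : 0 < q) (c τ : ℝ) : |cosFar q c τ| ≤ 1 / q := by
  by_cases h : q < |τ|
  · rw [cosFar, Set.indicator_of_mem (show τ ∈ {τ : ℝ | q < |τ|} from h), abs_div]
    exact div_le_div₀ zero_le_one (Real.abs_cos_le_one _) hq h.le
  · rw [cosFar, Set.indicator_of_notMem (show τ ∉ {τ : ℝ | q < |τ|} from h), abs_zero]
    positivity

lemma cosFar_neg (q c τ : ℝ) : cosFar q c (-τ) = -cosFar q c τ := by
  by_cases h : q < |τ|
  · rw [cosFar, Set.indicator_of_mem (show -τ ∈ {τ : ℝ | q < |τ|} by simpa using h), cosFar,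
      Set.indicator_of_mem (show τ ∈ {τ : ℝ | q < |τ|} from h), mul_neg, Real.cos_neg, div_neg]
  · rw [cosFar, Set.indicator_of_notMem (show -τ ∉ {τ : ℝ | q < |τ|} by simpa using h), cosFar,
      Set.indicator_of_notMem (show τ ∉ {τ : ℝ | q < |τ|} from h), neg_zero]

lemma intervalIntegrable_cosFar {q : ℝ} (hq : 0 < q) (c P Q : ℝ) :
    IntervalIntegrable (cosFar q c) volume P Q := by
  rw [intervalIntegrable_iff]
  exact Measure.integrableOn_of_bounded (M := 1 / q)
    ((measure_mono Set.uIoc_subset_uIcc).trans_lt isCompact_uIcc.measure_lt_top).ne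
    (measurable_cosFar q c).aestronglyMeasurable
    (Filter.Eventually.of_forall fun τ => abs_cosFar_le hq c τ)

lemma abs_integral_cosFar_le_of_le {q c P Q : ℝ} (hq : 0 < q) (hc : c ≠ 0) (hP : q ≤ P)
    (hPQ : P ≤ Q) : |∫ τ in P..Q, cosFar q c τ| ≤ 2 / (|c| * q) := by
  have hc' := abs_pos.2 hc
  have e : ∫ τ in P..Q, cosFar q c τ = ∫ τ in P..Q, Real.cos (c * τ) / τ := by
    rw [intervalIntegral.integral_of_le hPQ, intervalIntegral.integral_of_le hPQ]
    refine setIntegral_congr_fun measurableSet_Ioc fun τ hτ => ?_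
    have hτ' : τ ∈ {τ : ℝ | q < |τ|} := (hP.trans_lt hτ.1).trans_le (le_abs_self τ)
    simp only [cosFar]
    rw [Set.indicator_of_mem hτ']
  rw [e]
  refine (abs_integral_cos_mul_div_le (hq.trans_le hP) hPQ hc).trans ?_
  gcongr

/-- The integrals over two intervals containing `[-q, q]` differ little, and on a symmetric
interval the integral vanishes because the integrand is odd. -/
lemma abs_integral_cosFar_le {q c P Q : ℝ} (hq : 0 < q) (hc : c ≠ 0) (hP : P ≤ -q)
    (hQ : q ≤ Q) : |∫ τ in P..Q, cosFar q c τ| ≤ 2 / (|c| * q) := by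
  have hodd : ∫ τ in P..(-P), cosFar q c τ = 0 := by
    have h := intervalIntegral.integral_comp_neg (a := P) (b := -P) (cosFar q c)
    simp_rw [cosFar_neg] at h
    rw [intervalIntegral.integral_neg, neg_neg] at h
    linarith
  rw [← intervalIntegral.integral_add_adjacent_intervals (intervalIntegrable_cosFar hq c P (-P))
    (intervalIntegrable_cosFar hq c (-P) Q), hodd, zero_add]
  rcases le_total (-P) Q with h | h
  · exact abs_integral_cosFar_le_of_le hq hc (by linarith) h
  · rw [intervalIntegral.integral_symm, abs_neg]
    exact abs_integral_cosFar_le_of_le hq hc hQ h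

lemma abs_sin_sq_div_le {p : ℝ} (hp : 0 < p) (s : ℝ) : |Real.sin (p * s ^ 2) / s| ≤ p * |s| := by
  rcases eq_or_ne s 0 with rfl | hs
  · simp
  · rw [abs_div, div_le_iff₀ (abs_pos.2 hs), mul_assoc, abs_mul_abs_self]
    refine (Real.abs_sin_le_abs).trans (le_of_eq ?_)
    rw [abs_of_nonneg (by positivity)]
    ring

lemma measurable_sinSqNear (q p : ℝ) : Measurable (sinSqNear q p) :=
  Measurable.indicator (by fun_prop) (measurableSet_near q)

section NearPart

variable {n : ℕ} {a : Fin 2 → Fin n → ℝ} {r R N ε x p β : ℝ} {χ : ℝ → ℝ}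

/-- The part of the error term where the second coordinate is small and the first one large. The
oscillation in the first coordinate gains a factor `1 / |β * t 1|`, whose singularity is compensated
by `|sin (p * t 1 ^ 2) / t 1| ≤ p * |t 1|`. -/
lemma abs_integral_near_le (hF : FormBounds a r R) (h : IsSmoothCutoff N ε χ)
    (ha : ∀ j, a 0 j ≠ 0) (hε0 : 0 ≤ ε) (hεN : ε ≤ 1 / N) (hN : 1 ≤ N)
    (hx : |x| ≤ r * N) (hβ : β ≠ 0) (hp : 0 < p) :
    (Integrable fun t : Fin 2 → ℝ =>
      sinSqNear (r * N) p (t 1) * cosFar (r * N) (β * t 1) (t 0) * amplitude a χ x t) ∧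
    |∫ t : Fin 2 → ℝ,
      sinSqNear (r * N) p (t 1) * cosFar (r * N) (β * t 1) (t 0) * amplitude a χ x t| ≤
      8 * p / |β| + 2 * p * r * slopeConst a := by
  have hN0 : 0 < N := by linarith
  have hε : ε ≤ N := hεN.trans (((div_le_one hN0).2 hN).trans hN)
  have hx' : |x| ≤ N := hx.trans (mul_le_of_le_one_left hN0.le hF.r_le_one)
  have hr := hF.r_pos
  have hrN : 0 < r * N := by positivity
  have hβ' := abs_pos.2 hβ
  have hκ := slopeConst_nonneg (a := a)
  have hsin : ∀ s, |sinSqNear (r * N) p s| ≤ p * (r * N) := by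
    intro s
    by_cases hs : |s| ≤ r * N
    · rw [sinSqNear, Set.indicator_of_mem (show s ∈ {s : ℝ | |s| ≤ r * N} from hs)]
      exact (abs_sin_sq_div_le hp s).trans (by gcongr)
    · rw [sinSqNear, Set.indicator_of_notMem (show s ∉ {s : ℝ | |s| ≤ r * N} from hs), abs_zero]
      positivity
  have hmeas : Measurable fun t : Fin 2 → ℝ =>
      sinSqNear (r * N) p (t 1) * cosFar (r * N) (β * t 1) (t 0) := by
    refine ((measurable_sinSqNear _ _).comp (measurable_pi_apply 1)).mul ?_
    have e : (fun t : Fin 2 → ℝ => cosFar (r * N) (β * t 1) (t 0)) =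
        Set.indicator ((fun t : Fin 2 → ℝ => t 0) ⁻¹' {τ : ℝ | r * N < |τ|})
          (fun t => Real.cos (β * t 1 * t 0) / t 0) := rfl
    rw [e]
    exact Measurable.indicator (by fun_prop) ((measurable_pi_apply 0) (measurableSet_far _))
  have hI := integrable_mul_amplitude hF h hε hx'
    (w := fun t => sinSqNear (r * N) p (t 1) * cosFar (r * N) (β * t 1) (t 0))
    (M := p * (r * N) * (1 / (r * N))) hmeas (fun t => by
      rw [abs_mul]
      exact mul_le_mul (hsin _) (abs_cosFar_le hrN _ _) (abs_nonneg _) (by positivity))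
  refine ⟨hI, ?_⟩
  obtain ⟨h1, -, -, -⟩ := integral_fin_two hI
  rw [h1]
  have hbd : Integrable fun s =>
      (4 * p / (|β| * (r * N)) + p * slopeConst a * ε) * boxFun (r * N) s :=
    (integrable_boxFun _).const_mul _
  rw [← Real.norm_eq_abs]
  refine (norm_integral_le_of_norm_le hbd (Filter.Eventually.of_forall fun s => ?_)).trans ?_
  · have e : ∫ τ : ℝ, sinSqNear (r * N) p ((![τ, s] : Fin 2 → ℝ) 1) *
        cosFar (r * N) (β * (![τ, s] : Fin 2 → ℝ) 1) ((![τ, s] : Fin 2 → ℝ) 0) *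
        amplitude a χ x ![τ, s] = sinSqNear (r * N) p s *
        ∫ τ : ℝ, cosFar (r * N) (β * s) τ * amplitude a χ x (Fin.cons τ ![s]) := by
      rw [← integral_const_mul]
      congr 1
      funext τ
      simp only [Matrix.cons_val_zero, Matrix.cons_val_one]
      rw [mul_assoc]
      rfl
    rw [e, Real.norm_eq_abs, abs_mul]
    by_cases hs : |s| ≤ r * N
    swap
    · rw [sinSqNear, Set.indicator_of_notMem (show s ∉ {s : ℝ | |s| ≤ r * N} from hs), abs_zero,
        zero_mul]
      have := boxFun_nonneg (r * N) s
      positivity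
    rw [boxFun_of_le hs, mul_one]
    rcases eq_or_ne s 0 with rfl | hs0
    · have : sinSqNear (r * N) p 0 = 0 := by
        rw [sinSqNear, Set.indicator_of_mem (show (0 : ℝ) ∈ {s : ℝ | |s| ≤ r * N} from hs), div_zero]
      rw [this, abs_zero, zero_mul]
      positivity
    have hs' := abs_pos.2 hs0
    have hsin' : |sinSqNear (r * N) p s| ≤ p * |s| := by
      rw [sinSqNear, Set.indicator_of_mem (show s ∈ {s : ℝ | |s| ≤ r * N} from hs)]
      exact abs_sin_sq_div_le hp s
    have h2 := abs_integral_mul_amplitude_sub_le hF h ha hε0 hN0.le hx' ![s]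
      (measurable_cosFar (r * N) (β * s)) (fun τ => abs_cosFar_le hrN (β * s) τ)
    obtain ⟨P, Q, hP, hQ, hsl⟩ := slice_eq_of_inside hF hN0.le hx (t' := ![s]) (by simpa using hs)
    rw [hsl, integral_Icc_eq_integral_Ioc, ← intervalIntegral.integral_of_le (by linarith)] at h2
    have h3 := abs_integral_cosFar_le hrN (mul_ne_zero hβ hs0) hP hQ
    set K := ∫ τ : ℝ, cosFar (r * N) (β * s) τ * amplitude a χ x (Fin.cons τ ![s])
    have h4 : |K| ≤ 2 / (|β * s| * (r * N)) + 1 / (r * N) * slopeConst a * ε := by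
      have := abs_add_le (K - ∫ τ in P..Q, cosFar (r * N) (β * s) τ)
        (∫ τ in P..Q, cosFar (r * N) (β * s) τ)
      rw [sub_add_cancel] at this
      linarith
    calc |sinSqNear (r * N) p s| * |K|
        ≤ |sinSqNear (r * N) p s| * (2 / (|β * s| * (r * N)) + 1 / (r * N) * slopeConst a * ε) := by
          gcongr
      _ = |sinSqNear (r * N) p s| * (2 / (|β * s| * (r * N))) +
          |sinSqNear (r * N) p s| * (1 / (r * N) * slopeConst a * ε) := mul_add _ _ _
      _ ≤ p * |s| * (2 / (|β * s| * (r * N))) + p * (r * N) * (1 / (r * N) * slopeConst a * ε) := by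
          gcongr
          exact hsin s
      _ = 2 * p / (|β| * (r * N)) + p * slopeConst a * ε := by
          rw [abs_mul]; field_simp
      _ ≤ 4 * p / (|β| * (r * N)) + p * slopeConst a * ε := by gcongr; norm_num
  · rw [integral_const_mul, integral_boxFun hrN.le]
    have e1 : (4 * p / (|β| * (r * N)) + p * slopeConst a * ε) * (2 * (r * N)) =
        8 * p / |β| + 2 * p * r * slopeConst a * (ε * N) := by field_simp; ring
    rw [le_div_iff₀ hN0] at hεN
    have hs := slopeConst_nonneg (a := a)
    have hb : 2 * p * r * slopeConst a * (ε * N) ≤ 2 * p * r * slopeConst a :=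
      mul_le_of_le_one_right (by positivity) hεN
    rw [e1]
    linarith

end NearPart

section FarPart

variable {n : ℕ} {a : Fin 2 → Fin n → ℝ} {r R N ε x p β L : ℝ} {χ : ℝ → ℝ}

/-- The symmetric difference of a cutoff along one form, divided by the first coordinate. -/
noncomputable def differenceQuotient (χ : ℝ → ℝ) (x ρ a₀ a₁ : ℝ) (t : Fin 2 → ℝ) : ℝ :=
  boxFun ρ (t 0) * boxFun ρ (t 1) *
    (|t 0|⁻¹ * |χ (x + a₁ * t 1 + a₀ * t 0) - χ (x + a₁ * t 1 - a₀ * t 0)|)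

lemma differenceQuotient_nonneg (χ : ℝ → ℝ) (x ρ a₀ a₁ : ℝ) (t : Fin 2 → ℝ) :
    0 ≤ differenceQuotient χ x ρ a₀ a₁ t := by
  have h0 := boxFun_nonneg ρ (t 0)
  have h1 := boxFun_nonneg ρ (t 1)
  unfold differenceQuotient
  positivity

lemma boxFun_le_one (ρ t : ℝ) : boxFun ρ t ≤ 1 :=
  Set.indicator_le' (fun _ _ => le_rfl) (fun _ _ => zero_le_one) t

lemma boxFun_eq_zero {ρ t : ℝ} (h : ρ < |t|) : boxFun ρ t = 0 :=
  Set.indicator_of_notMem (show t ∉ Set.Icc (-ρ) ρ from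
    fun hm => absurd (abs_le.2 hm) (not_le.2 h)) _

lemma measurable_boxFun (ρ : ℝ) : Measurable (boxFun ρ) :=
  measurable_const.indicator measurableSet_Icc

/-- Integrating in the second coordinate first, the `L¹` bound for the differences of the cutoff
compensates the singularity in the first one. -/
lemma integral_differenceQuotient_le (h : IsSmoothCutoff N ε χ) (hε : 0 < ε) (hL0 : 0 ≤ L)
    (hL : ∀ y z, |χ y - χ z| ≤ L / ε * |y - z|) (a₀ : ℝ) {a₁ : ℝ} (h₁ : a₁ ≠ 0) {ρ : ℝ}
    (hρ : 0 ≤ ρ) :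
    Integrable (differenceQuotient χ x ρ a₀ a₁) ∧
    ∫ t, differenceQuotient χ x ρ a₀ a₁ t ≤ (4 + 8 * L) * |a₀| / |a₁| * (2 * ρ) := by
  have hc := h.contDiff.continuous.measurable
  have hm := measurable_boxFun ρ
  have h₁' := abs_pos.2 h₁
  have hI : Integrable (differenceQuotient χ x ρ a₀ a₁) := by
    refine integrable_of_cube (ρ := ρ) (M := L / ε * (2 * |a₀|)) ?_ (fun t => ?_) fun t ht => ?_
    · refine Measurable.aestronglyMeasurable ?_
      unfold differenceQuotient
      fun_prop
    · rw [abs_of_nonneg (differenceQuotient_nonneg _ _ _ _ _ _), differenceQuotient]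
      have hb : boxFun ρ (t 0) * boxFun ρ (t 1) ≤ 1 :=
        mul_le_one₀ (boxFun_le_one _ _) (boxFun_nonneg _ _) (boxFun_le_one _ _)
      refine (mul_le_of_le_one_left (by positivity) hb).trans ?_
      rcases eq_or_ne (t 0) 0 with h0 | h0
      · rw [h0, abs_zero, inv_zero, zero_mul]; positivity
      · rw [inv_mul_le_iff₀ (abs_pos.2 h0)]
        refine (hL _ _).trans (le_of_eq ?_)
        rw [show x + a₁ * t 1 + a₀ * t 0 - (x + a₁ * t 1 - a₀ * t 0) = 2 * a₀ * t 0 by ring,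
          abs_mul, abs_mul, abs_two]
        ring
    · rw [mem_cube] at ht
      push Not at ht
      obtain ⟨i, hi⟩ := ht
      rw [differenceQuotient]
      fin_cases i
      · rw [boxFun_eq_zero (t := t 0) hi, zero_mul, zero_mul]
      · rw [boxFun_eq_zero (t := t 1) hi, mul_zero, zero_mul]
  refine ⟨hI, ?_⟩
  obtain ⟨-, -, h2, h3⟩ := integral_fin_two hI
  rw [h2]
  have hbd : Integrable fun τ => (4 + 8 * L) * |a₀| / |a₁| * boxFun ρ τ :=
    (integrable_boxFun _).const_mul _
  refine (integral_mono h3 hbd fun τ => ?_).trans ?_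
  · simp only
    obtain ⟨hd1, hd2⟩ := integral_abs_cutoff_sub_le h hε hL0 hL (a₀ * τ)
    have e : ∀ s, differenceQuotient χ x ρ a₀ a₁ ![τ, s] = boxFun ρ τ * |τ|⁻¹ *
        (boxFun ρ s * |χ (x + a₁ * s + a₀ * τ) - χ (x + a₁ * s - a₀ * τ)|) := by
      intro s
      simp only [differenceQuotient, Matrix.cons_val_zero, Matrix.cons_val_one]
      ring
    simp_rw [e]
    rw [integral_const_mul]
    have h4 : ∫ s, boxFun ρ s * |χ (x + a₁ * s + a₀ * τ) - χ (x + a₁ * s - a₀ * τ)| ≤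
        |a₁|⁻¹ * ((4 + 8 * L) * |a₀ * τ|) := by
      have hi : Integrable fun s => |χ (x + a₁ * s + a₀ * τ) - χ (x + a₁ * s - a₀ * τ)| :=
        (hd1.comp_add_left x).comp_mul_left' h₁
      calc ∫ s, boxFun ρ s * |χ (x + a₁ * s + a₀ * τ) - χ (x + a₁ * s - a₀ * τ)|
          ≤ ∫ s, |χ (x + a₁ * s + a₀ * τ) - χ (x + a₁ * s - a₀ * τ)| := by
            refine integral_mono_of_nonneg (Filter.Eventually.of_forall fun s =>
              mul_nonneg (boxFun_nonneg _ _) (abs_nonneg _)) hi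
              (Filter.Eventually.of_forall fun s =>
                mul_le_of_le_one_left (abs_nonneg _) (boxFun_le_one _ _))
        _ = |a₁|⁻¹ * ∫ y, |χ (y + a₀ * τ) - χ (y - a₀ * τ)| :=
            integral_comp_affine (fun y => |χ (y + a₀ * τ) - χ (y - a₀ * τ)|) x a₁
        _ ≤ _ := by gcongr
    have hb := boxFun_nonneg ρ τ
    calc _ ≤ boxFun ρ τ * |τ|⁻¹ * (|a₁|⁻¹ * ((4 + 8 * L) * |a₀ * τ|)) := by gcongr
      _ = (4 + 8 * L) * |a₀| / |a₁| * boxFun ρ τ * (|τ|⁻¹ * |τ|) := by rw [abs_mul]; ring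
      _ ≤ (4 + 8 * L) * |a₀| / |a₁| * boxFun ρ τ * 1 := by
          gcongr
          exact inv_mul_le_one
      _ = _ := mul_one _
  · rw [integral_const_mul, integral_boxFun hρ]

lemma sum_fin_two_bool (f : (Fin 2 → Bool) → ℝ) :
    ∑ s, f s = f ![true, true] + f ![true, false] + (f ![false, true] + f ![false, false]) := by
  rw [← (finTwoArrowEquiv Bool).symm.sum_comp, Fintype.sum_prod_type]
  simp [finTwoArrowEquiv]

lemma abs_amplitude_sub_le (h : IsSmoothCutoff N ε χ) (b : Bool) (t : Fin 2 → ℝ) :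
    |amplitude (signFlip ![true, b] a) χ x t - amplitude (signFlip ![false, b] a) χ x t| ≤
      ∑ j, |χ (x + boolSign b * a 1 j * t 1 + a 0 j * t 0) -
        χ (x + boolSign b * a 1 j * t 1 - a 0 j * t 0)| := by
  refine (abs_prod_sub_prod_le _ (fun _ => h.nonneg _) (fun _ => h.le_one _) (fun _ => h.nonneg _)
    fun _ => h.le_one _).trans (le_of_eq ?_)
  refine Finset.sum_congr rfl fun j _ => ?_
  congr 3 <;>
  · simp [affineForm, signFlip, Fin.sum_univ_two, boolSign]
    ring

/-- The alternating sum of the reflected amplitudes with the oscillating weight. -/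
noncomputable def oscillatingPart (a : Fin 2 → Fin n → ℝ) (χ : ℝ → ℝ) (x p β : ℝ)
    (t : Fin 2 → ℝ) : ℝ :=
  ∑ s : Fin 2 → Bool, (∏ i, boolSign (s i)) *
    (Real.sin (p * t 1 ^ 2) / t 1 * (Real.cos (β * t 1 * t 0) / t 0) *
      amplitude (signFlip s a) χ x t)

/-- Where the second coordinate is large, pairing the reflections of the first coordinate turns its
singularity into difference quotients of the cutoff. -/
lemma abs_oscillatingPart_le (hF : FormBounds a r R) (h : IsSmoothCutoff N ε χ) (hε : ε ≤ N)
    (hx : |x| ≤ N) {q : ℝ} (hq : 0 < q) {t : Fin 2 → ℝ} (ht : q ≤ |t 1|) :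
    |oscillatingPart a χ x p β t| ≤ 1 / q * ∑ b : Bool, ∑ j,
      differenceQuotient χ x (R * N) (a 0 j) (boolSign b * a 1 j) t := by
  have hnn : 0 ≤ 1 / q * ∑ b : Bool, ∑ j,
      differenceQuotient χ x (R * N) (a 0 j) (boolSign b * a 1 j) t :=
    mul_nonneg (by positivity) (Finset.sum_nonneg fun b _ => Finset.sum_nonneg fun j _ =>
      differenceQuotient_nonneg _ _ _ _ _ _)
  by_cases hmem : t ∈ cube 2 (R * N)
  swap
  · have : oscillatingPart a χ x p β t = 0 := by
      refine Finset.sum_eq_zero fun s _ => ?_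
      rw [amplitude_eq_zero_of_notMem (hF.signFlip s) h hε hx hmem, mul_zero, mul_zero]
    rw [this, abs_zero]
    exact hnn
  rw [mem_cube] at hmem
  set w := Real.sin (p * t 1 ^ 2) / t 1 * (Real.cos (β * t 1 * t 0) / t 0) with hw
  have hw1 : |w| ≤ 1 / q * |t 0|⁻¹ := by
    rw [hw, abs_mul, abs_div, abs_div]
    refine mul_le_mul ?_ ?_ (by positivity) (by positivity)
    · exact div_le_div₀ zero_le_one (Real.abs_sin_le_one _) hq ht
    · rw [← one_div]
      gcongr
      exact Real.abs_cos_le_one _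
  have e : oscillatingPart a χ x p β t = w * ∑ b : Bool, boolSign b *
      (amplitude (signFlip ![true, b] a) χ x t - amplitude (signFlip ![false, b] a) χ x t) := by
    rw [oscillatingPart, sum_fin_two_bool]
    simp [Fin.prod_univ_two, boolSign]
    ring
  rw [e, abs_mul]
  have h2 : ∀ b, |boolSign b * (amplitude (signFlip ![true, b] a) χ x t -
      amplitude (signFlip ![false, b] a) χ x t)| ≤ ∑ j, |χ (x + boolSign b * a 1 j * t 1 +
        a 0 j * t 0) - χ (x + boolSign b * a 1 j * t 1 - a 0 j * t 0)| := by
    intro b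
    rw [abs_mul, abs_boolSign, one_mul]
    exact abs_amplitude_sub_le h b t
  calc |w| * |∑ b : Bool, boolSign b * (amplitude (signFlip ![true, b] a) χ x t -
        amplitude (signFlip ![false, b] a) χ x t)|
      ≤ 1 / q * |t 0|⁻¹ * ∑ b : Bool, ∑ j, |χ (x + boolSign b * a 1 j * t 1 +
        a 0 j * t 0) - χ (x + boolSign b * a 1 j * t 1 - a 0 j * t 0)| :=
        mul_le_mul hw1 ((Finset.abs_sum_le_sum_abs _ _).trans
          (Finset.sum_le_sum fun b _ => h2 b)) (abs_nonneg _) (by positivity)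
    _ = _ := by
        rw [mul_assoc, Finset.mul_sum]
        congr 1
        refine Finset.sum_congr rfl fun b _ => ?_
        rw [Finset.mul_sum]
        refine Finset.sum_congr rfl fun j _ => ?_
        rw [differenceQuotient, boxFun_of_le (hmem 0), boxFun_of_le (hmem 1)]
        ring

lemma measurable_oscillatingPart (h : IsSmoothCutoff N ε χ) :
    Measurable (oscillatingPart a χ x p β) := by
  have : ∀ s : Fin 2 → Bool, Measurable (amplitude (signFlip s a) χ x) :=
    fun s => (continuous_amplitude h).measurable
  unfold oscillatingPart
  fun_prop

/-- Where the second coordinate is small, the alternating sum vanishes unless the first coordinate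
is large. -/
lemma oscillatingPart_of_le (hF : FormBounds a r R) (h : IsSmoothCutoff N ε χ)
    (hx : |x| ≤ r * N) {t : Fin 2 → ℝ} (ht : |t 1| ≤ r * N) :
    oscillatingPart a χ x p β t = ∑ s : Fin 2 → Bool, (∏ i, boolSign (s i)) *
      (sinSqNear (r * N) p (t 1) * cosFar (r * N) (β * t 1) (t 0) *
        amplitude (signFlip s a) χ x t) := by
  rw [sinSqNear, Set.indicator_of_mem (show t 1 ∈ {s : ℝ | |s| ≤ r * N} from ht), cosFar]
  by_cases h0 : r * N < |t 0|
  · rw [Set.indicator_of_mem (show t 0 ∈ {τ : ℝ | r * N < |τ|} from h0)]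
    rfl
  · rw [Set.indicator_of_notMem (show t 0 ∉ {τ : ℝ | r * N < |τ|} from h0)]
    have h1 : ∀ s : Fin 2 → Bool, amplitude (signFlip s a) χ x t = 1 := fun s =>
      amplitude_eq_one h ((hF.signFlip s).inside hx fun i => by
        fin_cases i
        · exact not_lt.1 h0
        · exact ht)
    rw [oscillatingPart, sum_fin_two_bool]
    simp_rw [h1]
    simp [Fin.prod_univ_two, boolSign]

/-- The oscillating part is integrable, and its integral is bounded independently of `N`. -/
lemma abs_integral_oscillatingPart_le (hF : FormBounds a r R) (h : IsSmoothCutoff N ε χ)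
    (ha : ∀ i j, a i j ≠ 0) (hε0 : 0 < ε) (hεN : ε ≤ 1 / N) (hN : 1 ≤ N)
    (hx : |x| ≤ r * N) (hβ : β ≠ 0) (hp : 0 < p) (hL0 : 0 ≤ L)
    (hL : ∀ y z, |χ y - χ z| ≤ L / ε * |y - z|) :
    Integrable (oscillatingPart a χ x p β) ∧
    |∫ t, oscillatingPart a χ x p β t| ≤ 4 * (8 * p / |β| + 2 * p * r * slopeConst a) +
      4 * R / r * ∑ j, (4 + 8 * L) * |a 0 j| / |a 1 j| := by
  have hN0 : 0 < N := by linarith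
  have hε : ε ≤ N := hεN.trans (((div_le_one hN0).2 hN).trans hN)
  have hx' : |x| ≤ N := hx.trans (mul_le_of_le_one_left hN0.le hF.r_le_one)
  have hr := hF.r_pos
  have hrN : 0 < r * N := by positivity
  have hRN : 0 ≤ R * N := mul_nonneg (zero_le_one.trans hF.one_le_R) hN0.le
  have hsgn : ∀ b, boolSign b ≠ 0 := fun b => abs_pos.1 (by rw [abs_boolSign]; exact one_pos)
  have hnear := fun s : Fin 2 → Bool => abs_integral_near_le (β := β) (p := p) (hF.signFlip s) h
    (fun j => mul_ne_zero (hsgn _) (ha 0 j)) hε0.le hεN hN hx hβ hp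
  have hdq := fun (b : Bool) j => integral_differenceQuotient_le (x := x) h hε0 hL0 hL (a 0 j)
    (mul_ne_zero (hsgn b) (ha 1 j)) hRN
  set near : (Fin 2 → ℝ) → ℝ := fun t => ∑ s : Fin 2 → Bool, (∏ i, boolSign (s i)) *
      (sinSqNear (r * N) p (t 1) * cosFar (r * N) (β * t 1) (t 0) *
        amplitude (signFlip s a) χ x t) with hneardef
  set far : (Fin 2 → ℝ) → ℝ :=
    Set.indicator {t | r * N < |t 1|} (oscillatingPart a χ x p β) with hfardef
  have hset : MeasurableSet {t : Fin 2 → ℝ | r * N < |t 1|} :=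
    measurableSet_lt measurable_const (by fun_prop)
  have hsplit : ∀ t, oscillatingPart a χ x p β t = near t + far t := by
    intro t
    by_cases ht : r * N < |t 1|
    · have h0 : near t = 0 := by
        refine Finset.sum_eq_zero fun s _ => ?_
        rw [sinSqNear, Set.indicator_of_notMem (show t 1 ∉ {s : ℝ | |s| ≤ r * N} from
          not_le.2 ht)]
        simp
      rw [h0, zero_add, hfardef, Set.indicator_of_mem (show t ∈ {t | r * N < |t 1|} from ht)]
    · rw [hfardef, Set.indicator_of_notMem (show t ∉ {t | r * N < |t 1|} from ht), add_zero]
      exact oscillatingPart_of_le hF h hx (not_lt.1 ht)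
  have hbdI : Integrable fun t => 1 / (r * N) * ∑ b : Bool, ∑ j,
      differenceQuotient χ x (R * N) (a 0 j) (boolSign b * a 1 j) t :=
    (integrable_finsetSum _ fun b _ => integrable_finsetSum _ fun j _ => (hdq b j).1).const_mul _
  have hfar : ∀ t, ‖far t‖ ≤ 1 / (r * N) * ∑ b : Bool, ∑ j,
      differenceQuotient χ x (R * N) (a 0 j) (boolSign b * a 1 j) t := by
    intro t
    rw [hfardef]
    by_cases ht : r * N < |t 1|
    · rw [Set.indicator_of_mem (show t ∈ {t | r * N < |t 1|} from ht)]
      exact abs_oscillatingPart_le hF h hε hx' hrN ht.le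
    · rw [Set.indicator_of_notMem (show t ∉ {t | r * N < |t 1|} from ht), norm_zero]
      exact mul_nonneg (by positivity) (Finset.sum_nonneg fun b _ => Finset.sum_nonneg fun j _ =>
        differenceQuotient_nonneg _ _ _ _ _ _)
  have hfarI : Integrable far := hbdI.mono'
    ((measurable_oscillatingPart h).indicator hset).aestronglyMeasurable
    (Filter.Eventually.of_forall hfar)
  have hnearI : Integrable near := integrable_finsetSum _ fun s _ => (hnear s).1.const_mul _
  have hsum : Integrable (oscillatingPart a χ x p β) :=
    (hnearI.add hfarI).congr (Filter.Eventually.of_forall fun t => (hsplit t).symm)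
  refine ⟨hsum, ?_⟩
  simp_rw [hsplit]
  rw [integral_add hnearI hfarI]
  refine (abs_add_le _ _).trans (add_le_add ?_ ?_)
  · rw [hneardef, integral_finsetSum _ fun s _ => (hnear s).1.const_mul _]
    refine (Finset.abs_sum_le_sum_abs _ _).trans ?_
    calc _ ≤ ∑ _s : Fin 2 → Bool, (8 * p / |β| + 2 * p * r * slopeConst a) := by
          refine Finset.sum_le_sum fun s _ => ?_
          rw [integral_const_mul, abs_mul, Finset.abs_prod]
          simp_rw [abs_boolSign]
          rw [Finset.prod_const_one, one_mul, ← slopeConst_signFlip s]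
          exact (hnear s).2
      _ = _ := by simp; ring
  · refine (norm_integral_le_of_norm_le hbdI (Filter.Eventually.of_forall hfar)).trans ?_
    rw [integral_const_mul, integral_finsetSum _ fun b _ =>
      integrable_finsetSum _ fun j _ => (hdq b j).1]
    simp_rw [fun b : Bool => integral_finsetSum Finset.univ fun j _ => (hdq b j).1]
    calc _ ≤ 1 / (r * N) * ∑ _b : Bool, ∑ j, (4 + 8 * L) * |a 0 j| / |a 1 j| * (2 * (R * N)) := by
          gcongr with b _ j _
          refine (hdq b j).2.trans (le_of_eq ?_)
          rw [abs_mul, abs_boolSign, one_mul]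
      _ = _ := by
          rw [← Finset.sum_mul]
          simp
          field_simp
          ring

end FarPart

/-! ### The lower bound for phases with one square -/

lemma KillsMixedAndOneSquare.eq_zero {m : ℕ} {α : Fin 2 → Fin m → ℝ} {θ : Fin (m + 1) → ℝ}
    (h : KillsMixedAndOneSquare α θ) (v : Fin 2 → ℝ)
    (hv : ∀ j, ∑ i, coeffMatrix α i j * v i = 0) : v = 0 := by
  obtain ⟨A, p, β, hp, hβ, hA⟩ := h
  -- The phase is invariant under translation by `v`; compare its values at `0`, `e₀` and `e₁`.
  have key : ∀ t : Fin 2 → ℝ, p * (t + v) 1 ^ 2 + β * ((t + v) 0 * (t + v) 1) =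
      p * t 1 ^ 2 + β * (t 0 * t 1) := by
    intro t
    have h1 := hA 0 t
    have h2 := hA 0 (t + v)
    have e : phasePolynomial α θ 0 (t + v) = phasePolynomial α θ 0 t := by
      rw [phasePolynomial_eq, phasePolynomial_eq]
      refine Finset.sum_congr rfl fun j _ => ?_
      congr 2
      simp only [affineForm, Pi.add_apply, mul_add, Finset.sum_add_distrib, hv j, add_zero]
    linarith
  have k0 := key 0
  have k1 := key ![1, 0]
  have k2 := key ![0, 1]
  simp only [Pi.add_apply, Pi.zero_apply, Matrix.cons_val_zero, Matrix.cons_val_one] at k0 k1 k2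
  have hv1 : v 1 = 0 := by
    have : β * v 1 = 0 := by linarith
    exact (mul_eq_zero.1 this).resolve_left hβ
  have hv0 : v 0 = 0 := by
    rw [hv1] at k2
    have : β * v 0 = 0 := by linarith
    exact (mul_eq_zero.1 this).resolve_left hβ
  ext i
  fin_cases i
  · exact hv0
  · exact hv1

/-- With the square in the phase, the imaginary part of the kernel splits into a main term, the
same for all reflections up to the amplitude, and a term which alternates with the reflection. -/
lemma im_oddKernel_chirp_of_square {m : ℕ} {α : Fin 2 → Fin m → ℝ} {θ : Fin (m + 1) → ℝ}
    {A p β u : ℝ} (hA : ∀ x t, phasePolynomial α θ x t = A * x ^ 2 + p * t 1 ^ 2 + β * (t 0 * t 1))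
    (hβ : β ≠ 0) (hu : u * β = |β|) (χ : ℝ → ℝ) (x : ℝ) {t : Fin 2 → ℝ} (ht : ∀ i, t i ≠ 0) :
    ((u : ℂ) * Complex.exp (((-(A * x ^ 2) : ℝ) : ℂ) * Complex.I) *
      oddKernel (coeffMatrix α) (chirp 2 θ χ) x t).im =
      ∑ s : Fin 2 → Bool, Real.cos (p * t 1 ^ 2) * (|β| * Real.sinc (β * (t 0 * t 1))) *
        amplitude (signFlip s (coeffMatrix α)) χ x t +
      u * oscillatingPart (coeffMatrix α) χ x p β t := by
  have h0 := ht 0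
  have h1 := ht 1
  have hT : β * (t 0 * t 1) ≠ 0 := mul_ne_zero hβ (mul_ne_zero h0 h1)
  simp only [oddKernel, oscillatingPart]
  rw [mul_left_comm, Finset.mul_sum, Finset.mul_sum, Complex.im_sum, Finset.mul_sum,
    ← Finset.sum_add_distrib]
  refine Finset.sum_congr rfl fun s _ => ?_
  rw [prod_chirp_eq, hA]
  have hsq : ∀ b, boolSign b ^ 2 = 1 := fun b => by rw [← sq_abs, abs_boolSign, one_pow]
  set σ : ℝ := ∏ i, boolSign (s i) with hσ
  have hσ' : σ = boolSign (s 0) * boolSign (s 1) := by rw [hσ, Fin.prod_univ_two]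
  have hσ1 : σ = 1 ∨ σ = -1 := by
    have : |σ| = 1 := by rw [hσ, Finset.abs_prod]; simp [abs_boolSign]
    exact eq_or_eq_neg_of_abs_eq this
  set G := amplitude (signFlip s (coeffMatrix α)) χ x t
  have e : (∏ i, (t i : ℂ))⁻¹ * ((u : ℂ) * Complex.exp (((-(A * x ^ 2) : ℝ) : ℂ) * Complex.I) *
      ((∏ i, (boolSign (s i) : ℂ)) * ((G : ℂ) * Complex.exp (Complex.I *
        ((A * x ^ 2 + p * (boolSign (s 1) * t 1) ^ 2 +
          β * (boolSign (s 0) * t 0 * (boolSign (s 1) * t 1)) : ℝ) : ℂ))))) =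
      ((u * (t 0 * t 1)⁻¹ * σ * G : ℝ) : ℂ) *
        Complex.exp (((p * t 1 ^ 2 + σ * (β * (t 0 * t 1)) : ℝ) : ℂ) * Complex.I) := by
    have e1 : Complex.exp (((p * t 1 ^ 2 + σ * (β * (t 0 * t 1)) : ℝ) : ℂ) * Complex.I) =
        Complex.exp (((-(A * x ^ 2) : ℝ) : ℂ) * Complex.I) *
        Complex.exp (Complex.I * ((A * x ^ 2 + p * (boolSign (s 1) * t 1) ^ 2 +
          β * (boolSign (s 0) * t 0 * (boolSign (s 1) * t 1)) : ℝ) : ℂ)) := by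
      rw [← Complex.exp_add, mul_pow, hsq, hσ']
      congr 1
      push_cast
      ring
    rw [e1, hσ']
    push_cast
    rw [Fin.prod_univ_two, Fin.prod_univ_two]
    ring
  rw [e, Complex.im_ofReal_mul, Complex.exp_ofReal_mul_I_im, Real.sinc_of_ne_zero hT,
    Real.sin_add, ← hu, show β * t 1 * t 0 = β * (t 0 * t 1) by ring]
  rcases hσ1 with h | h <;> rw [h] <;> simp <;> field_simp <;> ring

/-- The lower bound for chirps whose phases kill `x t₁`, `x t₂` and `t₁²`. -/
theorem exists_log_le_norm_nHT {m : ℕ} {α : Fin 2 → Fin m → ℝ}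
    (hα : ∀ i j, α i j ≠ 0) {θ : Fin (m + 1) → ℝ} (hθ : KillsMixedAndOneSquare α θ) :
    ∃ c c' N₀ : ℝ, 0 < c ∧ 0 < c' ∧ 1 < N₀ ∧
      ∀ N : ℝ, N₀ ≤ N → ∃ ε : ℝ, 0 < ε ∧ ε ≤ 1 / N ∧
        ∃ χ : ℝ → ℝ, IsSmoothCutoff N ε χ ∧ ∀ x : ℝ, |x| ≤ c' * N →
          c * Real.log N ≤ ‖nHT α (chirp 2 θ χ) x‖ := by
  obtain ⟨r, R, hF⟩ := exists_formBounds _ hθ.eq_zero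
  obtain ⟨A, p, β, hp, hβ, hA⟩ := hθ
  obtain ⟨L, hL0, hL⟩ := exists_isSmoothCutoff
  have hS := sineLimit_pos
  have hr := hF.r_pos
  have hne : ∀ i j, coeffMatrix α i j ≠ 0 := fun i => coeffMatrix_ne_zero (hα i)
  set a := coeffMatrix α with ha
  set C₁ : ℝ := 4 * sineLimit * (p ^ 2 + 1 / p) + 8 / (|β| * r) + 12 * R / r +
    2 * |β| * slopeConst a * R + 4 * |β| * R with hC₁
  set C₂ : ℝ := 4 * (8 * p / |β| + 2 * p * r * slopeConst a) +
    4 * R / r * ∑ j, (4 + 8 * L) * |a 0 j| / |a 1 j| with hC₂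
  -- Beyond this `N₀` the bounded terms take up at most half of the main one.
  set N₀ : ℝ := max 2 (max (1 / r) (Real.exp ((4 * C₁ + C₂) / (8 * sineLimit)))) with hN₀
  refine ⟨8 * sineLimit / (4 * sineLimit) ^ 2, r, N₀, by positivity, hr,
    lt_of_lt_of_le one_lt_two (le_max_left _ _), fun N hN => ?_⟩
  have hN2 : 2 ≤ N := (le_max_left _ _).trans hN
  have hN1 : 1 ≤ N := by linarith
  have hN0 : 0 < N := by linarith
  have hrN : 1 ≤ r * N := by
    have : 1 / r ≤ N := ((le_max_left _ _).trans (le_max_right _ _)).trans hN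
    rwa [div_le_iff₀' hr] at this
  have hlog : 4 * C₁ + C₂ ≤ 8 * sineLimit * Real.log N := by
    have h1 : Real.exp ((4 * C₁ + C₂) / (8 * sineLimit)) ≤ N :=
      ((le_max_right _ _).trans (le_max_right _ _)).trans hN
    have h2 := (Real.le_log_iff_exp_le hN0).2 h1
    rwa [div_le_iff₀' (by positivity)] at h2
  have hε0 : 0 < 1 / N := by positivity
  have hε1 : 1 / N ≤ N := ((div_le_one hN0).2 hN1).trans hN1
  obtain ⟨χ, h, hχ⟩ := hL N (1 / N) hN0 hε0
  refine ⟨1 / N, hε0, le_rfl, χ, h, fun x hx => ?_⟩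
  have hx' : |x| ≤ N := hx.trans (mul_le_of_le_one_left hN0.le hF.r_le_one)
  obtain ⟨u, hu1, hu⟩ : ∃ u : ℝ, |u| = 1 ∧ u * β = |β| := by
    rcases lt_or_gt_of_ne hβ with hβ' | hβ'
    · exact ⟨-1, by simp, by rw [abs_of_neg hβ']; ring⟩
    · exact ⟨1, by simp, by rw [abs_of_pos hβ']; ring⟩
  obtain ⟨hoI, ho⟩ := abs_integral_oscillatingPart_le hF h hne hε0 le_rfl hN1 hx hβ hp hL0 hχ
  rw [div_mul_eq_mul_div, div_le_iff₀' (by positivity)]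
  refine le_norm_nHT_chirp α θ h x
    (z := (u : ℂ) * Complex.exp (((-(A * x ^ 2) : ℝ) : ℂ) * Complex.I)) ?_ ?_
  · rw [norm_mul, Complex.norm_exp_ofReal_mul_I, mul_one, Complex.norm_real, Real.norm_eq_abs, hu1]
  filter_upwards [Filter.eventually_ge_atTop (R * N)] with ρ hρ
  set w : (Fin 2 → ℝ) → ℝ :=
    fun t => Real.cos (p * t 1 ^ 2) * (|β| * Real.sinc (β * (t 0 * t 1))) with hw
  have hwI : ∀ s : Fin 2 → Bool, Integrable fun t => w t * amplitude (signFlip s a) χ x t :=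
    fun s => integrable_mul_amplitude (hF.signFlip s) h hε1 hx' (w := w) (M := |β|)
      (Continuous.measurable (by have := Real.continuous_sinc; rw [hw]; fun_prop)) fun t => by
        rw [hw, abs_mul, abs_mul, abs_abs]
        calc _ ≤ 1 * (|β| * 1) := by
              gcongr
              · exact Real.abs_cos_le_one _
              · exact Real.abs_sinc_le_one _
          _ = |β| := by ring
  have e : ∫ t in cube 2 ρ, ((u : ℂ) * Complex.exp (((-(A * x ^ 2) : ℝ) : ℂ) * Complex.I) *
      oddKernel a (chirp 2 θ χ) x t).im = ∫ t in cube 2 ρ,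
      (∑ s : Fin 2 → Bool, w t * amplitude (signFlip s a) χ x t +
        u * oscillatingPart a χ x p β t) := by
    refine integral_congr_ae ?_
    filter_upwards [ae_cube_ne_zero ρ] with t ht
    exact im_oddKernel_chirp_of_square hA hβ hu χ x ht
  have hout : ∀ t, t ∉ cube 2 ρ → ∀ s, amplitude (signFlip s a) χ x t = 0 := fun t ht s =>
    amplitude_eq_zero_of_notMem (hF.signFlip s) h hε1 hx' fun hmem =>
      ht (mem_cube.2 fun i => (mem_cube.1 hmem i).trans hρ)
  have e2 := setIntegral_eq_integral_of_forall_compl_eq_zero (μ := volume) (s := cube 2 ρ)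
    (f := fun t => ∑ s : Fin 2 → Bool, w t * amplitude (signFlip s a) χ x t +
        u * oscillatingPart a χ x p β t) fun t ht => by
      simp only [oscillatingPart, hout t ht, mul_zero, Finset.sum_const_zero, add_zero]
  rw [e, e2, integral_add (integrable_finsetSum _ fun s _ => hwI s) (hoI.const_mul u),
    integral_finsetSum _ fun s _ => hwI s, integral_const_mul]
  have hmain : ∑ _s : Fin 2 → Bool, (4 * sineLimit * Real.log N - C₁) ≤
      ∑ s : Fin 2 → Bool, ∫ t, w t * amplitude (signFlip s a) χ x t := by
    refine Finset.sum_le_sum fun s _ => ?_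
    have := le_integral_square (hF.signFlip s) h (fun j => mul_ne_zero
      (abs_pos.1 (by rw [abs_boolSign]; exact one_pos)) (hne 0 j)) hε0.le le_rfl hN1 hrN hx hβ hp
    rwa [slopeConst_signFlip] at this
  have hosc : -C₂ ≤ u * ∫ t, oscillatingPart a χ x p β t := by
    refine (abs_le.1 ?_).1
    rw [abs_mul, hu1, one_mul]
    exact ho
  rw [Finset.sum_const, Finset.card_univ, Fintype.card_fun, Fintype.card_bool, Fintype.card_fin,
    nsmul_eq_mul] at hmain
  push_cast at hmain
  linarith

/-! ### Generic solvability of monomial interpolation -/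

/-- The vector of the monomials with exponents `e l`, evaluated at `y`. -/
def monomialVector {k T : ℕ} (e : Fin T → Fin k → ℕ) (y : Fin k → ℝ) (l : Fin T) : ℝ :=
  ∏ i, y i ^ e l i

/-- Distinct monomials are linearly independent as functions, so their joint values span. -/
lemma span_range_monomialVector {k T : ℕ} {e : Fin T → Fin k → ℕ} (he : Function.Injective e) :
    Submodule.span ℝ (Set.range (monomialVector e)) = ⊤ := by
  by_contra hne
  obtain ⟨f, hf, hker⟩ := Submodule.exists_le_ker_of_lt_top _ (lt_top_iff_ne_top.2 hne)
  refine hf ?_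
  set c : Fin T → ℝ := fun l => f (Pi.single l 1) with hc
  have hfe : ∀ v, f v = ∑ l, v l * c l := fun v => by
    rw [LinearMap.pi_apply_eq_sum_univ f v]
    refine Finset.sum_congr rfl fun l _ => ?_
    rw [smul_eq_mul, hc]
    congr 2
    ext j
    simp [Pi.single_apply, eq_comm]
  set E : Fin T → Fin k →₀ ℕ := fun l => Finsupp.equivFunOnFinite.symm (e l) with hE
  have hEinj : Function.Injective E := Finsupp.equivFunOnFinite.symm.injective.comp he
  set Q : MvPolynomial (Fin k) ℝ := ∑ l, MvPolynomial.monomial (E l) (c l) with hQ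
  have hQ0 : Q = 0 := by
    refine MvPolynomial.funext fun y => ?_
    have h0 : f (monomialVector e y) = 0 := hker (Submodule.subset_span ⟨y, rfl⟩)
    rw [hfe] at h0
    rw [hQ, map_sum, map_zero, ← h0]
    refine Finset.sum_congr rfl fun l _ => ?_
    rw [MvPolynomial.eval_monomial, Finsupp.prod_fintype _ _ fun i => pow_zero _, mul_comm]
    rfl
  have hc0 : ∀ l, c l = 0 := fun l => by
    have := congrArg (MvPolynomial.coeff (E l)) hQ0
    rw [hQ, MvPolynomial.coeff_sum, MvPolynomial.coeff_zero, Finset.sum_eq_single l] at this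
    · simpa using this
    · intro b _ hb
      rw [MvPolynomial.coeff_monomial, if_neg (hEinj.ne hb)]
    · simp
  ext l
  simpa [hc] using hc0 l

/-- The monomials with exponents `e l` at the first columns of the coefficient matrix. -/
def monomialMatrix {k m T : ℕ} (e : Fin T → Fin k → ℕ) (hT : T ≤ m + 1) (α : Fin k → Fin m → ℝ) :
    Matrix (Fin T) (Fin T) ℝ :=
  Matrix.of fun l j => monomialVector e (fun i => coeffMatrix α i (Fin.castLE hT j)) l

/-- The first column is the fixed vector of the point `(1, …, 1)`, which is nonzero and therefore
extends to a basis of monomial vectors. -/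
lemma exists_det_monomialMatrix_ne_zero {k m T : ℕ} {e : Fin T → Fin k → ℕ}
    (he : Function.Injective e) (hT : T ≤ m + 1) :
    ∃ α : Fin k → Fin m → ℝ, (monomialMatrix e hT α).det ≠ 0 := by
  rcases T with _ | T
  · exact ⟨0, by simp⟩
  have h1 : monomialVector e 1 ≠ 0 := fun h => by
    simpa [monomialVector] using congrFun h 0
  have hli : LinearIndepOn ℝ id {monomialVector e 1} := LinearIndepOn.singleton h1
  obtain ⟨b, hbt, hsb, htb, hb⟩ := exists_linearIndepOn_id_extension hli
    (t := Set.range (monomialVector e)) (by rintro _ rfl; exact ⟨1, rfl⟩)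
  have hspan : ⊤ ≤ Submodule.span ℝ (Set.range ((↑) : b → Fin (T + 1) → ℝ)) := by
    rw [Subtype.range_coe, ← span_range_monomialVector he]
    exact Submodule.span_le.2 htb
  let B : Module.Basis b ℝ (Fin (T + 1) → ℝ) := Module.Basis.mk hb hspan
  have hfin : Finite b := Module.Finite.finite_basis B
  have hcard : Nat.card b = T + 1 := by
    rw [← Module.finrank_eq_nat_card_basis B, Module.finrank_fin_fun]
  let g₀ : Fin (T + 1) ≃ b := (Finite.equivFinOfCardEq hcard).symm
  let b₀ : b := ⟨monomialVector e 1, hsb rfl⟩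
  let g : Fin (T + 1) ≃ b := (Equiv.swap 0 (g₀.symm b₀)).trans g₀
  have hg0 : (g 0 : Fin (T + 1) → ℝ) = monomialVector e 1 := by
    simp [g, b₀]
  choose y hy using fun j => hbt (g j).2
  set α : Fin k → Fin m → ℝ := fun i j =>
    if h : (j : ℕ) + 1 < T + 1 then y ⟨j + 1, h⟩ i else 0 with hα
  refine ⟨α, ?_⟩
  have hcol : ∀ j, (monomialMatrix e hT α).transpose j = g j := by
    intro j
    ext l
    rw [Matrix.transpose_apply, monomialMatrix, Matrix.of_apply]
    refine Fin.cases ?_ (fun j => ?_) j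
    · rw [hg0]
      exact congrFun (congrArg _ (funext fun i => by simp [coeffMatrix])) l
    · rw [← hy]
      congr 1
      ext i
      have e1 : Fin.castLE hT j.succ = Fin.succ ⟨j, by omega⟩ := by ext; simp
      rw [e1, coeffMatrix, Fin.cons_succ, hα]
      simp only
      rw [dif_pos (by omega)]
      rfl
  have hrows : LinearIndependent ℝ (monomialMatrix e hT α).transpose.row := by
    have : (monomialMatrix e hT α).transpose.row = fun j => ((g j : b) : Fin (T + 1) → ℝ) := by
      ext j l
      exact congrFun (hcol j) l
    rw [this]
    exact LinearIndependent.comp (v := fun x : b => (x : Fin (T + 1) → ℝ)) hb g g.injective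
  rw [← Matrix.det_transpose]
  exact ((Matrix.isUnit_iff_isUnit_det _).1
    (Matrix.linearIndependent_rows_iff_isUnit.1 hrows)).ne_zero

/-- The determinant of the monomial matrix is a nonzero polynomial in the coefficients. -/
lemma exists_polynomial_det_monomialMatrix {k m T : ℕ} {e : Fin T → Fin k → ℕ}
    (he : Function.Injective e) (hT : T ≤ m + 1) :
    ∃ P : MvPolynomial (Fin k × Fin m) ℝ, P ≠ 0 ∧ ∀ α : Fin k → Fin m → ℝ,
      MvPolynomial.eval (fun ij => α ij.1 ij.2) P = (monomialMatrix e hT α).det := by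
  set M : Matrix (Fin T) (Fin T) (MvPolynomial (Fin k × Fin m) ℝ) := Matrix.of fun l j =>
    ∏ i, (Fin.cons 1 (fun j' => MvPolynomial.X (i, j')) : Fin (m + 1) → _) (Fin.castLE hT j) ^ e l i
    with hM
  have key : ∀ α : Fin k → Fin m → ℝ,
      MvPolynomial.eval (fun ij => α ij.1 ij.2) M.det = (monomialMatrix e hT α).det := by
    intro α
    rw [RingHom.map_det]
    congr 1
    ext l j
    simp only [RingHom.mapMatrix_apply, Matrix.map_apply, hM, Matrix.of_apply, map_prod, map_pow,
      monomialMatrix, monomialVector, coeffMatrix]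
    refine Finset.prod_congr rfl fun i _ => ?_
    congr 1
    refine Fin.cases ?_ (fun j => ?_) (Fin.castLE hT j)
    · simp
    · simp
  refine ⟨M.det, fun h0 => ?_, key⟩
  obtain ⟨α, hα⟩ := exists_det_monomialMatrix_ne_zero he hT
  exact hα (by rw [← key, h0, map_zero])

/-- Coefficients for the columns which realize prescribed monomial sums. -/
lemma exists_sum_monomialVector_eq {k m T : ℕ} {e : Fin T → Fin k → ℕ} {hT : T ≤ m + 1}
    {α : Fin k → Fin m → ℝ} (h : (monomialMatrix e hT α).det ≠ 0) (w : Fin T → ℝ) :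
    ∃ θ : Fin (m + 1) → ℝ, (∀ j : Fin (m + 1), T ≤ (j : ℕ) → θ j = 0) ∧
      ∀ l, ∑ j, θ j * monomialVector e (fun i => coeffMatrix α i j) l = w l := by
  set θ' := (monomialMatrix e hT α)⁻¹.mulVec w with hθ'
  have hw : (monomialMatrix e hT α).mulVec θ' = w := by
    rw [hθ', Matrix.mulVec_mulVec, Matrix.mul_nonsing_inv _ (Ne.isUnit h), Matrix.one_mulVec]
  refine ⟨fun j => if hj : (j : ℕ) < T then θ' ⟨j, hj⟩ else 0,
    fun j hj => dif_neg (by omega), fun l => ?_⟩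
  rw [← congrFun hw l]
  symm
  refine Fintype.sum_of_injective (Fin.castLE hT) (Fin.castLE_injective hT) _ _ ?_ ?_
  · intro j hj
    have hjT : ¬ (j : ℕ) < T := fun hjT => hj ⟨⟨j, hjT⟩, by ext; simp⟩
    simp [hjT]
  · intro j
    simp [monomialMatrix, mul_comm]

/-! ### Phases for generic coefficients -/

lemma card_piAntidiag_univ (k : ℕ) :
    (Finset.piAntidiag (Finset.univ : Finset (Fin (k + 1))) k).card = Nat.centralBinom k := by
  rw [← Finset.map_sym_eq_piAntidiag, Finset.card_map, Finset.sym_univ, Finset.card_univ,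
    Sym.card_sym_eq_multichoose, Fintype.card_fin, Nat.multichoose_eq,
    Nat.centralBinom_eq_two_mul_choose]
  congr 1
  omega

lemma thresholdN_eq (k : ℕ) : thresholdN k = Nat.centralBinom k - 1 := by
  rw [thresholdN, Nat.centralBinom_eq_two_mul_choose, Nat.choose_eq_factorial_div_factorial
    (by omega), show 2 * k - k = k by omega, sq]

/-- The multinomial expansion of the phase, with the powers of the coefficients collected. -/
lemma phasePolynomial_eq_sum {k m : ℕ} (α : Fin k → Fin m → ℝ) (θ : Fin (m + 1) → ℝ) (x : ℝ)
    (t : Fin k → ℝ) :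
    phasePolynomial α θ x t = ∑ g ∈ Finset.piAntidiag (Finset.univ : Finset (Fin (k + 1))) k,
      (Nat.multinomial Finset.univ g : ℝ) * (x ^ g 0 * ∏ i, t i ^ g i.succ) *
        ∑ j, θ j * ∏ i, coeffMatrix α i j ^ g i.succ := by
  have e : ∀ j, affineForm (coeffMatrix α) x t j ^ k =
      ∑ g ∈ Finset.piAntidiag (Finset.univ : Finset (Fin (k + 1))) k,
        (Nat.multinomial Finset.univ g : ℝ) * (x ^ g 0 * ∏ i, t i ^ g i.succ) *
          ∏ i, coeffMatrix α i j ^ g i.succ := by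
    intro j
    have : affineForm (coeffMatrix α) x t j =
        ∑ i, (Fin.cons x fun i => coeffMatrix α i j * t i : Fin (k + 1) → ℝ) i := by
      rw [Fin.sum_univ_succ, affineForm]
      simp
    rw [this, Finset.sum_pow_eq_sum_piAntidiag]
    refine Finset.sum_congr rfl fun g _ => ?_
    rw [Fin.prod_univ_succ]
    simp only [Fin.cons_zero, Fin.cons_succ, mul_pow, Finset.prod_mul_distrib]
    ring
  rw [phasePolynomial_eq]
  simp_rw [e, Finset.mul_sum]
  rw [Finset.sum_comm]
  refine Finset.sum_congr rfl fun g _ => Finset.sum_congr rfl fun j _ => ?_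
  ring

/-- With at least `N(k)` functions, generic coefficients admit phases which kill all monomials
but `xᵏ` and `t₁ ⋯ tₖ`. -/
lemma exists_polynomial_killsAllButProduct {k m : ℕ} (hk : 0 < k) (hm : thresholdN k ≤ m + 1) :
    ∃ P : MvPolynomial (Fin k × Fin m) ℝ, P ≠ 0 ∧ ∀ α : Fin k → Fin m → ℝ,
      MvPolynomial.eval (fun ij => α ij.1 ij.2) P ≠ 0 →
        ∃ θ : Fin (m + 1) → ℝ, KillsAllButProduct α θ := by
  set S₀ := Finset.piAntidiag (Finset.univ : Finset (Fin (k + 1))) k with hS₀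
  set g₀ : Fin (k + 1) → ℕ := Fin.cons k 0 with hg₀
  have hsum : ∀ g ∈ S₀, g 0 + ∑ i : Fin k, g i.succ = k := fun g hg => by
    rw [← Fin.sum_univ_succ]
    exact (Finset.mem_piAntidiag.1 hg).1
  have hg₀S : g₀ ∈ S₀ := by
    rw [hS₀, Finset.mem_piAntidiag]
    exact ⟨by simp [hg₀, Fin.sum_univ_succ], fun i _ => Finset.mem_univ i⟩
  set S := S₀.erase g₀ with hS
  have hcard : S.card = thresholdN k := by
    rw [hS, Finset.card_erase_of_mem hg₀S, hS₀, card_piAntidiag_univ, thresholdN_eq]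
  set E : Fin (thresholdN k) ≃ S := (Finset.equivFinOfCardEq hcard).symm with hE
  set e : Fin (thresholdN k) → Fin k → ℕ := fun l => Fin.tail (E l : Fin (k + 1) → ℕ) with he
  have hSS : ∀ g ∈ S, g ∈ S₀ := fun g hg => Finset.mem_of_mem_erase hg
  -- The total degree is fixed, so a monomial is determined by its exponents in the `t i`.
  have htail : ∀ g ∈ S₀, ∀ g' ∈ S₀, Fin.tail g = Fin.tail g' → g = g' := by
    intro g hg g' hg' h
    have h1 : ∀ i, g (Fin.succ i) = g' (Fin.succ i) := fun i => congrFun h i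
    have h2 := hsum g hg
    have h3 := hsum g' hg'
    ext i
    refine Fin.cases ?_ h1 i
    simp_rw [h1] at h2
    omega
  have hinj : Function.Injective e := fun l l' h =>
    E.injective (Subtype.ext (htail _ (hSS _ (E l).2) _ (hSS _ (E l').2) h))
  obtain ⟨P, hP, hPe⟩ := exists_polynomial_det_monomialMatrix hinj hm
  refine ⟨P, hP, fun α hα => ?_⟩
  rw [hPe] at hα
  obtain ⟨θ, -, hθ⟩ := exists_sum_monomialVector_eq hα
    (fun l => if e l = 1 then ((k ! : ℕ) : ℝ)⁻¹ else 0)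
  have hθ' : ∀ g ∈ S, ∑ j, θ j * ∏ i, coeffMatrix α i j ^ g i.succ =
      if Fin.tail g = 1 then ((k ! : ℕ) : ℝ)⁻¹ else 0 := by
    intro g hg
    have := hθ (E.symm ⟨g, hg⟩)
    simpa [he, monomialVector, Fin.tail] using this
  refine ⟨θ, Nat.multinomial Finset.univ g₀ * ∑ j, θ j, fun x t => ?_⟩
  rw [phasePolynomial_eq_sum, ← hS₀, ← Finset.add_sum_erase S₀ _ hg₀S, ← hS]
  congr 1
  · simp [hg₀]
    ring
  · rw [Finset.sum_congr rfl fun g hg => by rw [hθ' g hg]]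
    set g₁ : Fin (k + 1) → ℕ := Fin.cons 0 1 with hg₁
    have hg₁S : g₁ ∈ S := by
      rw [hS, Finset.mem_erase, hS₀, Finset.mem_piAntidiag]
      refine ⟨fun h => ?_, by simp [hg₁, Fin.sum_univ_succ], fun i _ => Finset.mem_univ i⟩
      have := congrFun h 0
      simp [hg₁, hg₀] at this
      omega
    rw [Finset.sum_eq_single g₁]
    · have hk0 : ((k ! : ℕ) : ℝ) ≠ 0 := by exact_mod_cast Nat.factorial_ne_zero k
      have : Nat.multinomial Finset.univ g₁ = k ! := by
        simp [Nat.multinomial, hg₁, Fin.sum_univ_succ, Fin.prod_univ_succ]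
      rw [this, if_pos (by simp [hg₁])]
      simp [hg₁]
      field_simp
    · intro g hg hne
      rw [if_neg, mul_zero]
      intro h
      exact hne (htail g (hSS _ hg) g₁ (hSS _ hg₁S) (by rw [h]; simp [hg₁]))
    · exact fun h => absurd hg₁S h

/-- For `k = 2` and four functions, generic coefficients admit phases which kill `x t₁`, `x t₂`
and `t₁²`. The two determinants are those of the monomials `t₁, t₂, t₁², t₂²` and
`t₁, t₂, t₁², t₁ t₂`. -/
lemma exists_polynomial_killsMixedAndOneSquare {m : ℕ} (hm : 4 ≤ m + 1) :
    ∃ P : MvPolynomial (Fin 2 × Fin m) ℝ, P ≠ 0 ∧ ∀ α : Fin 2 → Fin m → ℝ,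
      MvPolynomial.eval (fun ij => α ij.1 ij.2) P ≠ 0 →
        ∃ θ : Fin (m + 1) → ℝ, KillsMixedAndOneSquare α θ := by
  set e₁ : Fin 4 → Fin 2 → ℕ := ![![1, 0], ![0, 1], ![2, 0], ![0, 2]] with he₁
  set e₂ : Fin 4 → Fin 2 → ℕ := ![![1, 0], ![0, 1], ![2, 0], ![1, 1]] with he₂
  have hi₁ : Function.Injective e₁ := by decide
  have hi₂ : Function.Injective e₂ := by decide
  obtain ⟨P₁, hP₁, h₁⟩ := exists_polynomial_det_monomialMatrix hi₁ hm
  obtain ⟨P₂, hP₂, h₂⟩ := exists_polynomial_det_monomialMatrix hi₂ hm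
  refine ⟨P₁ * P₂, mul_ne_zero hP₁ hP₂, fun α hα => ?_⟩
  rw [map_mul, h₁, h₂] at hα
  obtain ⟨θ, hθ0, hθ⟩ := exists_sum_monomialVector_eq (left_ne_zero_of_mul hα) ![0, 0, 0, 1]
  have q0 := hθ 0
  have q1 := hθ 1
  have q2 := hθ 2
  have q3 := hθ 3
  simp [monomialVector, he₁, Fin.prod_univ_two] at q0 q1 q2 q3
  refine ⟨θ, ∑ j, θ j, 1, 2 * ∑ j, θ j * (coeffMatrix α 0 j * coeffMatrix α 1 j), one_pos,
    fun hb => ?_, fun x t => ?_⟩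
  · -- Otherwise the phases would solve the homogeneous system of the second determinant.
    have q4 : ∑ j, θ j * (coeffMatrix α 0 j * coeffMatrix α 1 j) = 0 := by linarith
    have hz : (monomialMatrix e₂ hm α).mulVec (fun j => θ (Fin.castLE hm j)) = 0 := by
      have hs : ∀ l, (monomialMatrix e₂ hm α).mulVec (fun j => θ (Fin.castLE hm j)) l =
          ∑ j, θ j * monomialVector e₂ (fun i => coeffMatrix α i j) l := by
        intro l
        change ∑ j, monomialMatrix e₂ hm α l j * θ (Fin.castLE hm j) = _
        refine Fintype.sum_of_injective (Fin.castLE hm) (Fin.castLE_injective hm) _ _ ?_ ?_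
        · intro j hj
          rw [hθ0 j, zero_mul]
          by_contra hjT
          exact hj ⟨⟨j, by omega⟩, by ext; simp⟩
        · intro j
          rw [mul_comm]
          rfl
      ext l
      rw [hs]
      fin_cases l <;> simp [monomialVector, he₂, Fin.prod_univ_two, q0, q1, q2, q4]
    have hθz := Matrix.eq_zero_of_mulVec_eq_zero (right_ne_zero_of_mul hα) hz
    have hall : ∀ j, θ j = 0 := fun j => by
      by_cases hj : (j : ℕ) < 4
      · simpa using congrFun hθz ⟨j, hj⟩
      · exact hθ0 j (by omega)
    simp [hall] at q3
  · rw [phasePolynomial_eq]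
    have : ∀ j, θ j * affineForm (coeffMatrix α) x t j ^ 2 = x ^ 2 * θ j +
        2 * x * t 0 * (θ j * coeffMatrix α 0 j) + 2 * x * t 1 * (θ j * coeffMatrix α 1 j) +
        t 0 ^ 2 * (θ j * coeffMatrix α 0 j ^ 2) + t 1 ^ 2 * (θ j * coeffMatrix α 1 j ^ 2) +
        2 * t 0 * t 1 * (θ j * (coeffMatrix α 0 j * coeffMatrix α 1 j)) := fun j => by
      rw [affineForm, Fin.sum_univ_two]
      ring
    simp_rw [this, Finset.sum_add_distrib, ← Finset.mul_sum]
    rw [q0, q1, q2, q3]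
    ring

/-- Generic coefficients have no zero entry. -/
lemma exists_polynomial_forall_ne_zero (k m : ℕ) :
    ∃ P : MvPolynomial (Fin k × Fin m) ℝ, P ≠ 0 ∧ ∀ α : Fin k → Fin m → ℝ,
      MvPolynomial.eval (fun ij => α ij.1 ij.2) P ≠ 0 → ∀ i j, α i j ≠ 0 := by
  refine ⟨∏ ij, MvPolynomial.X ij, Finset.prod_ne_zero_iff.2 fun ij _ => MvPolynomial.X_ne_zero ij,
    fun α hα i j => ?_⟩
  rw [map_prod, Finset.prod_ne_zero_iff] at hα
  simpa using hα (i, j) (Finset.mem_univ _)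

/-! ### Logarithmic growth excludes Hölder type estimates -/

lemma eLpNorm_chirp_le {k n : ℕ} {θ : Fin n → ℝ} {N ε : ℝ} {χ : ℝ → ℝ} (h : IsSmoothCutoff N ε χ)
    (hN : 0 < N) (hε : ε ≤ N) (p : ℝ≥0∞) (j : Fin n) :
    eLpNorm (chirp k θ χ j) p volume ≤ ENNReal.ofReal ((4 * N) ^ (1 / p.toReal)) := by
  set s := Set.Icc (-(2 * N)) (2 * N) with hs
  have h1 : ∀ y, ‖chirp k θ χ j y‖ ≤ ‖s.indicator (fun _ => (1 : ℝ)) y‖ := by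
    intro y
    rw [chirp, norm_mul, mul_comm Complex.I, Complex.norm_exp_ofReal_mul_I, mul_one,
      Complex.norm_real]
    by_cases hy : y ∈ s
    · rw [Set.indicator_of_mem hy, norm_one, Real.norm_eq_abs, abs_of_nonneg (h.nonneg y)]
      exact h.le_one y
    · have : χ y = 0 := image_eq_zero_of_notMem_tsupport fun hy' => hy
        ⟨by linarith [(h.tsupport_subset hy').1], by linarith [(h.tsupport_subset hy').2]⟩
      rw [this, norm_zero]
      exact norm_nonneg _
  refine (eLpNorm_mono h1).trans ((eLpNorm_indicator_const_le (1 : ℝ) p).trans (le_of_eq ?_))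
  rw [enorm_one, one_mul, hs, Real.volume_Icc, ENNReal.ofReal_rpow_of_pos (by linarith)]
  congr 2
  ring

lemma le_eLpNorm_of_forall_abs_le {g : ℝ → ℂ} {B ρ : ℝ} (hB : 0 ≤ B) (hρ : 0 < ρ)
    (h : ∀ x, |x| ≤ ρ → B ≤ ‖g x‖) {q : ℝ≥0∞} (hq : q ≠ 0) (hq' : q ≠ ⊤) :
    ENNReal.ofReal (B * (2 * ρ) ^ (1 / q.toReal)) ≤ eLpNorm g q volume := by
  set s := Set.Icc (-ρ) ρ with hs
  have h1 : ∀ x, ‖s.indicator (fun _ => B) x‖ ≤ ‖g x‖ := by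
    intro x
    by_cases hx : x ∈ s
    · rw [Set.indicator_of_mem hx, Real.norm_eq_abs, abs_of_nonneg hB]
      exact h x (abs_le.2 hx)
    · rw [Set.indicator_of_notMem hx, norm_zero]
      exact norm_nonneg _
  refine le_trans (le_of_eq ?_) (eLpNorm_mono h1)
  rw [eLpNorm_indicator_const measurableSet_Icc hq hq', Real.volume_Icc,
    ENNReal.ofReal_mul hB, Real.enorm_eq_ofReal hB, ENNReal.ofReal_rpow_of_pos (by linarith)]
  congr 3
  ring

/-- If the operator exceeds a power of `log N` on an interval of length comparable to `N`, for
chirps which live on an interval of length comparable to `N`, then it satisfies no estimate: by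
the Hölder scaling the powers of `N` on the two sides cancel. -/
theorem satisfiesNoHolderEstimate_of_log {k m d : ℕ} {α : Fin k → Fin m → ℝ}
    {θ : Fin (m + 1) → ℝ} {c c' N₀ : ℝ} (hd : d ≠ 0) (hc : 0 < c) (hc' : 0 < c')
    (H : ∀ N, N₀ ≤ N → 1 ≤ N → ∃ ε : ℝ, ε ≤ N ∧ ∃ χ : ℝ → ℝ, IsSmoothCutoff N ε χ ∧
      ∀ x : ℝ, |x| ≤ c' * N → c * Real.log N ^ d ≤ ‖nHT α (chirp k θ χ) x‖) :
    SatisfiesNoHolderEstimate (nHT α) := by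
  rintro p q hp hq hq' hpq ⟨C, hC⟩
  set K : ℝ := (c' / 2) ^ (1 / q.toReal) with hK
  have hK0 : 0 < K := Real.rpow_pos_of_pos (by positivity) _
  have hsum : ∑ j, 1 / (p j).toReal = 1 / q.toReal := by
    have := congrArg ENNReal.toReal hpq
    rw [ENNReal.toReal_sum fun j _ => ENNReal.inv_ne_top.2 (zero_lt_one.trans (hp j)).ne'] at this
    simpa [ENNReal.toReal_inv] using this
  -- At `N = exp M` the estimate would read `c K M ^ d ≤ C`, which fails for this `M`.
  set M : ℝ := max (max 1 (Real.log (max 1 N₀))) (C / (c * K) + 1) with hM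
  have hM1 : 1 ≤ M := (le_max_left _ _).trans (le_max_left _ _)
  have hMN : max 1 N₀ ≤ Real.exp M := by
    rw [← Real.log_le_iff_le_exp (by positivity)]
    exact (le_max_right _ _).trans (le_max_left _ _)
  have hMC : C < c * K * M := by
    rw [mul_comm, ← div_lt_iff₀ (by positivity)]
    exact (lt_add_one _).trans_le (le_max_right _ _)
  set N := Real.exp M with hN
  have hN1 : 1 ≤ N := (le_max_left _ _).trans hMN
  have hN0 : 0 < N := by linarith
  obtain ⟨ε, hε, χ, h, hx⟩ := H N ((le_max_right _ _).trans hMN) hN1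
  obtain ⟨F, hF⟩ := exists_schwartz_eq_chirp h k θ
  have h1 := hC F
  have hFj : ∀ j, ⇑(F j) = chirp k θ χ j := fun j => congrFun hF j
  simp_rw [hFj] at h1
  have hlow : ENNReal.ofReal (c * M ^ d * (2 * (c' * N)) ^ (1 / q.toReal)) ≤
      eLpNorm (nHT α (chirp k θ χ)) q volume :=
    le_eLpNorm_of_forall_abs_le (by positivity) (by positivity)
      (fun x hx' => by simpa [hN] using hx x hx') hq.ne' hq'.ne
  have hup : (C : ℝ≥0∞) * ∏ j, eLpNorm (chirp k θ χ j) (p j) volume ≤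
      ENNReal.ofReal (C * (4 * N) ^ (1 / q.toReal)) := by
    rw [ENNReal.ofReal_mul C.coe_nonneg, ENNReal.ofReal_coe_nnreal, ← hsum,
      Real.rpow_sum_of_pos (by positivity),
      ENNReal.ofReal_prod_of_nonneg fun j _ => by positivity]
    gcongr with j _
    exact eLpNorm_chirp_le h hN0 hε (p j) j
  have hfin := (ENNReal.ofReal_le_ofReal_iff (by positivity)).1 (hlow.trans (h1.trans hup))
  rw [show 2 * (c' * N) = c' / 2 * (4 * N) by ring, Real.mul_rpow (by positivity) (by positivity),
    ← hK, ← mul_assoc] at hfin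
  have h2 := le_of_mul_le_mul_right hfin (by positivity)
  have h3 : M ≤ M ^ d := le_self_pow₀ hM1 hd
  have h4 : c * K * M ≤ c * M ^ d * K := by
    calc c * K * M ≤ c * K * M ^ d := by gcongr
      _ = _ := by ring
  linarith

/-! ### Failure of the estimates for generic coefficients -/

theorem mainTheorem2 :
    (∀ k : ℕ, 2 ≤ k → ∀ m : ℕ, thresholdN k ≤ m + 1 →
      ForGeneric fun α : Fin k → Fin m → ℝ =>
        SatisfiesNoHolderEstimate (nHT α) ∧
        (∃ θ : Fin (m + 1) → ℝ, KillsAllButProduct α θ) ∧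
        ∀ θ : Fin (m + 1) → ℝ, KillsAllButProduct α θ →
          ∃ c c' N₀ : ℝ, 0 < c ∧ 0 < c' ∧ 1 < N₀ ∧
            ∀ N : ℝ, N₀ ≤ N → ∀ ε : ℝ, 0 < ε → ε ≤ 1 / N ^ (k - 1) →
              ∀ χ : ℝ → ℝ, IsSmoothCutoff N ε χ → ∀ x : ℝ, |x| ≤ c' * N →
                c * Real.log N ^ (k - 1) ≤ ‖nHT α (chirp k θ χ) x‖) ∧
    (ForGeneric fun α : Fin 2 → Fin 3 → ℝ =>
      SatisfiesNoHolderEstimate (nHT α) ∧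
      (∃ θ : Fin 4 → ℝ, KillsMixedAndOneSquare α θ) ∧
      ∀ θ : Fin 4 → ℝ, KillsMixedAndOneSquare α θ →
        ∃ c c' N₀ : ℝ, 0 < c ∧ 0 < c' ∧ 1 < N₀ ∧
          ∀ N : ℝ, N₀ ≤ N → ∃ ε : ℝ, 0 < ε ∧ ε ≤ 1 / N ∧
            ∃ χ : ℝ → ℝ, IsSmoothCutoff N ε χ ∧ ∀ x : ℝ, |x| ≤ c' * N →
              c * Real.log N ≤ ‖nHT α (chirp 2 θ χ) x‖) := by
  constructor
  · intro k hk m hm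
    obtain ⟨d, rfl⟩ : ∃ d, k = d + 1 := ⟨k - 1, by omega⟩
    have hd : 0 < d := by omega
    obtain ⟨P, hP, hPα⟩ := exists_polynomial_killsAllButProduct (Nat.succ_pos d) hm
    obtain ⟨Q, hQ, hQα⟩ := exists_polynomial_forall_ne_zero (d + 1) m
    refine ⟨P * Q, mul_ne_zero hP hQ, fun α hα => ?_⟩
    rw [map_mul] at hα
    obtain ⟨θ, hθ⟩ := hPα α (left_ne_zero_of_mul hα)
    have hα0 := hQα α (right_ne_zero_of_mul hα)
    have key := fun θ (hθ : KillsAllButProduct α θ) => exists_log_pow_le_norm_nHT hd (hα0 0) hθ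
    refine ⟨?_, ⟨θ, hθ⟩, key⟩
    obtain ⟨c, c', N₀, hc, hc', -, H⟩ := key θ hθ
    obtain ⟨L, -, hL⟩ := exists_isSmoothCutoff
    refine satisfiesNoHolderEstimate_of_log hd.ne' hc hc' (N₀ := N₀) (θ := θ) fun N hN hN1 => ?_
    have hε : 0 < 1 / N ^ d := by positivity
    obtain ⟨χ, h, -⟩ := hL N (1 / N ^ d) (by linarith) hε
    refine ⟨1 / N ^ d, le_trans ?_ hN1, χ, h, H N hN _ hε le_rfl χ h⟩
    rw [div_le_one (by positivity)]
    exact one_le_pow₀ hN1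
  · obtain ⟨P, hP, hPα⟩ := exists_polynomial_killsMixedAndOneSquare (m := 3) le_rfl
    obtain ⟨Q, hQ, hQα⟩ := exists_polynomial_forall_ne_zero 2 3
    refine ⟨P * Q, mul_ne_zero hP hQ, fun α hα => ?_⟩
    rw [map_mul] at hα
    obtain ⟨θ, hθ⟩ := hPα α (left_ne_zero_of_mul hα)
    have hα0 := hQα α (right_ne_zero_of_mul hα)
    have key := fun θ (hθ : KillsMixedAndOneSquare α θ) => exists_log_le_norm_nHT hα0 hθ
    refine ⟨?_, ⟨θ, hθ⟩, key⟩
    obtain ⟨c, c', N₀, hc, hc', -, H⟩ := key θ hθ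
    refine satisfiesNoHolderEstimate_of_log one_ne_zero hc hc' (N₀ := N₀) (θ := θ)
      fun N hN hN1 => ?_
    obtain ⟨ε, -, hεN, χ, h, hx⟩ := H N hN
    refine ⟨ε, hεN.trans (((div_le_one (by linarith)).2 hN1).trans hN1), χ, h, ?_⟩
    simpa using hx
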